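/- **Theorem C.** Let $r\ge 2$ ($r\in\mathbb N\cup\{\infty\}$), let $D\subset\mathbb R^n$ be open and $I\subset\mathbb R$, and let $f:D\to\mathbb R^n$ and $g:I\times D\to\mathbb R^n$ be of class $C^r$. Suppose that $\dot z=f(z)$ has a non-constant $T$-periodic solution $\varphi:\mathbb R\to D$, $T>0$. Let $\Psi(t)$ be the fundamental matrix solution of the variational equation $\dot y=Df(\varphi(t))\,y$ with $\Psi(0)=I_n$, and let $d$ be the A-index of this equation: the sum of the sizes of the Jordan blocks with a negative real eigenvalue that occur an odd number of times in the Jordan normal form of a monodromy matrix $\Phi(0)^{-1}\Phi(T)$ ($\Phi$ any fundamental matrix solution), each kind of block counted once. Then there is a largest $q\in\mathbb N=\{0,1,2,\dots\}$ for which $(\Psi(T)-I_n)^q x=\varphi'(0)$ has a solution $x\in\mathbb R^n$; denote it by $q_0$. It satisfies $q_0\le n-d-1$ (in particular $d\le n-1$), and there is a real $C^r$ matrix function $U:\mathbb R\to\mathbb R^{n\times(n-1)}$ with $$U(t+T)=U(t)\,[I_{n-d-1}\oplus(-I_d)]\qquad\text{for all } t\in\mathbb R,$$ and there is $\varepsilon>0$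 such that on the set of all $(s,v,w)\in\mathbb R\times\mathbb R^{n-d-1}\times\mathbb R^d$ with $\|(v,w)\|<\varepsilon$ the map $$z=\varphi(s)+U(s)\begin{bmatrix}v\\w\end{bmatrix}$$ is a local $C^r$ diffeomorphism into $D$, and this change of variables transforms the system $\dot z=f(z)+g(t,z)$ into $$\begin{aligned}\dot s&=1+L v+\Lambda_0(s,v,w)+\tilde\Lambda_0(t,s,v,w),\\ \dot v&=H_1v+\Lambda_1(s,v,w)+\tilde\Lambda_1(t,s,v,w),\\ \dot w&=H_2w+\Lambda_2(s,v,w)+\tilde\Lambda_2(t,s,v,w),\end{aligned}$$ where $H_1\in\mathbb R^{(n-d-1)\times(n-d-1)}$, $H_2\in\mathbb R^{d\times d}$, $L\in\mathbb R^{1\times(n-d-1)}$, and, for $\|(v,w)\|<\varepsilon$, $s\in\mathbb R$, $t\in I$: 1. If $\lambda_1,\dots,\lambda_{n-1}\in\mathbb C$ are the eigenvalues, with multiplicity, of the derivative at the orbit of a Poincaré map of $\varphi$ (the return map, with return time close to $T$, of a hyperplane section transversal to the orbit; it is differentiable at its fixed point on the orbit), then the real parts of the eigenvalues of $H_1\oplus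 H_2$, with multiplicity, are $\frac1T\log|\lambda_\ell|$, $\ell=1,\dots,n-1$. 2. $\Lambda_\ell(s,0,0)=0$ and $\frac{\partial\Lambda_\ell}{\partial(v,w)}(s,0,0)=0$ for $\ell\in\{0,1,2\}$. 3. $\Lambda_\ell(s+T,v,w)=\Lambda_\ell(s,v,-w)$ and $\tilde\Lambda_\ell(t,s+T,v,w)=\tilde\Lambda_\ell(t,s,v,-w)$ for $\ell\in\{0,1\}$. 4. $\Lambda_2(s+T,v,w)=-\Lambda_2(s,v,-w)$ and $\tilde\Lambda_2(t,s+T,v,w)=-\tilde\Lambda_2(t,s,v,-w)$. 5. There is $C>0$, independent of $(t,s,v,w)$, with $\|\tilde\Lambda_\ell(t,s,v,w)\|\le C\,\bigl\|g\bigl(t,\varphi(s)+U(s)\begin{bmatrix}v\\w\end{bmatrix}\bigr)\bigr\|$ for $\ell\in\{0,1,2\}$. 6. $L=[L_1\ \cdots\ L_{q_0}\ 0\ \cdots\ 0]$; in particular $L=0$ if $q_0=0$. -/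

import Mathlib

namespace FloquetForm

/-- The upper triangular Jordan block of size `k` with eigenvalue `μ`. -/
def jordanBlock (K : Type*) [Field K] (k : ℕ) (μ : K) : Matrix (Fin k) (Fin k) K :=
  Matrix.of fun i j => if i = j then μ else if (i : ℕ) + 1 = j then 1 else 0

/-- The number of Jordan blocks of size `k` (for `1 ≤ k`) with eigenvalue `μ` in the Jordan normal
form of `M`, expressed through the ranks of the powers of `M - μ I`; the theorem
`numJordanBlocks_eq` below shows that this is the literal count of blocks. The subtraction never
truncates. -/
noncomputable def numJordanBlocks {K : Type*} [Field K] {n : ℕ}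
    (M : Matrix (Fin n) (Fin n) K) (μ : K) (k : ℕ) : ℕ :=
  ((M - Matrix.scalar (Fin n) μ) ^ (k - 1)).rank + ((M - Matrix.scalar (Fin n) μ) ^ (k + 1)).rank
    - 2 * ((M - Matrix.scalar (Fin n) μ) ^ k).rank

theorem exists_mul_mul_eq_diagonal {K : Type*} [Field K] {m : Type*} [Fintype m] [DecidableEq m]
    (M : Matrix m m K) : ∃ (A B : Matrix m m K) (w : m → K),
      IsUnit A.det ∧ IsUnit B.det ∧ A * M * B = Matrix.diagonal w := by
  obtain ⟨V, U, e, hV, hU, h⟩ := Matrix.exists_rank_normal_form M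
  refine ⟨V, U, Sum.elim 1 0 ∘ e, (Matrix.isUnit_iff_isUnit_det _).1 hV,
    (Matrix.isUnit_iff_isUnit_det _).1 hU, ?_⟩
  rw [h, ← Matrix.diagonal_one, ← Matrix.diagonal_zero, Matrix.fromBlocks_diagonal,
    Matrix.submatrix_diagonal_equiv]
  congr 1

/-- The rank of a matrix does not change under a field extension. -/
theorem rank_mapMatrix_algebraMap {F K : Type*} [Field F] [Field K] [Algebra F K] {n : ℕ}
    (M : Matrix (Fin n) (Fin n) F) : (M.map (algebraMap F K)).rank = M.rank := by
  classical
  obtain ⟨A, B, w, hA, hB, h⟩ := exists_mul_mul_eq_diagonal M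
  have hd : ∀ C : Matrix (Fin n) (Fin n) F, IsUnit C.det →
      IsUnit (C.map (algebraMap F K)).det := by
    intro C hC
    have := hC.map (algebraMap F K)
    rwa [RingHom.map_det] at this
  rw [← Matrix.rank_mul_eq_right_of_isUnit_det A M hA,
    ← Matrix.rank_mul_eq_left_of_isUnit_det B (A * M) hB, h,
    ← Matrix.rank_mul_eq_right_of_isUnit_det _ (M.map (algebraMap F K)) (hd A hA),
    ← Matrix.rank_mul_eq_left_of_isUnit_det _ (_ * _) (hd B hB), ← Matrix.map_mul,
    ← Matrix.map_mul, h, Matrix.diagonal_map (map_zero _), Matrix.rank_diagonal,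
    Matrix.rank_diagonal]
  simp

/-- The rank of a block diagonal matrix is the sum of the ranks of its blocks. -/
theorem rank_blockDiag {K : Type*} [Field K] {ι : Type*} [Fintype ι] [DecidableEq ι]
    (k : ι → ℕ) (M : ∀ i, Matrix (Fin (k i)) (Fin (k i)) K) :
    (Matrix.blockDiagonal' M).rank = ∑ i, (M i).rank := by
  classical
  choose A B w hA hB h using fun i => exists_mul_mul_eq_diagonal (M i)
  have hd : ∀ C : ∀ i, Matrix (Fin (k i)) (Fin (k i)) K, (∀ i, IsUnit (C i).det) →
      IsUnit (Matrix.blockDiagonal' C).det := by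
    intro C hC
    refine (Matrix.isUnit_iff_isUnit_det _).1 ?_
    have hu : IsUnit C := Pi.isUnit_iff.2 fun i => (Matrix.isUnit_iff_isUnit_det _).2 (hC i)
    exact hu.map (Matrix.blockDiagonal'RingHom (fun i => Fin (k i)) K)
  rw [← Matrix.rank_mul_eq_right_of_isUnit_det _ _ (hd A hA),
    ← Matrix.rank_mul_eq_left_of_isUnit_det _ (_ * _) (hd B hB), ← Matrix.blockDiagonal'_mul,
    ← Matrix.blockDiagonal'_mul]
  simp only [h]
  rw [Matrix.blockDiagonal'_diagonal, Matrix.rank_diagonal]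
  have : ∀ i, (M i).rank = Fintype.card {j // w i j ≠ 0} := by
    intro i
    rw [← Matrix.rank_mul_eq_right_of_isUnit_det _ _ (hA i),
      ← Matrix.rank_mul_eq_left_of_isUnit_det _ (_ * _) (hB i), h, Matrix.rank_diagonal]
  simp only [this, Fintype.card_subtype]
  rw [Finset.card_filter, Fintype.sum_sigma]
  simp only [Finset.card_filter]

theorem pow_shift {K : Type*} [Field K] (k q : ℕ) (i j : Fin k) :
    (jordanBlock K k 0 ^ q) i j = if (i : ℕ) + q = j then 1 else 0 := by
  induction q generalizing i j with
  | zero => simp [Matrix.one_apply, Fin.ext_iff]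
  | succ q ih =>
    rw [pow_succ, Matrix.mul_apply]
    simp only [ih]
    have hne : ∀ a b : Fin k, jordanBlock K k 0 a b = if (a : ℕ) + 1 = b then 1 else 0 := by
      intro a b
      by_cases h : a = b
      · subst h; simp [jordanBlock]
      · simp [jordanBlock, h]
    simp only [hne, ite_mul, one_mul, zero_mul]
    by_cases h : (i : ℕ) + q < k
    · rw [Finset.sum_eq_single (⟨i + q, h⟩ : Fin k)]
      · simp [add_assoc]
      · intro b _ hb
        rw [if_neg]
        intro h'; apply hb; ext; simp [← h']
      · simp
    · rw [if_neg (by omega)]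
      apply Finset.sum_eq_zero
      intro x _
      rw [if_neg (by omega)]

theorem rank_jordan_pow {K : Type*} [Field K] (k q : ℕ) (μ ν : K) [Decidable (μ = ν)] :
    ((jordanBlock K k μ - Matrix.scalar (Fin k) ν) ^ q).rank = if μ = ν then k - q else k := by
  have hsub : jordanBlock K k μ - Matrix.scalar (Fin k) ν = jordanBlock K k (μ - ν) := by
    ext i j
    by_cases h : i = j
    · subst h; simp [jordanBlock]
    · simp [jordanBlock, h]
  rw [hsub]
  split_ifs with h
  · rw [h, sub_self]
    apply le_antisymm
    · refine (Matrix.rank_le_card_of_support_subset (jordanBlock K k 0 ^ q)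
        (Finset.univ.filter fun i : Fin k => (i : ℕ) < k - q) ?_).trans ?_
      · intro i hi
        simp only [Finset.coe_filter, Finset.mem_univ, true_and, Set.mem_ofPred_eq]
        by_contra hlt
        apply hi
        funext j
        rw [Matrix.row, pow_shift, if_neg (by omega)]
        rfl
      · rw [Fin.card_filter_val_lt]
        omega
    · have := Matrix.rank_submatrix_le (jordanBlock K k 0 ^ q)
        (fun i : Fin (k - q) => (⟨i, by omega⟩ : Fin k))
        (fun i : Fin (k - q) => (⟨i + q, by omega⟩ : Fin k))
      refine le_trans (le_of_eq ?_) this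
      rw [show (jordanBlock K k 0 ^ q).submatrix _ _ = 1 from ?_, Matrix.rank_one,
        Fintype.card_fin]
      ext i j
      rw [Matrix.submatrix_apply, pow_shift, Matrix.one_apply]
      simp [Fin.ext_iff]
  · have hdet : (jordanBlock K k (μ - ν)).det ≠ 0 := by
      rw [Matrix.det_of_isUpperTriangular]
      · simp [jordanBlock, Finset.prod_const, sub_ne_zero.2 h]
      · intro i j hij
        simp only [id] at hij
        simp [jordanBlock, hij.ne', show ¬ ((i : ℕ) + 1 = j) by have : (j:ℕ) < i := hij; omega]
    rw [Matrix.rank_of_det_ne_zero]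
    · simp
    · rw [Matrix.det_pow]; exact pow_ne_zero _ hdet

/-- If, over a field extension `K` of `F` (such as `ℂ` over `ℝ`), the matrix `M` is similar to a
block diagonal matrix of Jordan blocks, then `numJordanBlocks M ν q` is the number of those blocks
that have size `q` and eigenvalue `ν`. -/
theorem numJordanBlocks_eq {F K : Type*} [Field F] [Field K] [DecidableEq K] [Algebra F K] {n : ℕ}
    (M : Matrix (Fin n) (Fin n) F) {ι : Type*} [Fintype ι] [DecidableEq ι] (k : ι → ℕ) (μ : ι → K)
    (e : (Σ i, Fin (k i)) ≃ Fin n) (P : Matrix (Fin n) (Fin n) K) (hP : IsUnit P.det)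
    (h : M.map (algebraMap F K) =
      P * Matrix.reindex e e (Matrix.blockDiagonal' fun i => jordanBlock K (k i) (μ i)) * P⁻¹)
    (ν : F) (q : ℕ) (hq : 1 ≤ q) :
    numJordanBlocks M ν q = Fintype.card {i // μ i = algebraMap F K ν ∧ k i = q} := by
  have key : ∀ p, ((M - Matrix.scalar (Fin n) ν) ^ p).rank =
      ∑ i, if μ i = algebraMap F K ν then k i - p else k i := by
    intro p
    have h1 : ((M - Matrix.scalar (Fin n) ν) ^ p).map (algebraMap F K) =
        P * (Matrix.reindexAlgEquiv K K e (Matrix.blockDiagonal' fun i =>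
          (jordanBlock K (k i) (μ i) - Matrix.scalar (Fin (k i)) (algebraMap F K ν)) ^ p)) * P⁻¹ := by
      have hb : (Matrix.blockDiagonal' fun i =>
          (jordanBlock K (k i) (μ i) - Matrix.scalar (Fin (k i)) (algebraMap F K ν)) ^ p) =
          ((Matrix.blockDiagonal' fun i => jordanBlock K (k i) (μ i)) -
            Matrix.scalar _ (algebraMap F K ν)) ^ p := by
        have := Matrix.blockDiagonal'_pow (fun i =>
          (jordanBlock K (k i) (μ i) - Matrix.scalar (Fin (k i)) (algebraMap F K ν))) p
        refine Eq.trans this ?_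
        congr 1
        have h2 := Matrix.blockDiagonal'_sub (fun i => jordanBlock K (k i) (μ i))
          (fun i => Matrix.scalar (Fin (k i)) (algebraMap F K ν))
        refine Eq.trans h2 ?_
        congr 1
        simp only [Matrix.scalar_apply]
        rw [Matrix.blockDiagonal'_diagonal]
      rw [hb, map_pow, map_sub]
      clear hb
      have hs : Matrix.reindexAlgEquiv K K e (Matrix.scalar _ (algebraMap F K ν)) =
          Matrix.scalar (Fin n) (algebraMap F K ν) := by
        ext i j
        simp [Matrix.diagonal_apply]
      have hPP : P⁻¹ * P = 1 := Matrix.nonsing_inv_mul P hP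
      have hPP' : P * P⁻¹ = 1 := Matrix.mul_nonsing_inv P hP
      have hconj : ∀ X : Matrix (Fin n) (Fin n) K, P * X ^ p * P⁻¹ = (P * X * P⁻¹) ^ p := by
        intro X
        induction p with
        | zero => simp [hPP']
        | succ p ih =>
          rw [pow_succ, pow_succ, ← ih]
          simp only [Matrix.mul_assoc]
          rw [← Matrix.mul_assoc P⁻¹ P, hPP, Matrix.one_mul]
      rw [hconj, hs]
      have hm : ((M - Matrix.scalar (Fin n) ν) ^ p).map (algebraMap F K) =
          (M.map (algebraMap F K) - Matrix.scalar (Fin n) (algebraMap F K ν)) ^ p := by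
        have := map_pow (algebraMap F K).mapMatrix (M - Matrix.scalar (Fin n) ν) p
        rw [map_sub] at this
        refine Eq.trans this ?_
        congr 2
        ext i j
        simp [Matrix.diagonal_apply, apply_ite (algebraMap F K)]
      rw [hm, h]
      congr 1
      rw [mul_sub, sub_mul]
      congr 1
      rw [← (Matrix.scalar_commute (algebraMap F K ν) (fun r => mul_comm _ r) P).eq,
        Matrix.mul_assoc, hPP', Matrix.mul_one]
    rw [← rank_mapMatrix_algebraMap (K := K), h1, Matrix.rank_mul_eq_left_of_isUnit_det _ _
      (by rw [Matrix.det_nonsing_inv]; exact hP.ringInverse),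
      Matrix.rank_mul_eq_right_of_isUnit_det _ _ hP, Matrix.coe_reindexAlgEquiv,
      Matrix.rank_reindex, rank_blockDiag]
    exact Finset.sum_congr rfl fun i _ => rank_jordan_pow _ _ _ _
  unfold numJordanBlocks
  rw [key, key, key, Fintype.card_subtype, Finset.card_filter, Finset.mul_sum,
    ← Finset.sum_add_distrib]
  have : ∀ i, ((if μ i = algebraMap F K ν then k i - (q - 1) else k i) +
      if μ i = algebraMap F K ν then k i - (q + 1) else k i) =
      2 * (if μ i = algebraMap F K ν then k i - q else k i) +
        if μ i = algebraMap F K ν ∧ k i = q then 1 else 0 := by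
    intro i
    by_cases h : μ i = algebraMap F K ν
    · simp only [h, if_true, true_and]
      split_ifs <;> omega
    · simp only [h, if_false, false_and]; omega
  rw [Finset.sum_congr rfl fun i _ => this i, Finset.sum_add_distrib]
  omega

/-- Real `n`-space with its Euclidean norm. -/
abbrev Vec (n : ℕ) : Type := EuclideanSpace ℝ (Fin n)

/-- The sum of the sizes of the Jordan blocks of `M` that have a negative real eigenvalue and occur
an odd number of times in the Jordan normal form, each kind of block counted once. -/
noncomputable def antiperiodicityIndex {n : ℕ} (M : Matrix (Fin n) (Fin n) ℝ) : ℕ :=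
  ∑ μ ∈ M.charpoly.roots.toFinset with μ < 0,
    ∑ k ∈ Finset.Icc 1 n with Odd (numJordanBlocks M μ k), k

/-- `Φ` is a (real) fundamental matrix solution of `x' = A(t) x`. -/
def IsFundamentalMatrix {n : ℕ} (A Φ : ℝ → Matrix (Fin n) (Fin n) ℝ) : Prop :=
  (∀ t i j, HasDerivAt (fun u => Φ u i j) ((A t * Φ t) i j) t) ∧ ∀ t, IsUnit (Φ t)

/-- `d` is the A-index of the `T`-periodic system `x' = A(t) x`, that is, the antiperiodicity index
of a monodromy matrix `Φ(0)⁻¹ Φ(T)`. All monodromy matrices of a system are similar. -/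
def IsAIndex {n : ℕ} (A : ℝ → Matrix (Fin n) (Fin n) ℝ) (T : ℝ) (d : ℕ) : Prop :=
  ∃ Φ, IsFundamentalMatrix A Φ ∧ antiperiodicityIndex ((Φ 0)⁻¹ * Φ T) = d

/-- The Jacobian matrix of `f` at `z`. -/
noncomputable def jacobian {n : ℕ} (f : Vec n → Vec n)
    (z : Vec n) : Matrix (Fin n) (Fin n) ℝ :=
  Matrix.of fun i j => fderiv ℝ f z (EuclideanSpace.single j 1) i

/-- `γ` solves `z' = f(z)` in the domain `D` on the set of times `J`. -/
def IsSolutionOn {n : ℕ} (f : Vec n → Vec n)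
    (D : Set (Vec n)) (γ : ℝ → Vec n) (J : Set ℝ) : Prop :=
  ∀ t ∈ J, γ t ∈ D ∧ HasDerivWithinAt γ (f (γ t)) J t

/-- `P` is a Poincaré map of the orbit of `z' = f(z)` that passes through the point `p` and returns
to it after the time `T`, on the hyperplane section `p + E`: for all small `x ∈ E`, the solution
that starts at `p + x` meets the section again at `p + P x`, after a time `τ x` which tends to `T`
as `x → 0`. -/
def IsPoincareMap {n : ℕ} (f : Vec n → Vec n)
    (D : Set (Vec n)) (p : Vec n) (T : ℝ)
    (E : Submodule ℝ (Vec n)) (P : E → E) : Prop :=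
  ∃ τ : E → ℝ, τ 0 = T ∧ ContinuousAt τ 0 ∧ ∀ᶠ x in nhds (0 : E), 0 < τ x ∧
    ∃ γ : ℝ → Vec n, IsSolutionOn f D γ (Set.Icc 0 (τ x)) ∧
      γ 0 = p + x ∧ γ (τ x) = p + P x

/-- The matrix-vector product, on Euclidean spaces. -/
noncomputable def mulE {m n : Type*} [Fintype n] (M : Matrix m n ℝ) (x : EuclideanSpace ℝ n) :
    EuclideanSpace ℝ m :=
  WithLp.toLp 2 (M.mulVec x.ofLp)

/-- The map `(s, v, w) ↦ φ(s) + U(s) [v; w]`. -/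
noncomputable def tubeMap {n a b : ℕ} (φ : ℝ → Vec n)
    (U : ℝ → Matrix (Fin n) (Fin a ⊕ Fin b) ℝ)
    (p : ℝ × Vec a × Vec b) : Vec n :=
  φ p.1 + mulE (U p.1) (WithLp.toLp 2 (Sum.elim p.2.1.ofLp p.2.2.ofLp))

/-- The change of variables `z = X(p)`, `p ∈ Ω`, transforms the system `z' = F(t, z)`, `z ∈ D`,
`t ∈ I`, into the system `p' = G(t, p)`: the map `X` is a local `C^r` diffeomorphism from the open
set `Ω` into `D`, its derivative carries the vector field `G(t, ·)` to `F(t, ·)`, and a continuous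
curve in `Ω` solves the new system if and only if its image solves the original one. -/
structure TransformsSystem {P Z : Type*} [NormedAddCommGroup P] [NormedSpace ℝ P]
    [NormedAddCommGroup Z] [NormedSpace ℝ Z] (r : WithTop ℕ∞) (X : P → Z) (Ω : Set P) (D : Set Z)
    (I : Set ℝ) (F : ℝ → Z → Z) (G : ℝ → P → P) : Prop where
  isOpen : IsOpen Ω
  mapsTo : Set.MapsTo X Ω D
  contDiffOn : ContDiffOn ℝ r X Ω
  pushforward : ∀ p ∈ Ω, ∃ e : P ≃L[ℝ] Z, HasFDerivAt X (e : P →L[ℝ] Z) p ∧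
    ∀ t ∈ I, e (G t p) = F t (X p)
  solutions : ∀ J ⊆ I, ∀ c : ℝ → P, ContinuousOn c J → Set.MapsTo c J Ω →
    ((∀ t ∈ J, HasDerivWithinAt (fun u => X (c u)) (F t (X (c t))) J t) ↔
      ∀ t ∈ J, HasDerivWithinAt c (G t (c t)) J t)

end FloquetForm

/-! This is Floquet theory over the reals, with the period `T` kept at the price of a reflection. A
real monodromy matrix `M = Ψ(T)` need not have a real logarithm: the obstruction is a Jordan block
with a negative eigenvalue that occurs an odd number of times. A pair `N ⊕ N` of equal negative
blocks does have one, because `-1 = exp(πJ)` for a matrix `J` with `J² = -1` on the doubled space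
that commutes with `Q ⊕ Q`, where `exp Q = -N`. One copy of each kind of block with odd count is
left over; these fill a space of dimension `d`, on which `-M` has a logarithm
(`exists_antiperiodic_decomposition`). Hence `M S = S R exp(T B)`, where `R = 1 ⊕ I ⊕ (-I_d)`
commutes with `B` (`exists_normal_form`).

The fixed vector `u = φ'(0)` of `M` lies in the part `Mp` that has a real logarithm, and is the
first column of `S`. The logarithm is chosen so that it kills fixed vectors and fixed covectors. So
the first column of `B` is zero, and its first row is `[0 L 0]`. The next columns of `S` span the
kernel of a covector `l` with `l u = 1` and are adapted to the functional that gives `L`, so that at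
most the first entry of `L` survives. If `q₀ = 0`, then `u` is not in the range of `Mp - 1`, `l` can
be a left fixed vector, and `L = 0`. The bound on `q₀` comes from the kernels of the powers of `Mp -
1` on a space of dimension `n - d`.

The frame `Z(t) = Ψ(t) S exp(-tB)` satisfies `Z(t + T) = Z(t) R` and `Z' = Df(φ) Z - Z B`, and its
first column is `f(φ)` (`isFloquetFrame_frameMatrix`). The other columns form `U`. The equation for
`Z` says that the tube map carries the linear part of the normal form to `f` up to an error `o(‖(v,
w)‖)` (`hasFDerivAt_remainder`). Compactness of one period and the symmetry give a tube of uniform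
thickness and a uniform bound for the inverse derivative (`exists_tube`).

For the eigenvalues, the derivative of a Poincaré map is the monodromy operator modulo the direction
of the flow (`differentiableAt_poincareMap`), so its characteristic polynomial times `X - 1` is that
of `M`. The normal form factors the latter as `X - 1` times the polynomials of `exp(T H₁)` and
`-exp(T H₂)`, whose eigenvalues have the moduli `exp(T Re z)`. -/

namespace FloquetForm

open Matrix NormedSpace

/-! ### Logarithms in a Banach algebra. -/

section BanachLog

variable {𝔸 : Type*} [NormedRing 𝔸] [NormedAlgebra ℝ 𝔸] [CompleteSpace 𝔸]

/-- The chain rule for the exponential along a curve that commutes with its own past. -/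
theorem hasDerivAt_exp_of_commute {L : ℝ → 𝔸} {L' : 𝔸} {t : ℝ} (h : HasDerivAt L L' t)
    (hc : ∀ u, Commute (L t) (L u)) :
    HasDerivAt (fun u => exp (L u)) (exp (L t) * L') t := by
  -- Commutation gives `exp(L u) = exp(L t) exp(L u - L t)`, so only the derivative of `exp` at `0`
  -- is needed.
  have h0 : HasDerivAt (fun u => exp (L u - L t)) L' t := by
    have hs : HasFDerivAt (exp : 𝔸 → 𝔸) (1 : 𝔸 →L[ℝ] 𝔸) (L t - L t) := by
      rw [sub_self]; exact hasStrictFDerivAt_exp_zero.hasFDerivAt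
    have := hs.comp_hasDerivAt t (h.sub_const (L t))
    simpa using! this
  have h1 := h0.const_mul (exp (L t))
  refine h1.congr_of_eventuallyEq (Filter.Eventually.of_forall fun u => ?_)
  have : Commute (L t) (L u - L t) := (hc u).sub_right (Commute.refl _)
  let _ : NormedAlgebra ℚ 𝔸 := NormedAlgebra.restrictScalars ℚ ℝ 𝔸
  show exp (L u) = exp (L t) * exp (L u - L t)
  rw [← NormedSpace.exp_add_of_commute this, add_sub_cancel]

/-- A logarithm of `A` in a Banach algebra, when the segment from `1` to `A` consists of units. It
is annihilated by all continuous linear maps that annihilate the multiples `(A - 1) * X`, for the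
`X` that commute with the commutant of `A`. -/
theorem exists_exp_eq_of_segment (A : 𝔸) (hA : ∀ s ∈ Set.Icc (0 : ℝ) 1, IsUnit (1 + s • (A - 1))) :
    ∃ B : 𝔸, exp B = A ∧ ∀ Λ : 𝔸 →L[ℝ] ℝ,
      (∀ X, Commute A X → Λ ((A - 1) * X) = 0) → Λ B = 0 := by
  -- The logarithm is `∫₀¹ (A - 1)(1 + s(A - 1))⁻¹ ds`: on the segment, `R` is the logarithmic
  -- derivative of `Q`. Each value of the integrand is `A - 1` times an element that commutes with
  -- `A`, which gives the statement on `Λ`.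
  set Q : ℝ → 𝔸 := fun s => 1 + s • (A - 1) with hQ
  have hQc : Continuous Q := by fun_prop
  set R : ℝ → 𝔸 := fun s => (A - 1) * Ring.inverse (Q s) with hR
  have hAQ : ∀ s, Commute A (Q s) := fun s =>
    (Commute.one_right A).add_right (((Commute.refl A).sub_right (Commute.one_right A)).smul_right s)
  -- `Ring.inverse` is `0` at non-units, so the commutation persists off the segment.
  have hinv : ∀ X s, Commute X (Q s) → Commute X (Ring.inverse (Q s)) := fun X s h =>
    by
      by_cases hu : IsUnit (Q s)
      · obtain ⟨v, hv⟩ := hu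
        rw [← hv, Ring.inverse_unit]
        rw [← hv] at h
        exact h.units_inv_right
      · rw [Ring.inverse_non_unit _ hu]
        exact Commute.zero_right X
  have hRR : ∀ s X, Commute X A → Commute X (R s) := by
    intro s X h
    have h1 : Commute X (A - 1) := h.sub_right (Commute.one_right X)
    exact h1.mul_right (hinv X s ((Commute.one_right X).add_right (h1.smul_right s)))
  have hopen : IsOpen {s | IsUnit (Q s)} := Units.isOpen.preimage hQc
  have hRat : ∀ s, IsUnit (Q s) → ContinuousAt R s := by
    intro s hs
    have h1 := NormedRing.inverse_continuousAt hs.unit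
    rw [hs.unit_spec] at h1
    exact continuousAt_const.mul (ContinuousAt.comp (f := Q) h1 hQc.continuousAt)
  have hRon : ContinuousOn R {s | IsUnit (Q s)} := fun s hs => (hRat s hs).continuousWithinAt
  have hsub : Set.Icc (0:ℝ) 1 ⊆ {s | IsUnit (Q s)} := hA
  have hint : ∀ t ∈ Set.Icc (0:ℝ) 1, IntervalIntegrable R MeasureTheory.volume 0 t := by
    intro t ht
    apply (hRon.mono _).intervalIntegrable
    rw [Set.uIcc_of_le ht.1]
    exact (Set.Icc_subset_Icc_right ht.2).trans hsub
  set L : ℝ → 𝔸 := fun t => ∫ s in (0:ℝ)..t, R s with hL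
  have hΛ : ∀ t ∈ Set.Icc (0:ℝ) 1, ∀ Λ : 𝔸 →L[ℝ] ℝ, (∀ s, Λ (R s) = 0) → Λ (L t) = 0 := by
    intro t ht Λ h
    rw [hL, ← ContinuousLinearMap.intervalIntegral_comp_comm Λ (hint t ht)]
    simp [h]
  have hcomm : ∀ t X, Commute X A → Commute X (L t) := by
    intro t X h
    by_cases hi : IntervalIntegrable R MeasureTheory.volume 0 t
    · have := ContinuousLinearMap.intervalIntegral_comp_comm
        (ContinuousLinearMap.mul ℝ 𝔸 X - (ContinuousLinearMap.mul ℝ 𝔸).flip X) hi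
      simp only [_root_.sub_apply, ContinuousLinearMap.mul_apply',
        ContinuousLinearMap.flip_apply, (hRR _ X h).eq, sub_self,
        intervalIntegral.integral_zero] at this
      exact sub_eq_zero.1 this.symm
    · simp only [hL, intervalIntegral.integral_undef hi]
      exact Commute.zero_right X
  have hLd : ∀ t ∈ Set.Icc (0:ℝ) 1, HasDerivAt L (R t) t := fun t ht =>
    intervalIntegral.integral_hasDerivAt_right (hint t ht)
      (hRon.stronglyMeasurableAtFilter hopen t (hA t ht)) (hRat t (hA t ht))
  have hLL : ∀ t u, Commute (L t) (L u) := fun t u =>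
    hcomm u _ (hcomm t A (Commute.refl A)).symm
  -- The product is constant, since `R Q = A - 1 = Q'`.
  have hE : ∀ t ∈ Set.Icc (0:ℝ) 1, HasDerivAt (fun u => exp (-L u) * Q u) 0 t := by
    intro t ht
    have h1 := hasDerivAt_exp_of_commute (hLd t ht).neg
      (fun u => ((hLL t u).neg_left).neg_right)
    have h2 : HasDerivAt Q (A - 1) t := by
      simpa only [id, one_smul] using! ((hasDerivAt_id t).smul_const (A - 1)).const_add 1
    have hRQ : R t * Q t = A - 1 := by
      simp only [hR]
      rw [mul_assoc, Ring.inverse_mul_cancel _ (hA t ht), mul_one]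
    have h3 := h1.mul h2
    have h4 : exp (-L t) * -R t * Q t + exp (-L t) * (A - 1) = 0 := by
      rw [mul_assoc, neg_mul, hRQ, mul_neg, neg_add_cancel]
    rw [← h4]
    exact h3
  have hconst := constant_of_has_deriv_right_zero
    (f := fun u => exp (-L u) * Q u) (a := 0) (b := 1)
    (fun t ht => (hE t ht).continuousAt.continuousWithinAt)
    (fun t ht => (hE t ⟨ht.1, ht.2.le⟩).hasDerivWithinAt) 1 (by simp)
  let _ : NormedAlgebra ℚ 𝔸 := NormedAlgebra.restrictScalars ℚ ℝ 𝔸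
  refine ⟨L 1, ?_, fun Λ h => hΛ 1 (by simp) Λ fun s => h _ (hinv A s (hAQ s))⟩
  have h2 : exp (-L 1) * A = 1 := by simpa [hQ, hL] using hconst
  have h3 : exp (L 1) * exp (-L 1) = 1 := by
    rw [← NormedSpace.exp_add_of_commute (Commute.refl (L 1)).neg_right]; simp
  calc exp (L 1) = exp (L 1) * (exp (-L 1) * A) := by rw [h2, mul_one]
    _ = A := by rw [← mul_assoc, h3, one_mul]

end BanachLog

/-! ### Matrix exponentials and real logarithms. -/

section MatrixExp

variable {m p : Type*} [Fintype m] [DecidableEq m] [Fintype p] [DecidableEq p]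
  [Fintype q] [DecidableEq q]

/-- The exponential respects intertwining relations. -/
theorem mul_exp_of_mul_eq {𝕂 : Type*} [RCLike 𝕂] (R : Matrix p m 𝕂) (A : Matrix m m 𝕂)
    (B : Matrix p p 𝕂) (h : R * A = B * R) : R * exp A = exp B * R := by
  let _ : NormedRing (Matrix m m 𝕂) := Matrix.linftyOpNormedRing
  let _ : NormedAlgebra 𝕂 (Matrix m m 𝕂) := Matrix.linftyOpNormedAlgebra
  let _ : NormedRing (Matrix p p 𝕂) := Matrix.linftyOpNormedRing
  let _ : NormedAlgebra 𝕂 (Matrix p p 𝕂) := Matrix.linftyOpNormedAlgebra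
  have : @CompleteSpace (Matrix m m 𝕂) PseudoMetricSpace.toUniformSpace :=
    FiniteDimensional.complete 𝕂 _
  have : @CompleteSpace (Matrix p p 𝕂) PseudoMetricSpace.toUniformSpace :=
    FiniteDimensional.complete 𝕂 _
  have hA := exp_series_hasSum_exp' (𝕂 := 𝕂) A
  have hB := exp_series_hasSum_exp' (𝕂 := 𝕂) B
  have h1 := hA.map (AddMonoidHom.mk' (fun X => R * X) fun X Y => Matrix.mul_add R X Y)
    (by show Continuous fun X : Matrix m m 𝕂 => R * X; fun_prop)
  have h2 := hB.map (AddMonoidHom.mk' (fun X => X * R) fun X Y => Matrix.add_mul X Y R)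
    (by show Continuous fun X : Matrix p p 𝕂 => X * R; fun_prop)
  have hpow : ∀ k : ℕ, R * A ^ k = B ^ k * R := by
    intro k
    induction k with
    | zero => simp
    | succ k ih => rw [pow_succ, ← Matrix.mul_assoc, ih, Matrix.mul_assoc, h, ← Matrix.mul_assoc,
        ← pow_succ]
  refine h1.unique (h2.congr_fun ?_ )
  intro k
  simp [hpow]

/-- A block triangular matrix is intertwined with its diagonal blocks by the block column `[1; 0]`
and the block row `[0 1]`. `mul_exp_of_mul_eq` transfers both relations to the exponential, which
fixes three of its four blocks. -/
theorem exists_exp_fromBlocks {𝕂 : Type*} [RCLike 𝕂] (A : Matrix m m 𝕂) (B : Matrix m p 𝕂)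
    (D : Matrix p p 𝕂) :
    ∃ Y, exp (fromBlocks A B 0 D) = fromBlocks (exp A) Y 0 (exp D) := by
  set X := fromBlocks A B 0 D with hX
  have h1 := mul_exp_of_mul_eq (fromCols (0 : Matrix p m 𝕂) (1 : Matrix p p 𝕂)) X D
    (by simp [hX, fromCols_mul_fromBlocks, mul_fromCols])
  have h2 := mul_exp_of_mul_eq (fromRows (1 : Matrix m m 𝕂) (0 : Matrix p m 𝕂)) A X
    (by simp [hX, fromBlocks_mul_fromRows, fromRows_mul])
  rw [← fromBlocks_toBlocks (exp X)] at h1 h2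
  simp only [fromCols_mul_fromBlocks, mul_fromCols, fromBlocks_mul_fromRows, fromRows_mul] at h1 h2
  refine ⟨(exp X).toBlocks₁₂, ?_⟩
  conv_lhs => rw [← fromBlocks_toBlocks (exp X)]
  simp only [Matrix.zero_mul, Matrix.one_mul, zero_add, Matrix.mul_zero, Matrix.mul_one, add_zero,
    fromCols_inj.eq_iff, fromRows_inj.eq_iff] at h1 h2
  rw [← h2.1, h1.1, h1.2]

theorem exp_fromBlocks_diagonal {𝕂 : Type*} [RCLike 𝕂] (A : Matrix m m 𝕂) (D : Matrix p p 𝕂) :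
    exp (fromBlocks A 0 0 D) = fromBlocks (exp A) 0 0 (exp D) := by
  obtain ⟨Y, hY⟩ := exists_exp_fromBlocks A 0 D
  have h1 := mul_exp_of_mul_eq (fromCols (1 : Matrix m m 𝕂) (0 : Matrix m p 𝕂))
    (fromBlocks A 0 0 D) A (by simp [fromCols_mul_fromBlocks, mul_fromCols])
  rw [hY] at h1 ⊢
  simp only [fromCols_mul_fromBlocks, mul_fromCols] at h1
  have e := congrArg toCols₂ h1
  simp only [toCols₂_fromCols] at e
  simp only [Matrix.one_mul, Matrix.zero_mul, add_zero, Matrix.mul_zero] at e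
  rw [e]

/-- A real matrix without eigenvalues in `(-∞, 0]` has a real logarithm; it annihilates the fixed
vectors and the fixed covectors. -/
theorem exists_log (A : Matrix m m ℝ) (hA : ∀ μ ≤ 0, (A - scalar m μ).det ≠ 0) :
    ∃ B : Matrix m m ℝ, exp B = A ∧ (∀ x, A *ᵥ x = x → B *ᵥ x = 0) ∧
      ∀ l, l ᵥ* A = l → l ᵥ* B = 0 := by
  let _ : NormedRing (Matrix m m ℝ) := Matrix.linftyOpNormedRing
  let _ : NormedAlgebra ℝ (Matrix m m ℝ) := Matrix.linftyOpNormedAlgebra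
  obtain ⟨B, hB, hΛ⟩ := exists_exp_eq_of_segment A (by
    intro s hs
    rcases hs.1.eq_or_lt with h | h
    · simp [← h]
    · rw [Matrix.isUnit_iff_isUnit_det, isUnit_iff_ne_zero]
      -- A singular point of the segment would give `A` the eigenvalue `1 - s⁻¹ ≤ 0`.
      have : 1 + s • (A - 1) = s • (A - scalar m (1 - s⁻¹)) := by
        rw [Matrix.scalar_apply, ← Matrix.smul_one_eq_diagonal, smul_sub, smul_sub, smul_smul,
          mul_sub, mul_inv_cancel₀ h.ne', sub_smul]
        simp only [mul_one, one_smul]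
        abel
      rw [this, Matrix.det_smul]
      refine mul_ne_zero (pow_ne_zero _ h.ne') (hA _ ?_)
      have := (one_le_inv₀ h).2 hs.2
      linarith)
  refine ⟨B, hB, fun x hx => funext fun i => ?_, fun l hl => funext fun i => ?_⟩
  · refine hΛ (LinearMap.toContinuousLinearMap
      (LinearMap.mk (AddHom.mk (fun X : Matrix m m ℝ => (X *ᵥ x) i)
        (fun X Y => by rw [add_mulVec, Pi.add_apply])) (fun c X => by simp [smul_mulVec]))) ?_
    intro X hX
    have h0 : ((A - 1) * X) *ᵥ x = 0 := by
      -- Commutation brings `A - 1` next to the fixed vector; for covectors it already stands on the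
      -- correct side.
      have : (A - 1) * X = X * (A - 1) := by rw [sub_mul, mul_sub, hX.eq]; simp
      rw [this, ← mulVec_mulVec, sub_mulVec, hx]; simp
    exact congrFun h0 i
  · refine hΛ (LinearMap.toContinuousLinearMap
      (LinearMap.mk (AddHom.mk (fun X : Matrix m m ℝ => (l ᵥ* X) i)
        (fun X Y => by rw [vecMul_add, Pi.add_apply])) (fun c X => by simp [vecMul_smul]))) ?_
    intro X _
    have h0 : l ᵥ* ((A - 1) * X) = 0 := by
      rw [← vecMul_vecMul, vecMul_sub, hl]; simp
    exact congrFun h0 i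

/-- The algebra homomorphism from `ℂ` with `i ↦ J` carries `exp(πi) = -1` over to matrices. -/
theorem exp_pi_smul_of_sq_eq_neg_one (J : Matrix m m ℝ) (hJ : J * J = -1) :
    exp (Real.pi • J) = -1 := by
  let _ : NormedRing (Matrix m m ℝ) := Matrix.linftyOpNormedRing
  let _ : NormedAlgebra ℝ (Matrix m m ℝ) := Matrix.linftyOpNormedAlgebra
  let _ : NormedAlgebra ℚ (Matrix m m ℝ) := NormedAlgebra.restrictScalars ℚ ℝ _
  have h := NormedSpace.map_exp (Complex.liftAux J hJ)
    (Complex.liftAux J hJ).toLinearMap.continuous_of_finiteDimensional ((Real.pi : ℂ) * Complex.I)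
  rw [← Complex.exp_eq_exp_ℂ, Complex.exp_pi_mul_I] at h
  rw [map_neg, map_one] at h
  rw [h]
  congr 1
  rw [Complex.liftAux_apply]
  simp

/-- A pair of copies of a matrix `N` has a real logarithm if `-N` has one. -/
theorem exp_fromBlocks_pi (Q : Matrix m m ℝ) :
    exp (fromBlocks Q (-(Real.pi • 1)) (Real.pi • 1) Q) = fromBlocks (-exp Q) 0 0 (-exp Q) := by
  have hsplit : fromBlocks Q (-(Real.pi • 1)) (Real.pi • 1) Q = fromBlocks Q 0 0 Q +
      Real.pi • fromBlocks (0 : Matrix m m ℝ) (-1) 1 0 := by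
    simp [fromBlocks_add, fromBlocks_smul]
  have hc : Commute (fromBlocks Q 0 0 Q) (Real.pi • fromBlocks (0 : Matrix m m ℝ) (-1) 1 0) := by
    apply Commute.smul_right
    simp [Commute, SemiconjBy, fromBlocks_multiply]
  rw [hsplit, Matrix.exp_add_of_commute _ _ hc, exp_pi_smul_of_sq_eq_neg_one,
    exp_fromBlocks_diagonal]
  · simp [fromBlocks_neg]
  · rw [← fromBlocks_one]
    rw [fromBlocks_neg]
    simp [fromBlocks_multiply]

end MatrixExp

end FloquetForm

namespace FloquetForm

open Matrix NormedSpace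

/-! ### Bases adapted to a vector and to functionals. -/

section AdaptedBasis

variable {K : Type*} [Field K]

theorem exists_basis_cons {V : Type*} [AddCommGroup V] [Module K V] {N : ℕ} (v : V)
    (l : Module.Dual K V) (hl : l v = 1) (b : Module.Basis (Fin N) K (LinearMap.ker l)) :
    ∃ c : Module.Basis (Fin (N + 1)) K V, c 0 = v ∧ ∀ j : Fin N, c j.succ = b j := by
  refine ⟨Module.Basis.mkFinCons v b ?_ ?_, ?_, ?_⟩
  · intro c x hx h
    have := congrArg l h
    rw [map_add, map_smul, hl, LinearMap.mem_ker.1 hx] at this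
    simpa using this
  · intro z
    exact ⟨-l z, by simp [hl]⟩
  · simp
  · simp

/-- Applied to the first row of the logarithm, this leaves at most one nonzero entry in `L`. -/
theorem exists_basis_of_dual {V : Type*} [AddCommGroup V] [Module K V] [FiniteDimensional K V]
    {N : ℕ} (hN : Module.finrank K V = N) (l : Module.Dual K V) :
    ∃ c : Module.Basis (Fin N) K V, ∀ j : Fin N, 0 < (j : ℕ) → l (c j) = 0 := by
  by_cases hl : l = 0
  · exact ⟨Module.finBasisOfFinrankEq K V hN, by simp [hl]⟩
  obtain ⟨v, hv⟩ : ∃ v, l v = 1 := by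
    obtain ⟨w, hw⟩ := DFunLike.ne_iff.1 hl
    exact ⟨(l w)⁻¹ • w, by simpa using inv_mul_cancel₀ hw⟩
  have hfin := Module.Dual.finrank_ker_add_one_of_ne_zero hl
  obtain ⟨c, -, hc⟩ := exists_basis_cons v l hv (Module.finBasis K (LinearMap.ker l))
  have hcard : Module.finrank K (LinearMap.ker l) + 1 = N := by omega
  subst hcard
  refine ⟨c, fun j hj => ?_⟩
  obtain ⟨i, rfl⟩ := Fin.exists_succ_eq.2 (Fin.pos_iff_ne_zero.1 hj)
  rw [hc]
  exact LinearMap.mem_ker.1 (Subtype.prop _)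

/-- A basis that starts with `v`, continues within the kernel of `l`, and is such that the
functional `w` vanishes on all but the first of these further vectors. -/
theorem exists_adapted_basis {m : Type*} [Fintype m] [DecidableEq m] {N : ℕ}
    (hN : Fintype.card m = N + 1) (v l w : m → K) (hlv : l ⬝ᵥ v = 1) :
    ∃ (S : Matrix m (Fin 1 ⊕ Fin N) K) (S' : Matrix (Fin 1 ⊕ Fin N) m K),
      S * S' = 1 ∧ S' * S = 1 ∧ (∀ i, S i (.inl 0) = v i) ∧ (l ᵥ* S = Sum.elim (fun _ => 1) fun _ => 0) ∧
      ∀ j : Fin N, 0 < (j : ℕ) → (w ᵥ* S) (.inr j) = 0 := by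
  set L : Module.Dual K (m → K) := dotProductBilin K K l with hL
  have hLa : ∀ x, L x = l ⬝ᵥ x := fun x => rfl
  have hL1 : L v = 1 := hlv
  have hL0 : L ≠ 0 := by rintro h; rw [h] at hL1; simp at hL1
  have hfin := Module.Dual.finrank_ker_add_one_of_ne_zero hL0
  rw [Module.finrank_pi, hN] at hfin
  -- The further vectors are a basis of `ker l` adapted to the restriction of `w`.
  obtain ⟨b, hb⟩ := exists_basis_of_dual (N := N) (by omega)
    ((dotProductBilin K K w : Module.Dual K (m → K)).comp (LinearMap.ker L).subtype)
  obtain ⟨c, hc0, hcs⟩ := exists_basis_cons v L hL1 b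
  set e : Fin (N + 1) ≃ Fin 1 ⊕ Fin N := (finCongr (add_comm N 1)).trans finSumFinEquiv.symm
  have he0 : e.symm (.inl 0) = 0 := by ext; simp [e]
  have hes : ∀ j, e.symm (.inr j) = j.succ := fun j => by ext; simp [e]
  set C := c.reindex e
  have hC0 : C (.inl 0) = v := by simp [C, he0, hc0]
  have hCs : ∀ j, C (.inr j) = b j := fun j => by simp [C, hes, hcs]
  have hS : ∀ i j, (Pi.basisFun K m).toMatrix C i j = C j i := fun i j => by
    simp [Module.Basis.toMatrix_apply]
  have hvec : ∀ (u : m → K) j, (u ᵥ* (Pi.basisFun K m).toMatrix C) j = u ⬝ᵥ C j := fun u j => by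
    simp only [vecMul, dotProduct, hS]
  refine ⟨(Pi.basisFun K m).toMatrix C, C.toMatrix (Pi.basisFun K m),
    Module.Basis.toMatrix_mul_toMatrix_flip _ _, Module.Basis.toMatrix_mul_toMatrix_flip _ _,
    fun i => by rw [hS, hC0], ?_, fun j hj => ?_⟩
  · funext j
    rw [hvec]
    rcases j with j | j
    · rw [Subsingleton.elim j 0, hC0]; simpa using hlv
    · rw [hCs]
      exact LinearMap.mem_ker.1 (b j).2
  · rw [hvec, hCs]
    exact hb j hj

/-- The two index types may differ, so the proof moves `S` around cyclically; the correcting power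
of `X` is trivial because the cardinalities agree. -/
theorem charpoly_conj {m p : Type*} [Fintype m] [DecidableEq m] [Fintype p] [DecidableEq p]
    (S : Matrix m p K) (S' : Matrix p m K) (h1 : S * S' = 1) (h2 : S' * S = 1)
    (X : Matrix m m K) : (S' * X * S).charpoly = X.charpoly := by
  have hc : Fintype.card m = Fintype.card p := Matrix.square_of_invertible S S' h1 h2
  have := charpoly_mul_comm_of_le (S' * X) S hc.le
  rw [this, hc, Nat.sub_self, pow_zero, one_mul, ← Matrix.mul_assoc, h1, Matrix.one_mul]

end AdaptedBasis

/-! ### Eigenvalues of exponentials. -/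

/-- The eigenvalues of `c exp(tX)` with multiplicities. -/
theorem roots_charpoly_smul_exp (c t : ℂ) : ∀ (n : ℕ) {m : Type} [Fintype m] [DecidableEq m]
    (_ : Fintype.card m = n) (X : Matrix m m ℂ),
    (c • exp (t • X)).charpoly.roots = X.charpoly.roots.map fun z => c * Complex.exp (t * z) := by
  intro n
  induction n with
  | zero =>
    intro m _ _ hm X
    have := Fintype.card_eq_zero_iff.1 hm
    simp
  | succ n ih =>
    intro m _ _ hm X
    have : Nonempty m := Fintype.card_pos_iff.1 (by omega)
    -- With an eigenvector of `X` as first basis vector, `X` and its exponential are block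
    -- triangular together, and the induction hypothesis handles the lower right block.
    obtain ⟨z, hz⟩ := Module.End.exists_eigenvalue (Matrix.toLin' X)
    obtain ⟨v, hv⟩ := hz.exists_hasEigenvector
    have hXv : X *ᵥ v = z • v := by simpa using hv.apply_eq_smul
    obtain ⟨l, hlv⟩ : ∃ l : m → ℂ, l ⬝ᵥ v = 1 := by
      obtain ⟨i, hi⟩ := Function.ne_iff.1 hv.2
      exact ⟨Pi.single i (v i)⁻¹, by simpa using inv_mul_cancel₀ hi⟩
    obtain ⟨S, S', h1, h2, hS, -⟩ := exists_adapted_basis hm v l 0 hlv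
    let E : Matrix (Fin 1 ⊕ Fin n) (Fin 1) ℂ := fromRows 1 0
    have hcol : S' * X * S * E = E * (z • (1 : Matrix (Fin 1) (Fin 1) ℂ)) := by
      have hSv : S * E = replicateCol (Fin 1) v := by
        simp only [E]
        ext i j
        rw [Subsingleton.elim j 0]
        simp [Matrix.mul_apply, hS]
      have hXv' : X * replicateCol (Fin 1) v = z • replicateCol (Fin 1) v := by
        ext i j
        have := congrFun hXv i
        simpa [Matrix.mul_apply, mulVec, dotProduct] using this
      rw [Matrix.mul_assoc (S' * X), hSv, Matrix.mul_assoc, hXv', Matrix.mul_smul, ← hSv, ← Matrix.mul_assoc,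
        h2, Matrix.one_mul, Matrix.mul_smul, Matrix.mul_one]
    set Y := S' * X * S with hY
    have hYb : Y = fromBlocks (z • 1) Y.toBlocks₁₂ 0 Y.toBlocks₂₂ := by
      conv_lhs => rw [← fromBlocks_toBlocks Y]
      rw [← fromBlocks_toBlocks Y] at hcol
      simp only [E, fromBlocks_mul_fromRows, fromRows_mul, Matrix.mul_one, Matrix.one_mul,
        Matrix.mul_zero, add_zero, Matrix.zero_mul, fromRows_inj.eq_iff] at hcol
      rw [hcol.1, hcol.2]
    have hexp : S' * exp (t • X) * S = exp (t • Y) := by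
      rw [mul_exp_of_mul_eq S' (t • X) (t • Y)
        (by rw [hY, Matrix.mul_smul, Matrix.smul_mul, Matrix.mul_assoc, h1, Matrix.mul_one]),
        Matrix.mul_assoc, h2, Matrix.mul_one]
    rw [← charpoly_conj S S' h1 h2 (c • exp (t • X)), Matrix.mul_smul, Matrix.smul_mul, hexp,
      ← charpoly_conj S S' h1 h2 X, ← hY, hYb, fromBlocks_smul, smul_zero]
    obtain ⟨Z, hZ⟩ := exists_exp_fromBlocks (t • z • (1 : Matrix (Fin 1) (Fin 1) ℂ))
      (t • Y.toBlocks₁₂) (t • Y.toBlocks₂₂)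
    rw [hZ, fromBlocks_smul, smul_zero, charpoly_fromBlocks_zero₂₁, charpoly_fromBlocks_zero₂₁]
    have h11 : exp (t • z • (1 : Matrix (Fin 1) (Fin 1) ℂ)) =
        diagonal fun _ => Complex.exp (t * z) := by
      rw [smul_smul, Matrix.smul_one_eq_diagonal, Matrix.exp_diagonal]
      congr 1
      funext i
      rw [Complex.exp_eq_exp_ℂ]
      exact Pi.coe_exp (fun _ : Fin 1 => t * z) i
    rw [h11, ← diagonal_smul, charpoly_diagonal, Matrix.smul_one_eq_diagonal, charpoly_diagonal,
      Polynomial.roots_mul, Polynomial.roots_mul, ih (by simp), Multiset.map_add]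
    · congr 1
      simp only [Finset.univ_unique, Pi.smul_apply, smul_eq_mul, Finset.prod_const,
        Finset.card_singleton, pow_one, Polynomial.roots_X_sub_C, Multiset.map_singleton]
    · exact mul_ne_zero (Finset.prod_ne_zero_iff.2 fun i _ => Polynomial.X_sub_C_ne_zero _)
        (charpoly_monic _).ne_zero
    · exact mul_ne_zero (Finset.prod_ne_zero_iff.2 fun i _ => Polynomial.X_sub_C_ne_zero _)
        (charpoly_monic _).ne_zero

/-- The logarithms of the moduli of the eigenvalues of `c exp(tX)`, `|c| = 1`. -/
theorem log_norm_aroots_charpoly_smul_exp {m : Type} [Fintype m] [DecidableEq m] (c t : ℝ)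
    (hc : |c| = 1) (ht : t ≠ 0) (X : Matrix m m ℝ) :
    ((c • exp (t • X)).charpoly.aroots ℂ).map (fun l => 1 / t * Real.log ‖l‖) =
      (X.charpoly.aroots ℂ).map Complex.re := by
  have hmap : (exp (t • X)).map (algebraMap ℝ ℂ) =
      exp ((t : ℂ) • X.map (algebraMap ℝ ℂ)) := by
    let _ : NormedRing (Matrix m m ℝ) := Matrix.linftyOpNormedRing
    let _ : NormedAlgebra ℝ (Matrix m m ℝ) := Matrix.linftyOpNormedAlgebra
    let _ : NormedAlgebra ℚ (Matrix m m ℝ) := NormedAlgebra.restrictScalars ℚ ℝ _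
    let _ : NormedRing (Matrix m m ℂ) := Matrix.linftyOpNormedRing
    let _ : NormedAlgebra ℝ (Matrix m m ℂ) := Matrix.linftyOpNormedAlgebra
    have h := NormedSpace.map_exp ((algebraMap ℝ ℂ).mapMatrix (m := m))
      (by show Continuous fun A : Matrix m m ℝ => A.map Complex.ofReal
          exact Continuous.matrix_map continuous_id Complex.continuous_ofReal) (t • X)
    simp only [RingHom.mapMatrix_apply] at h
    refine h.trans ?_
    congr 1
    ext i j
    simp
  have hmap2 : (c • exp (t • X)).map (algebraMap ℝ ℂ) =
      (c : ℂ) • exp ((t : ℂ) • X.map (algebraMap ℝ ℂ)) := by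
    rw [← hmap]; ext i j; simp
  rw [Polynomial.aroots, Polynomial.aroots, ← charpoly_map, ← charpoly_map, hmap2,
    roots_charpoly_smul_exp _ _ _ rfl, Multiset.map_map]
  -- The sign `c` disappears in the modulus `|c exp(tz)| = exp(t Re z)`.
  refine Multiset.map_congr rfl fun z _ => ?_
  simp only [Function.comp_apply, norm_mul, Complex.norm_real, Real.norm_eq_abs, hc, one_mul,
    Complex.norm_exp, Real.log_exp, Complex.re_ofReal_mul]
  field_simp

end FloquetForm

/-! ### The Jordan decomposition over the reals. -/

namespace FloquetForm

open Matrix Polynomial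

/-- After a translation by `μ`, a vanishing combination is a polynomial of degree less than `e`
divisible by `X ^ e`. The exponents decrease with `j` so that multiplication by `X` becomes an upper
triangular Jordan block. -/
theorem linearIndependent_mk_X_sub_C_pow {K : Type*} [Field K] (μ : K) (e : ℕ) :
    LinearIndependent K fun j : Fin e =>
      (Submodule.Quotient.mk ((X - C μ) ^ (e - 1 - (j : ℕ))) :
        K[X] ⧸ Submodule.span K[X] {(X - C μ) ^ e}) := by
  rw [Fintype.linearIndependent_iff]
  intro g hg
  set q : K[X] := ∑ j : Fin e, C (g j) * X ^ (e - 1 - (j : ℕ)) with hq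
  have h1 : (X - C μ) ^ e ∣ q.comp (X - C μ) := by
    rw [← Ideal.mem_span_singleton]
    refine (Submodule.Quotient.mk_eq_zero (Submodule.span K[X] {(X - C μ) ^ e})).1 ?_
    rw [← hg, hq, Polynomial.sum_comp]
    rw [← Submodule.mkQ_apply, map_sum]
    refine Finset.sum_congr rfl fun j _ => ?_
    simp only [mul_comp, C_comp, X_pow_comp, Submodule.mkQ_apply]
    rw [← smul_eq_C_mul]
    rfl
  have hdeg : q.degree < e := by
    refine (Polynomial.degree_sum_le _ _).trans_lt ?_
    rw [Finset.sup_lt_iff (by exact WithBot.bot_lt_coe e)]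
    intro j _
    refine (degree_C_mul_X_pow_le _ _).trans_lt ?_
    have := j.2
    exact_mod_cast (by omega : e - 1 - (j : ℕ) < e)
  have hq0 : q = 0 := by
    have h2 : X ^ e ∣ q := by
      obtain ⟨s, hs⟩ := h1
      refine ⟨s.comp (X + C μ), ?_⟩
      have := congrArg (fun r => r.comp (X + C μ)) hs
      simpa [comp_assoc] using this
    exact eq_zero_of_dvd_of_degree_lt h2 (by rwa [degree_X_pow])
  intro j
  have hc : q.coeff (e - 1 - (j : ℕ)) = g j := by
    simp only [hq, finsetSum_coeff, coeff_C_mul, coeff_X_pow]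
    rw [Finset.sum_eq_single j]
    · simp
    · intro i _ hij
      have : e - 1 - (j : ℕ) ≠ e - 1 - (i : ℕ) := by
        have := i.2; have := j.2
        intro h; apply hij; ext; omega
      simp [this]
    · simp
  rw [← hc, hq0, coeff_zero]

/-- A basis of the module `ℝ[X] / (p ^ e)`, `p` irreducible, in which multiplication by `X` is a
Jordan block or has no real eigenvalue. -/
theorem exists_basis_quotient_pow (p : ℝ[X]) (hp : Irreducible p) (e : ℕ) :
    ∃ (k : ℕ) (b : Module.Basis (Fin k) ℝ (ℝ[X] ⧸ Submodule.span ℝ[X] {p ^ e}))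
      (M : Matrix (Fin k) (Fin k) ℝ), (∀ j, (X : ℝ[X]) • b j = ∑ i, M i j • b i) ∧
      ((1 ≤ k ∧ ∃ μ, M = jordanBlock ℝ k μ) ∨ ∀ μ, (M - scalar (Fin k) μ).det ≠ 0) := by
  have hpe : p ^ e ≠ 0 := pow_ne_zero _ hp.ne_zero
  have hfin : FiniteDimensional ℝ (ℝ[X] ⧸ Submodule.span ℝ[X] {p ^ e}) :=
    (AdjoinRoot.powerBasis hpe).finite
  have hrank : Module.finrank ℝ (ℝ[X] ⧸ Submodule.span ℝ[X] {p ^ e}) = (p ^ e).natDegree :=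
    finrank_quotient_span_eq_natDegree
  by_cases hroot : ∃ μ, p.IsRoot μ
  · obtain ⟨μ, hμ⟩ := hroot
    have hass : Associated (X - C μ) p :=
      (irreducible_X_sub_C μ).associated_of_dvd hp (dvd_iff_isRoot.2 hμ)
    have hspan : Submodule.span ℝ[X] {p ^ e} = Submodule.span ℝ[X] {(X - C μ) ^ e} :=
      (Ideal.span_singleton_eq_span_singleton.2 (hass.pow_pow)).symm
    rw [natDegree_pow, natDegree_eq_of_degree_eq (degree_eq_degree_of_associated hass).symm,
      natDegree_X_sub_C, mul_one] at hrank
    rw [hspan] at hfin hrank ⊢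
    have hli := linearIndependent_mk_X_sub_C_pow μ e
    let b := Module.Basis.mk hli
      (hli.span_eq_top_of_card_eq_finrank' (by rw [hrank, Fintype.card_fin])).ge
    have hb : ∀ j, b j = Submodule.Quotient.mk ((X - C μ) ^ (e - 1 - (j : ℕ))) := fun j =>
      Module.Basis.mk_apply _ _ _
    refine ⟨e, b, jordanBlock ℝ e μ, fun j => ?_, ?_⟩
    -- The second term is `b (j - 1)`, except for `j = 0`, where it is `(X - μ) ^ e = 0` in the
    -- quotient.
    · have hX : (X : ℝ[X]) • b j = μ • b j +
          Submodule.Quotient.mk ((X - C μ) ^ (e - 1 - (j : ℕ) + 1)) := by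
        rw [hb, ← Submodule.Quotient.mk_smul, ← Submodule.Quotient.mk_smul,
          ← Submodule.Quotient.mk_add]
        congr 1
        rw [smul_eq_mul, smul_eq_C_mul, pow_succ]
        ring
      rw [hX]
      by_cases hj : (j : ℕ) = 0
      · rw [Finset.sum_eq_single j]
        · have he : e - 1 - (j : ℕ) + 1 = e := by have := j.2; omega
          rw [he, (Submodule.Quotient.mk_eq_zero _).2 (Submodule.mem_span_singleton_self _)]
          simp [jordanBlock]
        · intro i _ hij
          simp [jordanBlock, hij, hj]
        · simp
      · have hlt : (j : ℕ) - 1 < e := by have := j.2; omega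
        set i₀ : Fin e := ⟨(j : ℕ) - 1, hlt⟩ with hi₀
        have hne : i₀ ≠ j := by intro h; have := congrArg Fin.val h; simp [hi₀] at this; omega
        rw [Finset.sum_eq_add_of_mem j i₀ (Finset.mem_univ _) (Finset.mem_univ _) hne.symm]
        · have h1 : jordanBlock ℝ e μ j j = μ := by simp [jordanBlock]
          have h2 : jordanBlock ℝ e μ i₀ j = 1 := by
            simp only [jordanBlock, of_apply, if_neg hne]
            rw [if_pos]; simp [hi₀]; omega
          rw [h1, h2, one_smul, hb i₀]
          congr 3
          simp only [hi₀]
          have := j.2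
          omega
        · intro c _ hc
          have : ¬ ((c : ℕ) + 1 = j) := by
            intro h; apply hc.2; ext; simp [hi₀]; omega
          simp [jordanBlock, hc.1, this]
    · rcases Nat.eq_zero_or_pos e with he | he
      · right
        subst he
        intro ν; simp
      · exact Or.inl ⟨he, μ, rfl⟩
  · set b := Module.finBasis ℝ (ℝ[X] ⧸ Submodule.span ℝ[X] {p ^ e})
    set M : Matrix _ _ ℝ := Matrix.of fun i j => b.repr ((X : ℝ[X]) • b j) i
    have hM : ∀ j, (X : ℝ[X]) • b j = ∑ i, M i j • b i := fun j => (b.sum_repr _).symm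
    refine ⟨_, b, M, hM, Or.inr fun μ hdet => ?_⟩
    obtain ⟨v, hv, hMv⟩ := exists_mulVec_eq_zero_iff.2 hdet
    set y := ∑ j, v j • b j with hy
    have hXy : (X - C μ) • y = 0 := by
      have h1 : (X : ℝ[X]) • y = ∑ i, (M *ᵥ v) i • b i := by
        rw [hy, Finset.smul_sum]
        simp only [smul_comm (X : ℝ[X]) (_ : ℝ), hM, Finset.smul_sum, mulVec, dotProduct,
          Finset.sum_smul, smul_smul]
        rw [Finset.sum_comm]
        simp only [mul_comm]
      have h2 : (C μ : ℝ[X]) • y = ∑ i, (μ • v) i • b i := by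
        rw [← algebraMap_eq, algebraMap_smul, hy, Finset.smul_sum]
        simp [smul_smul]
      rw [sub_smul, h1, h2, ← Finset.sum_sub_distrib]
      refine Finset.sum_eq_zero fun i _ => ?_
      have := congrFun hMv i
      rw [sub_mulVec, scalar_apply, ← smul_one_eq_diagonal, smul_mulVec, one_mulVec] at this
      rw [← sub_smul]
      rw [Pi.sub_apply] at this
      rw [this]; simp
    -- The vector `y` is killed by `X - μ` and by `p ^ e`, which are coprime because `p` has no real
    -- root.
    have hcop : IsCoprime (p ^ e) (X - C μ) := by
      apply IsCoprime.pow_left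
      refine (Irreducible.coprime_iff_not_dvd hp).2 fun h => hroot ⟨μ, ?_⟩
      exact dvd_iff_isRoot.1 ((hp.associated_of_dvd (irreducible_X_sub_C μ) h).symm.dvd)
    obtain ⟨s, t, hst⟩ := hcop
    have hpy : p ^ e • y = 0 := by
      obtain ⟨z, hz⟩ := Submodule.Quotient.mk_surjective _ y
      rw [← hz, ← Submodule.Quotient.mk_smul, Submodule.Quotient.mk_eq_zero, smul_eq_mul, mul_comm]
      exact Ideal.mul_mem_left _ _ (Ideal.mem_span_singleton_self _)
    have hy0 : y = 0 := by
      have := congrArg (fun r => r • y) hst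
      simpa [add_smul, mul_smul, hXy, hpy] using this.symm
    apply hv
    funext j
    exact (Fintype.linearIndependent_iff.1 b.linearIndependent) v hy0 j

/-- Every real matrix is similar to a direct sum of Jordan blocks and of matrices without real
eigenvalues. -/
theorem exists_jordan_decomposition {n : ℕ} (M : Matrix (Fin n) (Fin n) ℝ) :
    ∃ (ι : Type) (_ : Fintype ι) (_ : DecidableEq ι) (k : ι → ℕ)
      (A : ∀ i, Matrix (Fin (k i)) (Fin (k i)) ℝ) (P : Matrix (Fin n) (Σ i, Fin (k i)) ℝ)
      (P' : Matrix (Σ i, Fin (k i)) (Fin n) ℝ), P * P' = 1 ∧ P' * P = 1 ∧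
      M * P = P * blockDiagonal' A ∧
      ∀ i, (1 ≤ k i ∧ ∃ μ, A i = jordanBlock ℝ (k i) μ) ∨
        ∀ μ, (A i - scalar (Fin (k i)) μ).det ≠ 0 := by
  classical
  -- With `X` acting as `M`, the space is a torsion module over the principal ideal domain `ℝ[X]`,
  -- hence a direct sum of modules `ℝ[X] / (p ^ e)`.
  obtain ⟨ι, _, p, hp, e, ⟨l⟩⟩ := Module.equiv_directSum_of_isTorsion
    (Module.AEval.isTorsion_of_finiteDimensional ℝ (Fin n → ℝ) (Matrix.toLin' M))
  choose k b A hA hA' using fun i => exists_basis_quotient_pow (p i) (hp i) (e i)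
  let l' : (Fin n → ℝ) ≃ₗ[ℝ] _ := (Module.AEval'.of (Matrix.toLin' M)).trans (l.restrictScalars ℝ)
  let c : Module.Basis (Σ i, Fin (k i)) ℝ (Fin n → ℝ) := (DFinsupp.basis b).map l'.symm
  have hc : ∀ i j, c ⟨i, j⟩ = l'.symm (DirectSum.lof ℝ[X] ι
      (fun i => ℝ[X] ⧸ Submodule.span ℝ[X] {p i ^ e i}) i (b i j)) := by
    intro i j
    simp only [c, Module.Basis.map_apply]
    congr 1
    simp [DFinsupp.basis]
    rfl
  have hMc : ∀ i j, M *ᵥ c ⟨i, j⟩ = ∑ a, A i a j • c ⟨i, a⟩ := by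
    intro i j
    apply l'.injective
    have h1 : l' (M *ᵥ c ⟨i, j⟩) = (X : ℝ[X]) • l' (c ⟨i, j⟩) := by
      simp only [l', LinearEquiv.trans_apply, LinearEquiv.restrictScalars_apply]
      rw [← map_smul, Module.AEval'.X_smul_of]
      rfl
    rw [h1, hc, LinearEquiv.apply_symm_apply, ← map_smul, hA, map_sum, map_sum]
    refine Finset.sum_congr rfl fun a _ => ?_
    refine Eq.trans ?_ (l'.map_smul _ _).symm
    rw [hc, LinearEquiv.apply_symm_apply]
    exact LinearMap.map_smul_of_tower _ _ _
  have hS : ∀ i j, (Pi.basisFun ℝ (Fin n)).toMatrix c i j = c j i := fun i j => by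
    simp [Module.Basis.toMatrix_apply]
  refine ⟨ι, inferInstance, inferInstance, k, A, (Pi.basisFun ℝ (Fin n)).toMatrix c,
    c.toMatrix (Pi.basisFun ℝ (Fin n)), Module.Basis.toMatrix_mul_toMatrix_flip _ _,
    Module.Basis.toMatrix_mul_toMatrix_flip _ _, ?_, hA'⟩
  ext a ⟨i, j⟩
  have h1 := congrFun (hMc i j) a
  rw [Matrix.mul_apply, Matrix.mul_apply, Fintype.sum_sigma, Finset.sum_eq_single i]
  · simp only [hS, blockDiagonal'_apply_eq]
    rw [Finset.sum_apply] at h1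
    simp only [mulVec, dotProduct, Pi.smul_apply, smul_eq_mul] at h1
    rw [h1]
    exact Finset.sum_congr rfl fun x _ => mul_comm _ _
  · intro i' _ hi'
    refine Finset.sum_eq_zero fun x _ => ?_
    rw [blockDiagonal'_apply_ne _ _ _ hi', mul_zero]
  · simp

end FloquetForm

/-! ### Sums of Jordan blocks and the count of negative blocks. -/

namespace FloquetForm

open Matrix

/-- The direct sum of the Jordan blocks of sizes `k i` with eigenvalues `μ i`. -/
def jordanSum {ι : Type} [DecidableEq ι] (μ : ι → ℝ) (k : ι → ℕ) :
    Matrix (Σ i, Fin (k i)) (Σ i, Fin (k i)) ℝ :=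
  Matrix.of fun x y => if x.1 = y.1 then
    (if (x.2 : ℕ) = y.2 then μ x.1 else if (x.2 : ℕ) + 1 = y.2 then 1 else 0) else 0

theorem blockDiagonal'_jordanBlock_apply {ι : Type} [DecidableEq ι] {k : ι → ℕ}
    (A : ∀ i, Matrix (Fin (k i)) (Fin (k i)) ℝ) (x y : Σ i, Fin (k i)) (μ : ℝ)
    (h : A x.1 = jordanBlock ℝ (k x.1) μ) :
    blockDiagonal' A x y = if x.1 = y.1 then
      (if (x.2 : ℕ) = y.2 then μ else if (x.2 : ℕ) + 1 = y.2 then 1 else 0) else 0 := by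
  obtain ⟨i, a⟩ := x
  obtain ⟨j, b⟩ := y
  by_cases hij : i = j
  · subst hij
    rw [blockDiagonal'_apply_eq]
    simp only at h
    rw [h]
    simp [jordanBlock, Fin.ext_iff]
  · rw [blockDiagonal'_apply_ne _ _ _ hij]
    simp [hij]

theorem jordanSum_eq {ι : Type} [DecidableEq ι] (μ : ι → ℝ) (k : ι → ℕ) :
    jordanSum μ k = blockDiagonal' fun i => jordanBlock ℝ (k i) (μ i) := by
  ext x y
  rw [blockDiagonal'_jordanBlock_apply _ x y _ rfl]
  rfl

theorem det_jordanBlock_sub (k : ℕ) (μ ν : ℝ) :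
    (jordanBlock ℝ k μ - scalar (Fin k) ν).det = (μ - ν) ^ k := by
  rw [Matrix.det_of_isUpperTriangular]
  · simp [jordanBlock, Finset.prod_const]
  · intro i j hij
    simp only [id] at hij
    have h1 : (j : ℕ) < i := hij
    simp [jordanBlock, hij.ne', show ¬ ((i : ℕ) + 1 = j) by omega]

/-- A null vector of one block extends by zero to a null vector of the sum, and a null vector of the
sum has a nonzero component in some block. -/
theorem det_blockDiagonal'_ne_zero_iff {ι : Type} [DecidableEq ι] [Fintype ι] {k : ι → ℕ}
    (A : ∀ i, Matrix (Fin (k i)) (Fin (k i)) ℝ) :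
    (blockDiagonal' A).det ≠ 0 ↔ ∀ i, (A i).det ≠ 0 := by
  have hmul : ∀ (v : (Σ i, Fin (k i)) → ℝ) i a,
      (blockDiagonal' A *ᵥ v) ⟨i, a⟩ = (A i *ᵥ fun b => v ⟨i, b⟩) a := by
    intro v i a
    simp only [mulVec, dotProduct]
    rw [Fintype.sum_sigma, Finset.sum_eq_single i]
    · simp only [blockDiagonal'_apply_eq]
    · intro j _ hj
      refine Finset.sum_eq_zero fun b _ => ?_
      rw [blockDiagonal'_apply_ne _ _ _ hj.symm, zero_mul]
    · simp
  constructor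
  · intro h i hi
    obtain ⟨v, hv, hAv⟩ := exists_mulVec_eq_zero_iff.2 hi
    refine h (exists_mulVec_eq_zero_iff.1 ⟨fun x => (Pi.single i v : ∀ i, Fin (k i) → ℝ) x.1 x.2,
      fun h0 => hv (funext fun a => ?_), funext fun x => ?_⟩)
    · simpa using congrFun h0 ⟨i, a⟩
    · obtain ⟨j, a⟩ := x
      rw [hmul]
      by_cases hj : j = i
      · subst hj
        simpa using congrFun hAv a
      · simp only [Pi.single_eq_of_ne hj]
        exact congrFun (mulVec_zero (A j)) a
  · intro h h0
    obtain ⟨v, hv, hAv⟩ := exists_mulVec_eq_zero_iff.2 h0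
    refine hv (funext fun x => ?_)
    obtain ⟨i, a⟩ := x
    by_contra hne
    refine h i (exists_mulVec_eq_zero_iff.1 ⟨fun b => v ⟨i, b⟩, fun h1 => hne (congrFun h1 a), ?_⟩)
    funext b
    rw [← hmul, hAv]
    rfl

theorem det_jordanSum_sub {ι : Type} [DecidableEq ι] [Fintype ι] (μ : ι → ℝ) (k : ι → ℕ) (ν : ℝ)
    (h : ∀ i, μ i ≠ ν) : (jordanSum μ k - scalar _ ν).det ≠ 0 := by
  have : jordanSum μ k - scalar _ ν =
      blockDiagonal' fun i => jordanBlock ℝ (k i) (μ i) - scalar (Fin (k i)) ν := by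
    rw [jordanSum_eq]
    refine Eq.trans ?_ (Matrix.blockDiagonal'_sub (fun i => jordanBlock ℝ (k i) (μ i))
      (fun i => scalar (Fin (k i)) ν)).symm
    congr 1
    simp only [scalar_apply]
    rw [blockDiagonal'_diagonal]
  rw [this, det_blockDiagonal'_ne_zero_iff]
  intro i
  rw [det_jordanBlock_sub]
  exact pow_ne_zero _ (sub_ne_zero.2 (h i))

section Conj

variable {m p : Type*} [Fintype m] [DecidableEq m] [Fintype p] [DecidableEq p]

theorem pow_mul_of_mul_eq {K : Type*} [Field K] {X : Matrix m m K} {Y : Matrix p p K}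
    {P : Matrix m p K} (h : X * P = P * Y) (q : ℕ) : X ^ q * P = P * Y ^ q := by
  induction q with
  | zero => simp
  | succ q ih => rw [pow_succ, Matrix.mul_assoc, h, ← Matrix.mul_assoc, ih, Matrix.mul_assoc,
      ← pow_succ]

theorem sub_scalar_mul_of_mul_eq {K : Type*} [Field K] {X : Matrix m m K} {Y : Matrix p p K}
    {P : Matrix m p K} (h : X * P = P * Y) (ν : K) :
    (X - scalar m ν) * P = P * (Y - scalar p ν) := by
  rw [Matrix.sub_mul, Matrix.mul_sub, h]
  congr 1
  ext i j
  simp [mul_comm]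

theorem rank_conj {K : Type*} [Field K] {X : Matrix m m K} {Y : Matrix p p K}
    {P : Matrix m p K} {P' : Matrix p m K} (h1 : P * P' = 1) (h2 : P' * P = 1)
    (h : X * P = P * Y) : X.rank = Y.rank := by
  have hX : X = P * Y * P' := by rw [← h, Matrix.mul_assoc, h1, Matrix.mul_one]
  have hY : Y = P' * X * P := by rw [Matrix.mul_assoc, h, ← Matrix.mul_assoc, h2, Matrix.one_mul]
  apply le_antisymm
  · rw [hX]
    exact (rank_mul_le_left _ _).trans (rank_mul_le_right _ _)
  · rw [hY]
    exact (rank_mul_le_left _ _).trans (rank_mul_le_right _ _)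

end Conj

theorem rank_pow_sub_scalar_of_blocks {n : ℕ} {ι : Type} [Fintype ι] [DecidableEq ι] {k : ι → ℕ}
    {M : Matrix (Fin n) (Fin n) ℝ}
    {A : ∀ i, Matrix (Fin (k i)) (Fin (k i)) ℝ} {P : Matrix (Fin n) (Σ i, Fin (k i)) ℝ}
    {P' : Matrix (Σ i, Fin (k i)) (Fin n) ℝ} (h1 : P * P' = 1) (h2 : P' * P = 1)
    (h : M * P = P * blockDiagonal' A) (ν : ℝ) (q : ℕ) :
    ((M - scalar (Fin n) ν) ^ q).rank = ∑ i, ((A i - scalar (Fin (k i)) ν) ^ q).rank := by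
  rw [rank_conj h1 h2 (pow_mul_of_mul_eq (sub_scalar_mul_of_mul_eq h ν) q), ← rank_blockDiag]
  congr 1
  refine Eq.trans ?_ (Matrix.blockDiagonal'_pow (fun i => A i - scalar (Fin (k i)) ν) q).symm
  congr 1
  refine Eq.trans ?_ (Matrix.blockDiagonal'_sub A (fun i => scalar (Fin (k i)) ν)).symm
  congr 1
  simp only [scalar_apply]
  rw [blockDiagonal'_diagonal]

theorem jordanBlock_injective {k : ℕ} (hk : 1 ≤ k) {μ ν : ℝ}
    (h : jordanBlock ℝ k μ = jordanBlock ℝ k ν) : μ = ν := by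
  have := congrFun (congrFun h ⟨0, hk⟩) ⟨0, hk⟩
  simpa [jordanBlock] using this

-- Blocks without real eigenvalues have full rank in all powers and cancel in the second difference
-- of the ranks. A Jordan block of size `k` for `ν` contributes the truncated difference `k - q`,
-- whose second difference is `1` exactly if `k = q`.
open Classical in
theorem numJordanBlocks_of_blocks {n : ℕ} {ι : Type} [Fintype ι] [DecidableEq ι] {k : ι → ℕ}
    {M : Matrix (Fin n) (Fin n) ℝ}
    {A : ∀ i, Matrix (Fin (k i)) (Fin (k i)) ℝ} {P : Matrix (Fin n) (Σ i, Fin (k i)) ℝ}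
    {P' : Matrix (Σ i, Fin (k i)) (Fin n) ℝ} (h1 : P * P' = 1) (h2 : P' * P = 1)
    (h : M * P = P * blockDiagonal' A)
    (hA : ∀ i, (1 ≤ k i ∧ ∃ μ, A i = jordanBlock ℝ (k i) μ) ∨
        ∀ μ, (A i - scalar (Fin (k i)) μ).det ≠ 0) (ν : ℝ) (q : ℕ) (hq : 1 ≤ q) :
    numJordanBlocks M ν q =
      (Finset.univ.filter fun i => A i = jordanBlock ℝ (k i) ν ∧ k i = q).card := by
  have key : ∀ p i, ((A i - scalar (Fin (k i)) ν) ^ p).rank =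
      if A i = jordanBlock ℝ (k i) ν then k i - p else k i := by
    intro p i
    split_ifs with hi
    · rw [hi, rank_jordan_pow, if_pos rfl]
    · rcases hA i with ⟨hk, μ, hμ⟩ | hdet
      · rw [hμ, rank_jordan_pow, if_neg]
        rintro rfl
        exact hi hμ
      · rw [rank_of_det_ne_zero]
        · simp
        · rw [det_pow]; exact pow_ne_zero _ (hdet ν)
  unfold numJordanBlocks
  simp only [rank_pow_sub_scalar_of_blocks h1 h2 h, key]
  rw [Finset.card_filter, Finset.mul_sum, ← Finset.sum_add_distrib]
  have : ∀ i, ((if A i = jordanBlock ℝ (k i) ν then k i - (q - 1) else k i) +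
      if A i = jordanBlock ℝ (k i) ν then k i - (q + 1) else k i) =
      2 * (if A i = jordanBlock ℝ (k i) ν then k i - q else k i) +
        if A i = jordanBlock ℝ (k i) ν ∧ k i = q then 1 else 0 := by
    intro i
    by_cases h : A i = jordanBlock ℝ (k i) ν
    · simp only [h, if_true, true_and]
      split_ifs <;> omega
    · simp only [h, if_false, false_and]; omega
  rw [Finset.sum_congr rfl fun i _ => this i, Finset.sum_add_distrib]
  omega

/-- An invertible real matrix is similar to the direct sum of a matrix without real eigenvalues
`≤ 0` and of Jordan blocks with negative eigenvalues. -/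
theorem exists_negative_jordan_blocks {n : ℕ} (M : Matrix (Fin n) (Fin n) ℝ) (hM : M.det ≠ 0) :
    ∃ (α ι : Type) (_ : Fintype α) (_ : DecidableEq α) (_ : Fintype ι) (_ : DecidableEq ι)
      (B : Matrix α α ℝ) (μ : ι → ℝ) (k : ι → ℕ) (P : Matrix (Fin n) (α ⊕ Σ i, Fin (k i)) ℝ)
      (P' : Matrix (α ⊕ Σ i, Fin (k i)) (Fin n) ℝ),
      P * P' = 1 ∧ P' * P = 1 ∧ M * P = P * fromBlocks B 0 0 (jordanSum μ k) ∧
      (∀ ν ≤ 0, (B - scalar α ν).det ≠ 0) ∧ (∀ i, μ i < 0 ∧ 1 ≤ k i) ∧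
      ∀ ν < 0, ∀ q, 1 ≤ q → numJordanBlocks M ν q =
        (Finset.univ.filter fun i => (μ i, k i) = (ν, q)).card := by
  classical
  obtain ⟨ι, _, _, k, A, P, P', h1, h2, h, hA⟩ := exists_jordan_decomposition M
  let Neg : ι → Prop := fun i => ∃ μ < 0, 1 ≤ k i ∧ A i = jordanBlock ℝ (k i) μ
  choose μ hμ hk hAμ using fun i : {i // Neg i} => i.2
  let e : (Σ i : {i // ¬ Neg i}, Fin (k i)) ⊕ (Σ i : {i // Neg i}, Fin (k i)) ≃
      Σ i, Fin (k i) :=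
    Equiv.ofBijective (Sum.elim (fun x => ⟨x.1, x.2⟩) fun x => ⟨x.1, x.2⟩) (by
      constructor
      · rintro (⟨⟨i, hi⟩, a⟩ | ⟨⟨i, hi⟩, a⟩) (⟨⟨j, hj⟩, b⟩ | ⟨⟨j, hj⟩, b⟩) hab
        · simp only [Sum.elim_inl, Sigma.mk.injEq] at hab
          obtain ⟨rfl, hab⟩ := hab
          rw [eq_of_heq hab]
        · simp only [Sum.elim_inl, Sum.elim_inr, Sigma.mk.injEq] at hab
          obtain ⟨rfl, hab⟩ := hab
          exact absurd hj hi
        · simp only [Sum.elim_inl, Sum.elim_inr, Sigma.mk.injEq] at hab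
          obtain ⟨rfl, hab⟩ := hab
          exact absurd hi hj
        · simp only [Sum.elim_inr, Sigma.mk.injEq] at hab
          obtain ⟨rfl, hab⟩ := hab
          rw [eq_of_heq hab]
      · rintro ⟨i, a⟩
        by_cases hi : Neg i
        · exact ⟨.inr ⟨⟨i, hi⟩, a⟩, rfl⟩
        · exact ⟨.inl ⟨⟨i, hi⟩, a⟩, rfl⟩)
  have he1 : ∀ i a, e (.inl ⟨i, a⟩) = ⟨i.1, a⟩ := fun _ _ => rfl
  have he2 : ∀ i a, e (.inr ⟨i, a⟩) = ⟨i.1, a⟩ := fun _ _ => rfl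
  have hdetA : ∀ i, (A i).det ≠ 0 := by
    have h3 : (blockDiagonal' A).det ≠ 0 := by
      intro h0
      obtain ⟨v, hv, hv0⟩ := exists_mulVec_eq_zero_iff.2 h0
      refine hM (exists_mulVec_eq_zero_iff.1 ⟨P *ᵥ v, fun h4 => hv ?_, ?_⟩)
      · rw [← one_mulVec v, ← h2, ← mulVec_mulVec, h4, mulVec_zero]
      · rw [mulVec_mulVec, h, ← mulVec_mulVec, hv0, mulVec_zero]
    exact (det_blockDiagonal'_ne_zero_iff A).1 h3
  refine ⟨_, {i // Neg i}, inferInstance, inferInstance, inferInstance, inferInstance,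
    blockDiagonal' fun i : {i // ¬ Neg i} => A i, μ, fun i => k i, P.submatrix id e,
    P'.submatrix e id, ?_, ?_, ?_, ?_, fun i => ⟨hμ i, hk i⟩, ?_⟩
  · rw [submatrix_mul_equiv, h1, submatrix_id_id]
  · rw [submatrix_mul P' P e id e Function.bijective_id |>.symm, h2, submatrix_one_equiv]
  · have hb : fromBlocks (blockDiagonal' fun i : {i // ¬ Neg i} => A i) 0 0
        (jordanSum μ fun i => k i) = (blockDiagonal' A).submatrix e e := by
      ext (⟨i, a⟩ | ⟨i, a⟩) (⟨j, b⟩ | ⟨j, b⟩)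
      · simp only [fromBlocks_apply₁₁, submatrix_apply, he1]
        by_cases hij : i = j
        · subst hij
          rw [blockDiagonal'_apply_eq, blockDiagonal'_apply_eq]
        · rw [blockDiagonal'_apply_ne _ _ _ hij,
            blockDiagonal'_apply_ne _ _ _ (fun h => hij (Subtype.ext h))]
      · simp only [fromBlocks_apply₁₂, submatrix_apply, he1, he2]
        rw [blockDiagonal'_apply_ne, Matrix.zero_apply]
        intro hij
        exact i.2 (hij ▸ j.2)
      · simp only [fromBlocks_apply₂₁, submatrix_apply, he1, he2]
        rw [blockDiagonal'_apply_ne, Matrix.zero_apply]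
        intro hij
        exact j.2 (hij ▸ i.2)
      · simp only [fromBlocks_apply₂₂, submatrix_apply, he2]
        rw [blockDiagonal'_jordanBlock_apply A _ _ (μ i) (hAμ i)]
        simp only [jordanSum, of_apply, Subtype.ext_iff]
    rw [hb, submatrix_mul_equiv, ← h]
    ext i j
    simp [Matrix.mul_apply]
  · intro ν hν
    have : (blockDiagonal' fun i : {i // ¬ Neg i} => A i) - scalar _ ν =
        blockDiagonal' fun i : {i // ¬ Neg i} => A i - scalar (Fin (k i)) ν := by
      refine Eq.trans ?_ (Matrix.blockDiagonal'_sub (fun i : {i // ¬ Neg i} => A i)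
        (fun i => scalar (Fin (k i)) ν)).symm
      congr 1
      simp only [scalar_apply]
      rw [blockDiagonal'_diagonal]
    rw [this, det_blockDiagonal'_ne_zero_iff]
    intro i
    rcases hA i with ⟨hki, μ', hμ'⟩ | hdet
    · rw [hμ', det_jordanBlock_sub]
      refine pow_ne_zero _ (sub_ne_zero.2 ?_)
      rintro rfl
      -- The eigenvalue `0` contradicts the invertibility of `M`; a block with a negative eigenvalue
      -- belongs to the other summand.
      rcases hν.eq_or_lt with h0 | h0
      · apply hdetA i
        have := det_jordanBlock_sub (k i) μ' 0
        rw [← hμ', h0, sub_zero, zero_pow (by omega)] at this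
        simpa using this
      · exact i.2 ⟨μ', h0, hki, hμ'⟩
    · exact hdet ν
  · intro ν hν q hq
    rw [numJordanBlocks_of_blocks h1 h2 h hA ν q hq]
    symm
    refine Finset.card_bij (fun i _ => i.1) ?_ ?_ ?_
    · intro i hi
      simp only [Finset.mem_filter, Finset.mem_univ, true_and, Prod.mk.injEq] at hi ⊢
      exact ⟨hi.1 ▸ hAμ i, hi.2⟩
    · intro i _ j _ hij
      exact Subtype.ext hij
    · intro i hi
      simp only [Finset.mem_filter, Finset.mem_univ, true_and] at hi
      have hki : 1 ≤ k i := hi.2 ▸ hq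
      refine ⟨⟨i, ν, hν, hki, hi.1⟩, ?_, rfl⟩
      simp only [Finset.mem_filter, Finset.mem_univ, true_and, Prod.mk.injEq]
      exact ⟨jordanBlock_injective hki ((hAμ ⟨i, ν, hν, hki, hi.1⟩).symm.trans hi.1), hi.2⟩

/-! ### Pairing of negative blocks and the antiperiodicity index. -/

/-- A finite family can be arranged in pairs of elements of the same kind, with one element left
over of each kind that occurs an odd number of times. -/
theorem exists_pairing {ι K : Type} [Fintype ι] [DecidableEq K] (kind : ι → K) :
    ∃ (κ β : Type) (_ : Fintype κ) (_ : DecidableEq κ) (_ : Fintype β) (_ : DecidableEq β)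
      (e : (κ ⊕ κ) ⊕ β ≃ ι), (∀ x, kind (e (.inl (.inl x))) = kind (e (.inl (.inr x)))) ∧
      ∀ w : K → ℕ, ∑ b, w (kind (e (.inr b))) =
        ∑ c ∈ Finset.univ.image kind with Odd (Finset.univ.filter fun i => kind i = c).card,
          w c := by
  classical
  let kd : ι → ↥(Finset.univ.image kind) := fun i => ⟨kind i, Finset.mem_image_of_mem _ (Finset.mem_univ i)⟩
  let N : ↥(Finset.univ.image kind) → ℕ := fun c => Fintype.card {i // kd i = c}
  -- A fibre of size `N c` splits into two halves of size `N c / 2` and a rest of size `N c % 2`.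
  let ε : ∀ c, (Fin (N c / 2) ⊕ Fin (N c / 2)) ⊕ Fin (N c % 2) ≃ {i // kd i = c} := fun c =>
    Fintype.equivOfCardEq (by simp only [Fintype.card_sum, Fintype.card_fin, N]; omega)
  let e : ((Σ c, Fin (N c / 2)) ⊕ (Σ c, Fin (N c / 2))) ⊕ (Σ c, Fin (N c % 2)) ≃ ι :=
    ((Equiv.sumCongr (Equiv.sigmaSumDistrib _ _).symm (Equiv.refl _)).trans
      (Equiv.sigmaSumDistrib _ _).symm).trans
      ((Equiv.sigmaCongrRight ε).trans (Equiv.sigmaFiberEquiv kd))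
  have hk : ∀ i : ι, ∀ c, kd i = c → kind i = c.1 := fun i c h => congrArg Subtype.val h
  refine ⟨_, _, inferInstance, inferInstance, inferInstance, inferInstance, e, ?_, ?_⟩
  · rintro ⟨c, a⟩
    exact (hk _ c (ε c (.inl (.inl a))).2).trans (hk _ c (ε c (.inl (.inr a))).2).symm
  · intro w
    have h1 : ∀ b : (Σ c, Fin (N c % 2)), kind (e (.inr b)) = b.1.1 := by
      rintro ⟨c, a⟩
      exact hk _ c (ε c (.inr a)).2
    simp only [h1]
    rw [Fintype.sum_sigma, Finset.sum_filter, ← Finset.sum_coe_sort (Finset.univ.image kind)]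
    refine Finset.sum_congr rfl fun c _ => ?_
    have hN : N c = (Finset.univ.filter fun i => kind i = c.1).card := by
      simp only [N, Fintype.card_subtype, kd, Subtype.ext_iff]
    rw [← hN]
    simp only [Finset.sum_const, Finset.card_univ, Fintype.card_fin, smul_eq_mul]
    split_ifs with ho
    · rw [Nat.odd_iff.1 ho, one_mul]
    · rw [Nat.not_odd_iff.1 ho, zero_mul]

/-- A pair `(ν, q)` with odd count is the kind of an actual block, and `ν` is then a root: otherwise
all powers of `M - ν` would have rank `n` and the count would be `0`. So both sums run over the same
kinds; the right-hand side has the form that `exists_pairing` yields. -/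
theorem antiperiodicityIndex_eq_sum {n : ℕ} {M : Matrix (Fin n) (Fin n) ℝ} {ι : Type} [Fintype ι]
    {μ : ι → ℝ} {k : ι → ℕ} (hι : ∀ i, μ i < 0 ∧ 1 ≤ k i) (hk : ∀ i, k i ≤ n)
    (hnum : ∀ ν < 0, ∀ q, 1 ≤ q → numJordanBlocks M ν q =
        (Finset.univ.filter fun i => (μ i, k i) = (ν, q)).card) :
    antiperiodicityIndex M =
      ∑ c ∈ Finset.univ.image (fun i => (μ i, k i)) with
        Odd (Finset.univ.filter fun i => (μ i, k i) = c).card, c.2 := by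
  unfold antiperiodicityIndex
  symm
  refine Finset.sum_finset_product' (f := fun (_ : ℝ) (q : ℕ) => q) _ _ _ fun c => ?_
  obtain ⟨ν, q⟩ := c
  simp only [Finset.mem_filter, Finset.mem_image, Finset.mem_univ, true_and, Multiset.mem_toFinset,
    Finset.mem_Icc, Prod.mk.injEq]
  constructor
  · rintro ⟨⟨i, rfl, rfl⟩, hodd⟩
    have h1 := hnum (μ i) (hι i).1 (k i) (hι i).2
    simp only [Prod.mk.injEq] at h1
    rw [← h1] at hodd
    refine ⟨⟨?_, (hι i).1⟩, ⟨(hι i).2, hk i⟩, hodd⟩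
    by_contra hroot
    rw [Polynomial.mem_roots (charpoly_monic M).ne_zero, Polynomial.IsRoot, eval_charpoly] at hroot
    have hfull : ∀ q, ((M - scalar (Fin n) (μ i)) ^ q).rank = n := by
      intro q
      rw [rank_of_det_ne_zero, Fintype.card_fin]
      rw [det_pow, ← neg_sub, det_neg]
      exact pow_ne_zero _ (mul_ne_zero (pow_ne_zero _ (by norm_num)) hroot)
    simp only [numJordanBlocks, hfull] at hodd
    rw [← two_mul, Nat.sub_self] at hodd
    simp at hodd
  · rintro ⟨⟨_, hν⟩, ⟨hq, _⟩, hodd⟩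
    have h1 := hnum ν hν q hq
    simp only [Prod.mk.injEq] at h1
    rw [h1] at hodd
    refine ⟨?_, hodd⟩
    obtain ⟨i, hi⟩ := Finset.card_pos.1 hodd.pos
    exact ⟨i, by simpa using hi⟩

/-- A direct sum of negative Jordan blocks that come in pairs, next to a direct sum of others. -/
theorem exists_jordanSum_pairing {ι : Type} [Fintype ι] [DecidableEq ι] (μ : ι → ℝ) (k : ι → ℕ)
    {κ' β' : Type} [Fintype κ'] [DecidableEq κ'] [Fintype β'] [DecidableEq β']
    (e : (κ' ⊕ κ') ⊕ β' ≃ ι) (hμ : ∀ x, μ (e (.inl (.inl x))) = μ (e (.inl (.inr x))))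
    (hk : ∀ x, k (e (.inl (.inl x))) = k (e (.inl (.inr x)))) :
    ∃ E : ((Σ x, Fin (k (e (.inl (.inl x))))) ⊕ (Σ x, Fin (k (e (.inl (.inl x)))))) ⊕
        (Σ x, Fin (k (e (.inr x)))) ≃ Σ i, Fin (k i),
      (jordanSum μ k).submatrix E E = fromBlocks (fromBlocks
        (jordanSum (fun x => μ (e (.inl (.inl x)))) fun x => k (e (.inl (.inl x)))) 0 0
        (jordanSum (fun x => μ (e (.inl (.inl x)))) fun x => k (e (.inl (.inl x))))) 0 0
        (jordanSum (fun x => μ (e (.inr x))) fun x => k (e (.inr x))) := by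
  -- The sizes of paired blocks are only provably equal, hence the cast. It keeps positions as
  -- natural numbers, and `jordanSum` compares nothing else.
  let F : ((Σ x, Fin (k (e (.inl (.inl x))))) ⊕ (Σ x, Fin (k (e (.inl (.inl x)))))) ⊕
        (Σ x, Fin (k (e (.inr x)))) → Σ i, Fin (k i) :=
    Sum.elim (Sum.elim (fun x => ⟨e (.inl (.inl x.1)), x.2⟩)
      fun x => ⟨e (.inl (.inr x.1)), Fin.cast (hk x.1) x.2⟩) fun x => ⟨e (.inr x.1), x.2⟩
  have hF : Function.Bijective F := by
    constructor
    · intro x y hxy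
      have h1 : (F x).1 = (F y).1 := congrArg Sigma.fst hxy
      have h2 : ((F x).2 : ℕ) = (F y).2 := by rw [hxy]
      rcases x with (⟨x, a⟩ | ⟨x, a⟩) | ⟨x, a⟩ <;> rcases y with (⟨y, b⟩ | ⟨y, b⟩) | ⟨y, b⟩ <;>
        simp only [F, Sum.elim_inl, Sum.elim_inr, EmbeddingLike.apply_eq_iff_eq, Sum.inl.injEq,
          Sum.inr.injEq, reduceCtorEq, Fin.val_cast] at h1 h2 <;> subst h1 <;>
        rw [Fin.ext h2]
    · rintro ⟨i, a⟩
      obtain ⟨(x | x) | x, rfl⟩ := e.surjective i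
      · exact ⟨.inl (.inl ⟨x, a⟩), rfl⟩
      · exact ⟨.inl (.inr ⟨x, Fin.cast (hk x).symm a⟩), rfl⟩
      · exact ⟨.inr ⟨x, a⟩, rfl⟩
  refine ⟨Equiv.ofBijective F hF, ?_⟩
  ext ((⟨x, a⟩ | ⟨x, a⟩) | ⟨x, a⟩) ((⟨y, b⟩ | ⟨y, b⟩) | ⟨y, b⟩) <;>
    simp [jordanSum, F, hμ]

/-- The block structure behind the A-index: an invertible real matrix is similar to the direct sum
of a matrix without real eigenvalues `≤ 0`, of two copies of a matrix, and of a matrix whose size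
is the antiperiodicity index; the latter two have no eigenvalues `≥ 0`. -/
theorem exists_antiperiodic_decomposition {n : ℕ} (M : Matrix (Fin n) (Fin n) ℝ)
    (hM : M.det ≠ 0) :
    ∃ (α κ β : Type) (_ : Fintype α) (_ : DecidableEq α) (_ : Fintype κ) (_ : DecidableEq κ)
      (_ : Fintype β) (_ : DecidableEq β) (A : Matrix α α ℝ) (N : Matrix κ κ ℝ) (B : Matrix β β ℝ)
      (P : Matrix (Fin n) ((α ⊕ (κ ⊕ κ)) ⊕ β) ℝ) (P' : Matrix ((α ⊕ (κ ⊕ κ)) ⊕ β) (Fin n) ℝ),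
      P * P' = 1 ∧ P' * P = 1 ∧
      M * P = P * fromBlocks (fromBlocks A 0 0 (fromBlocks N 0 0 N)) 0 0 B ∧
      Fintype.card β = antiperiodicityIndex M ∧ (∀ ν ≤ 0, (A - scalar α ν).det ≠ 0) ∧
      (∀ ν, 0 ≤ ν → (N - scalar κ ν).det ≠ 0) ∧ ∀ ν, 0 ≤ ν → (B - scalar β ν).det ≠ 0 := by
  obtain ⟨α, ι, _, _, _, _, A, μ, k, P, P', h1, h2, h, hA, hι, hnum⟩ :=
    exists_negative_jordan_blocks M hM
  obtain ⟨κ', β', _, _, _, _, e, hkind, hsum⟩ := exists_pairing fun i => (μ i, k i)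
  obtain ⟨E, hE⟩ := exists_jordanSum_pairing μ k e (fun x => congrArg Prod.fst (hkind x))
    (fun x => congrArg Prod.snd (hkind x))
  set N := jordanSum (fun x => μ (e (.inl (.inl x)))) fun x => k (e (.inl (.inl x)))
  set B := jordanSum (fun x => μ (e (.inr x))) fun x => k (e (.inr x))
  have hcard : Fintype.card (α ⊕ Σ i, Fin (k i)) = n := by
    simpa using (Matrix.square_of_invertible P P' h1 h2).symm
  -- The index only sums over sizes up to `n`, so no block may be larger.
  have hk : ∀ i, k i ≤ n := by
    intro i
    rw [Fintype.card_sum, Fintype.card_sigma] at hcard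
    have h3 := Finset.single_le_sum (f := fun i => Fintype.card (Fin (k i)))
      (fun i _ => Nat.zero_le _) (Finset.mem_univ i)
    simp only [Fintype.card_fin] at h3 hcard
    omega
  let G := (Equiv.sumAssoc α _ _).trans (Equiv.sumCongr (Equiv.refl α) E)
  refine ⟨α, _, _, inferInstance, inferInstance, inferInstance, inferInstance, inferInstance,
    inferInstance, A, N, B, P.submatrix id G, P'.submatrix G id, ?_, ?_, ?_, ?_, hA,
    fun ν hν => det_jordanSum_sub _ _ _ fun i => ((hι _).1.trans_le hν).ne,
    fun ν hν => det_jordanSum_sub _ _ _ fun i => ((hι _).1.trans_le hν).ne⟩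
  · rw [submatrix_mul_equiv, h1, submatrix_id_id]
  · rw [submatrix_mul P' P G id G Function.bijective_id |>.symm, h2, submatrix_one_equiv]
  · have hb : fromBlocks (fromBlocks A 0 0 (fromBlocks N 0 0 N)) 0 0 B =
        (fromBlocks A 0 0 (jordanSum μ k)).submatrix G G := by
      have hE' : ∀ x y, jordanSum μ k (E x) (E y) =
          fromBlocks (fromBlocks N 0 0 N) 0 0 B x y := fun x y => by rw [← hE]; rfl
      ext ((x | x) | x) ((y | y) | y) <;> simp [G, hE']
    rw [hb, submatrix_mul_equiv, ← h]
    ext i j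
    simp [Matrix.mul_apply]
  · rw [antiperiodicityIndex_eq_sum hι hk hnum, ← hsum fun c => c.2, Fintype.card_sigma]
    simp

end FloquetForm

/-! ### The real normal form of the monodromy matrix. -/

namespace FloquetForm

open Matrix NormedSpace

/-- The matrix `1 ⊕ I_a ⊕ (-I_b)`. -/
def blockReflection (a b : ℕ) : Matrix (Fin 1 ⊕ (Fin a ⊕ Fin b)) (Fin 1 ⊕ (Fin a ⊕ Fin b)) ℝ :=
  fromBlocks 1 0 0 (fromBlocks 1 0 0 (-1))

/-- The matrix with first row `[0 L 0]` and remaining diagonal blocks `0`, `H₁`, `H₂`. -/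
def floquetBlock {a b : ℕ} (L : Matrix (Fin 1) (Fin a) ℝ) (H₁ : Matrix (Fin a) (Fin a) ℝ)
    (H₂ : Matrix (Fin b) (Fin b) ℝ) :
    Matrix (Fin 1 ⊕ (Fin a ⊕ Fin b)) (Fin 1 ⊕ (Fin a ⊕ Fin b)) ℝ :=
  fromBlocks 0 (fromCols L 0) 0 (fromBlocks H₁ 0 0 H₂)

theorem exp_submatrix_equiv {m p : Type*} [Fintype m] [DecidableEq m] [Fintype p] [DecidableEq p]
    (a : p ≃ m) (X : Matrix m m ℝ) : exp (X.submatrix a a) = (exp X).submatrix a a := by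
  have h := mul_exp_of_mul_eq ((1 : Matrix m m ℝ).submatrix a id) X (X.submatrix a a) (by
    refine (one_submatrix_mul a (Equiv.refl m) X).trans ?_
    rw [mul_submatrix_one]
    ext i j
    simp)
  ext i j
  have h1 := congrFun (congrFun h i) (a j)
  simp only [Matrix.mul_apply, submatrix_apply, id, Matrix.one_apply, ite_mul, one_mul, zero_mul,
    Finset.sum_ite_eq, Finset.mem_univ, if_true, mul_ite, mul_one, mul_zero,
    EmbeddingLike.apply_eq_iff_eq, Finset.sum_ite_eq'] at h1
  rw [submatrix_apply, h1]

theorem eq_zero_of_mulVec_eq_self {m : Type*} [Fintype m] [DecidableEq m] {N : Matrix m m ℝ}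
    (hN : (N - scalar m 1).det ≠ 0) {x : m → ℝ} (hx : N *ᵥ x = x) : x = 0 := by
  by_contra h0
  refine hN (exists_mulVec_eq_zero_iff.1 ⟨x, h0, ?_⟩)
  rw [sub_mulVec, hx, scalar_apply, diagonal_one, one_mulVec, sub_self]

theorem eq_zero_of_vecMul_eq_self {m : Type*} [Fintype m] [DecidableEq m] {N : Matrix m m ℝ}
    (hN : (N - scalar m 1).det ≠ 0) {x : m → ℝ} (hx : x ᵥ* N = x) : x = 0 := by
  by_contra h0
  refine hN (exists_vecMul_eq_zero_iff.1 ⟨x, h0, ?_⟩)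
  rw [vecMul_sub, hx, scalar_apply, diagonal_one, vecMul_one, sub_self]

theorem exists_log_neg {m : Type*} [Fintype m] [DecidableEq m] (N : Matrix m m ℝ)
    (hN : ∀ ν, 0 ≤ ν → (N - scalar m ν).det ≠ 0) : ∃ Q : Matrix m m ℝ, exp Q = -N := by
  obtain ⟨Q, hQ, -⟩ := exists_log (-N) (by
    intro ν hν
    have h1 : -N - scalar m ν = -(N - scalar m (-ν)) := by
      rw [map_neg]; abel
    rw [h1, det_neg]
    exact mul_ne_zero (pow_ne_zero _ (by norm_num)) (hN _ (by linarith)))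
  exact ⟨Q, hQ⟩

/-- The logarithm of the sum of a matrix without eigenvalues in `(-∞, 0]` and of two copies of a
matrix without eigenvalues in `[0, ∞)`. -/
theorem exists_log_of_pair {α κ : Type} [Fintype α] [DecidableEq α] [Fintype κ] [DecidableEq κ]
    (A : Matrix α α ℝ) (N : Matrix κ κ ℝ) (hA : ∀ ν ≤ 0, (A - scalar α ν).det ≠ 0)
    (hN : ∀ ν, 0 ≤ ν → (N - scalar κ ν).det ≠ 0) :
    ∃ B, exp B = fromBlocks A 0 0 (fromBlocks N 0 0 N) ∧
      (∀ x, fromBlocks A 0 0 (fromBlocks N 0 0 N) *ᵥ x = x → B *ᵥ x = 0) ∧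
      ∀ l, l ᵥ* fromBlocks A 0 0 (fromBlocks N 0 0 N) = l → l ᵥ* B = 0 := by
  obtain ⟨B, hB, hBx, hBl⟩ := exists_log A hA
  obtain ⟨Q, hQ⟩ := exists_log_neg N hN
  -- Since `1` is not an eigenvalue of `N`, fixed vectors and covectors vanish on the two copies of
  -- `N`, where the logarithm involves `π`.
  have hN1 := hN 1 zero_le_one
  refine ⟨fromBlocks B 0 0 (fromBlocks Q (-(Real.pi • 1)) (Real.pi • 1) Q), ?_, ?_, ?_⟩
  · rw [exp_fromBlocks_diagonal, exp_fromBlocks_pi, hB, hQ, neg_neg]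
  · intro x hx
    obtain ⟨x₁, x₂, rfl⟩ : ∃ x₁ x₂, x = Sum.elim x₁ x₂ :=
      ⟨_, _, (Sum.elim_comp_inl_inr x).symm⟩
    obtain ⟨x₂, x₃, rfl⟩ : ∃ y₁ y₂, x₂ = Sum.elim y₁ y₂ :=
      ⟨_, _, (Sum.elim_comp_inl_inr x₂).symm⟩
    simp only [fromBlocks_mulVec, Sum.elim_comp_inl, Sum.elim_comp_inr, zero_mulVec, add_zero, zero_add, Sum.elim_eq_iff] at hx
    rw [eq_zero_of_mulVec_eq_self hN1 hx.2.1, eq_zero_of_mulVec_eq_self hN1 hx.2.2]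
    simp [fromBlocks_mulVec, Sum.elim_comp_inl, Sum.elim_comp_inr, hBx _ hx.1]
  · intro x hx
    obtain ⟨x₁, x₂, rfl⟩ : ∃ x₁ x₂, x = Sum.elim x₁ x₂ :=
      ⟨_, _, (Sum.elim_comp_inl_inr x).symm⟩
    obtain ⟨x₂, x₃, rfl⟩ : ∃ y₁ y₂, x₂ = Sum.elim y₁ y₂ :=
      ⟨_, _, (Sum.elim_comp_inl_inr x₂).symm⟩
    simp only [vecMul_fromBlocks, Sum.elim_comp_inl, Sum.elim_comp_inr, vecMul_zero, add_zero, zero_add, Sum.elim_eq_iff] at hx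
    rw [eq_zero_of_vecMul_eq_self hN1 hx.2.1, eq_zero_of_vecMul_eq_self hN1 hx.2.2]
    simp [vecMul_fromBlocks, Sum.elim_comp_inl, Sum.elim_comp_inr, hBl _ hx.1]

/-- If `u` is outside the range of `M - 1`, some functional kills this range but not `u`, and to
kill it is to be a left fixed vector. Otherwise any normalised covector will do. -/
theorem exists_covector {m : Type} [Fintype m] [DecidableEq m] (M : Matrix m m ℝ) (u : m → ℝ)
    (hu : u ≠ 0) : ∃ l : m → ℝ, l ⬝ᵥ u = 1 ∧ ((¬ ∃ x, (M - 1) *ᵥ x = u) → l ᵥ* M = l) := by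
  have key : ∀ f : Module.Dual ℝ (m → ℝ), ∀ x, (fun i => f (Pi.single i 1)) ⬝ᵥ x = f x := by
    intro f x
    conv_rhs => rw [pi_eq_sum_univ' x, map_sum]
    simp only [dotProduct, map_smul, smul_eq_mul]
    exact Finset.sum_congr rfl fun i _ => mul_comm _ _
  by_cases h : ∃ x, (M - 1) *ᵥ x = u
  · obtain ⟨i, hi⟩ := Function.ne_iff.1 hu
    exact ⟨Pi.single i (u i)⁻¹, by simpa using inv_mul_cancel₀ hi, fun h' => absurd h h'⟩
  · have hnot : u ∉ LinearMap.range (toLin' (M - 1)) := by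
      rintro ⟨x, hx⟩; exact h ⟨x, by rw [← hx, toLin'_apply]⟩
    obtain ⟨f, hf, hfr⟩ := Submodule.exists_le_ker_of_notMem hnot
    refine ⟨(f u)⁻¹ • fun i => f (Pi.single i 1), ?_, fun _ => ?_⟩
    · rw [smul_dotProduct, key, smul_eq_mul, inv_mul_cancel₀ hf]
    · have h1 : (fun i => f (Pi.single i 1)) ᵥ* (M - 1) = 0 := by
        funext j
        have h2 := hfr (LinearMap.mem_range_self (toLin' (M - 1)) (Pi.single j 1))
        rw [LinearMap.mem_ker, ← key, toLin'_apply, dotProduct_mulVec] at h2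
        simpa using h2
      rw [vecMul_sub, vecMul_one, sub_eq_zero] at h1
      rw [smul_vecMul, h1]

/-- Here `x` lies in the kernel of `(M - 1) ^ (q + 1)` but not of `(M - 1) ^ q`, whereas these
kernels are stationary from the dimension on. -/
theorem lt_card_of_pow_mulVec_eq {m : Type} [Fintype m] [DecidableEq m] {M : Matrix m m ℝ}
    {u x : m → ℝ} {q : ℕ} (hu : u ≠ 0) (hMu : M *ᵥ u = u) (hx : (M - 1) ^ q *ᵥ x = u) :
    q < Fintype.card m := by
  by_contra hq
  push Not at hq
  have hpow : ∀ k y, (toLin' (M - 1) ^ k : Module.End ℝ (m → ℝ)) y = (M - 1) ^ k *ᵥ y := by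
    intro k y
    rw [← toLin'_pow, toLin'_apply]
  have h1 := Module.End.ker_pow_eq_ker_pow_finrank_of_le (f := toLin' (M - 1)) (m := q)
    (by rwa [Module.finrank_pi])
  have h2 := Module.End.ker_pow_eq_ker_pow_finrank_of_le (f := toLin' (M - 1)) (m := q + 1)
    (by rw [Module.finrank_pi]; omega)
  have h3 : x ∈ LinearMap.ker (toLin' (M - 1) ^ (q + 1) : Module.End ℝ (m → ℝ)) := by
    rw [LinearMap.mem_ker, hpow, pow_succ', ← mulVec_mulVec, hx, sub_mulVec, hMu, one_mulVec,
      sub_self]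
  rw [h2, ← h1, LinearMap.mem_ker, hpow, hx] at h3
  exact hu h3

theorem fromBlocks_diagonal_sub_one_pow {m p : Type*} [Fintype m] [DecidableEq m] [Fintype p]
    [DecidableEq p] (A : Matrix m m ℝ) (B : Matrix p p ℝ) (q : ℕ) :
    (fromBlocks A 0 0 B - 1) ^ q = fromBlocks ((A - 1) ^ q) 0 0 ((B - 1) ^ q) := by
  have h : fromBlocks A 0 0 B - 1 = fromBlocks (A - 1) 0 0 (B - 1) := by
    rw [← fromBlocks_one, sub_eq_add_neg, fromBlocks_neg, fromBlocks_add]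
    simp [sub_eq_add_neg]
  induction q with
  | zero => simp
  | succ q ih =>
    rw [pow_succ, ih, h, fromBlocks_multiply]
    simp [pow_succ]

/-- The real normal form of an invertible matrix with a fixed vector. -/
theorem exists_normal_form {n : ℕ} (M : Matrix (Fin n) (Fin n) ℝ) (hM : M.det ≠ 0)
    (u : Fin n → ℝ) (hu : u ≠ 0) (hMu : M *ᵥ u = u) {d : ℕ} (hd : antiperiodicityIndex M = d) :
    ∃ q₀ : ℕ, IsGreatest {q : ℕ | ∃ x, (M - 1) ^ q *ᵥ x = u} q₀ ∧ q₀ + d + 1 ≤ n ∧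
      ∃ (S : Matrix (Fin n) (Fin 1 ⊕ (Fin (n - d - 1) ⊕ Fin d)) ℝ)
        (S' : Matrix (Fin 1 ⊕ (Fin (n - d - 1) ⊕ Fin d)) (Fin n) ℝ)
        (L : Matrix (Fin 1) (Fin (n - d - 1)) ℝ)
        (H₁ : Matrix (Fin (n - d - 1)) (Fin (n - d - 1)) ℝ) (H₂ : Matrix (Fin d) (Fin d) ℝ),
        S * S' = 1 ∧ S' * S = 1 ∧ (∀ i, S i (.inl 0) = u i) ∧
        M * S = S * (blockReflection (n - d - 1) d * exp (floquetBlock L H₁ H₂)) ∧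
        ∀ j : Fin (n - d - 1), q₀ ≤ j → L 0 j = 0 := by
  obtain ⟨α, κ, β, _, _, _, _, _, _, A, N, B, P, P', h1, h2, hP, hβ, hA, hN, hB⟩ :=
    exists_antiperiodic_decomposition M hM
  obtain ⟨Bp, hBp, hBpx, hBpl⟩ := exists_log_of_pair A N hA hN
  obtain ⟨Bm, hBm⟩ := exists_log_neg B hB
  set Mp := fromBlocks A 0 0 (fromBlocks N 0 0 N) with hMp
  have hP' : P' * M = fromBlocks Mp 0 0 B * P' := by
    rw [← Matrix.mul_one (P' * M), ← h1, Matrix.mul_assoc, ← Matrix.mul_assoc M, hP,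
      ← Matrix.mul_assoc, ← Matrix.mul_assoc, h2, Matrix.one_mul]
  obtain ⟨up, um, hup⟩ : ∃ up um, P' *ᵥ u = Sum.elim up um :=
    ⟨_, _, (Sum.elim_comp_inl_inr _).symm⟩
  have hfix : fromBlocks Mp 0 0 B *ᵥ (P' *ᵥ u) = P' *ᵥ u := by
    rw [mulVec_mulVec, ← hP', ← mulVec_mulVec, hMu]
  rw [hup, fromBlocks_mulVec, Sum.elim_comp_inl, Sum.elim_comp_inr, Sum.elim_eq_iff] at hfix
  simp only [zero_mulVec, add_zero, zero_add] at hfix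
  -- A fixed vector has no component in the antiperiodic part, as `1` is not an eigenvalue of `B`.
  have hum : um = 0 := eq_zero_of_mulVec_eq_self (hB 1 zero_le_one) hfix.2
  have hPu : P *ᵥ (Sum.elim up 0) = u := by
    rw [← hum, ← hup, mulVec_mulVec, h1, one_mulVec]
  have hup0 : up ≠ 0 := by
    rintro rfl
    apply hu
    rw [← hPu, show (Sum.elim 0 0 : (α ⊕ (κ ⊕ κ)) ⊕ β → ℝ) = 0 from Sum.elim_zero_zero, mulVec_zero]
  have hcard : Fintype.card (α ⊕ (κ ⊕ κ)) + d = n := by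
    have := Matrix.square_of_invertible P P' h1 h2
    rw [Fintype.card_sum, hβ, hd, Fintype.card_fin] at this
    exact this.symm
  have hdiag : ∀ q, (fromBlocks Mp 0 0 B - 1) ^ q = fromBlocks ((Mp - 1) ^ q) 0 0 ((B - 1) ^ q) := by
    exact fromBlocks_diagonal_sub_one_pow Mp B
  have hPq : ∀ q, (M - 1) ^ q * P = P * fromBlocks ((Mp - 1) ^ q) 0 0 ((B - 1) ^ q) := by
    intro q
    rw [← hdiag]
    apply pow_mul_of_mul_eq
    rw [Matrix.sub_mul, hP, Matrix.mul_sub, Matrix.one_mul, Matrix.mul_one]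
  -- As `u` lives in the first summand, solvability is decided there, in dimension `n - d`.
  have hset : ∀ q, (∃ x, (M - 1) ^ q *ᵥ x = u) ↔ ∃ x, (Mp - 1) ^ q *ᵥ x = up := by
    intro q
    constructor
    · rintro ⟨x, hx⟩
      refine ⟨(P' *ᵥ x) ∘ Sum.inl, ?_⟩
      have h3 : P' *ᵥ u = fromBlocks ((Mp - 1) ^ q) 0 0 ((B - 1) ^ q) *ᵥ (P' *ᵥ x) := by
        rw [← hx, mulVec_mulVec, mulVec_mulVec]
        congr 1
        calc P' * (M - 1) ^ q = P' * ((M - 1) ^ q * P) * P' := by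
              rw [Matrix.mul_assoc, Matrix.mul_assoc, h1, Matrix.mul_one]
          _ = _ := by rw [hPq, ← Matrix.mul_assoc P', h2, Matrix.one_mul]
      rw [hup, fromBlocks_mulVec, Sum.elim_eq_iff] at h3
      rw [h3.1]; simp
    · rintro ⟨x, hx⟩
      refine ⟨P *ᵥ Sum.elim x 0, ?_⟩
      rw [mulVec_mulVec, hPq, ← mulVec_mulVec, fromBlocks_mulVec, Sum.elim_comp_inl, Sum.elim_comp_inr, hx, ← hPu]
      simp
  have hlt : ∀ q, (∃ x, (M - 1) ^ q *ᵥ x = u) → q < Fintype.card (α ⊕ (κ ⊕ κ)) := by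
    intro q hq
    obtain ⟨x, hx⟩ := (hset q).1 hq
    exact lt_card_of_pow_mulVec_eq hup0 hfix.1 hx
  obtain ⟨q₀, hq₀⟩ : ∃ q₀, IsGreatest {q : ℕ | ∃ x, (M - 1) ^ q *ᵥ x = u} q₀ := by
    have hne : {q : ℕ | ∃ x, (M - 1) ^ q *ᵥ x = u}.Nonempty := ⟨0, u, by simp⟩
    have hbdd : BddAbove {q : ℕ | ∃ x, (M - 1) ^ q *ᵥ x = u} :=
      ⟨Fintype.card (α ⊕ (κ ⊕ κ)), fun q hq => (hlt q hq).le⟩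
    exact ⟨_, Nat.sSup_mem hne hbdd, fun q hq => le_csSup hbdd hq⟩
  have hq₀lt := hlt q₀ hq₀.1
  refine ⟨q₀, hq₀, by omega, ?_⟩
  -- The columns of `Sp` are `up` and a basis of `ker l` adapted to `l ᵥ* Bp`, which becomes the
  -- first row of the logarithm.
  obtain ⟨l, hlu, hl⟩ := exists_covector Mp up hup0
  obtain ⟨Sp, Sp', hS1, hS2, hSu, hlS, hwS⟩ := exists_adapted_basis (N := n - d - 1)
    (by omega) up l (l ᵥ* Bp) hlu
  -- As `l ᵥ* Sp` is the first unit covector, `l` is the first row of the inverse.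
  have hSp'0 : ∀ i, Sp' (.inl 0) i = l i := by
    intro i
    have h3 : l = (l ᵥ* Sp) ᵥ* Sp' := by rw [vecMul_vecMul, hS1, vecMul_one]
    rw [h3, hlS]
    simp [vecMul, dotProduct]
  set Y := Sp' * Bp * Sp with hY
  -- The first column of `Y` is the logarithm applied to the fixed vector `up`.
  have hY1 : Y.toBlocks₁₁ = 0 ∧ Y.toBlocks₂₁ = 0 := by
    have h3 : ∀ i, Y i (.inl 0) = 0 := by
      intro i
      have h4 : ∀ i, (Bp * Sp) i (.inl 0) = 0 := by
        intro i
        have := congrFun (hBpx up hfix.1) i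
        simpa [Matrix.mul_apply, hSu, mulVec, dotProduct] using this
      rw [hY, Matrix.mul_assoc, Matrix.mul_apply]
      simp [h4]
    constructor <;> ext i j <;> rw [Subsingleton.elim j 0] <;> simp [toBlocks₁₁, toBlocks₂₁, h3]
  have hYL : ∀ j, Y (.inl 0) (.inr j) = ((l ᵥ* Bp) ᵥ* Sp) (.inr j) := by
    intro j
    have h3 : Y (.inl 0) = (Sp' (.inl 0) ᵥ* Bp) ᵥ* Sp := by
      rw [vecMul_vecMul]
      funext i
      rw [hY, Matrix.mul_assoc, Matrix.mul_apply]
      rfl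
    rw [h3, show Sp' (.inl 0) = l from funext hSp'0]
  have hexpY : Mp * Sp = Sp * exp Y := by
    rw [← hBp]
    have h3 := mul_exp_of_mul_eq Sp Y Bp (by
      rw [hY, ← Matrix.mul_assoc, ← Matrix.mul_assoc, hS1, Matrix.one_mul])
    exact h3.symm
  obtain ⟨b⟩ : Nonempty (Fin d ≃ β) := ⟨Fintype.equivOfCardEq (by rw [hβ, hd, Fintype.card_fin])⟩
  let R : Matrix β (Fin d) ℝ := (1 : Matrix β β ℝ).submatrix id b
  let R' : Matrix (Fin d) β ℝ := (1 : Matrix β β ℝ).submatrix b id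
  have hR1 : R * R' = 1 := by
    simp only [R, R']
    rw [submatrix_mul_equiv, Matrix.mul_one, submatrix_id_id]
  have hR2 : R' * R = 1 := by
    simp only [R, R']
    rw [submatrix_mul 1 1 b id b Function.bijective_id |>.symm, Matrix.mul_one, submatrix_one_equiv]
  have hexpR : B * R = R * -exp (Bm.submatrix b b) := by
    rw [exp_submatrix_equiv, hBm]
    refine (mul_submatrix_one (Equiv.refl β) b B).trans ?_
    rw [one_submatrix_mul]
    ext i j
    simp
  -- The logarithm groups the flow direction with `v`, the frame groups `v` with `w`.
  let a := (Equiv.sumAssoc (Fin 1) (Fin (n - d - 1)) (Fin d)).symm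
  set S₀ := P * fromBlocks Sp 0 0 R with hS₀
  set S₀' := fromBlocks Sp' 0 0 R' * P' with hS₀'
  have h01 : S₀ * S₀' = 1 := by
    rw [hS₀, hS₀', Matrix.mul_assoc, ← Matrix.mul_assoc (fromBlocks _ _ _ _), fromBlocks_multiply,
      hS1, hR1]
    simp [h1]
  have h02 : S₀' * S₀ = 1 := by
    rw [hS₀, hS₀', Matrix.mul_assoc, ← Matrix.mul_assoc P', h2, Matrix.one_mul, fromBlocks_multiply,
      hS2, hR2]
    simp
  have hMS₀ : M * S₀ = S₀ * (fromBlocks 1 0 0 (-1) * exp (fromBlocks Y 0 0 (Bm.submatrix b b))) := by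
    rw [exp_fromBlocks_diagonal, fromBlocks_multiply, hS₀, ← Matrix.mul_assoc, hP, Matrix.mul_assoc,
      Matrix.mul_assoc, fromBlocks_multiply, fromBlocks_multiply]
    simp [hexpY, hexpR]
  have hblock : floquetBlock Y.toBlocks₁₂ Y.toBlocks₂₂ (Bm.submatrix b b) =
      (fromBlocks Y 0 0 (Bm.submatrix b b)).submatrix a a := by
    conv_rhs => rw [← fromBlocks_toBlocks Y, hY1.1, hY1.2]
    ext (i | i | i) (j | j | j) <;> simp [a, floquetBlock]
  have hK : blockReflection (n - d - 1) d =
      (fromBlocks (1 : Matrix (Fin 1 ⊕ Fin (n - d - 1)) _ ℝ) 0 0 (-1)).submatrix a a := by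
    ext (i | i | i) (j | j | j) <;> simp [a, blockReflection, Matrix.one_apply]
  refine ⟨S₀.submatrix id a, S₀'.submatrix a id, Y.toBlocks₁₂, Y.toBlocks₂₂, Bm.submatrix b b,
    ?_, ?_, ?_, ?_, ?_⟩
  · rw [submatrix_mul_equiv, h01, submatrix_id_id]
  · rw [submatrix_mul S₀' S₀ a id a Function.bijective_id |>.symm, h02, submatrix_one_equiv]
  · intro i
    have h3 : S₀ i (.inl (.inl 0)) = (P *ᵥ Sum.elim up 0) i := by
      rw [hS₀, Matrix.mul_apply]
      simp [mulVec, dotProduct, hSu]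
    rw [← hPu, ← h3]
    simp [a]
  · rw [hblock, exp_submatrix_equiv, hK, submatrix_mul_equiv, submatrix_mul_equiv, ← hMS₀]
    ext i j
    simp [Matrix.mul_apply]
  · intro j hj
    show Y (.inl 0) (.inr j) = 0
    rw [hYL]
    -- For `q₀ = 0` the covector `l` is fixed, so the logarithm kills it. For `q₀ > 0` the adapted
    -- basis already removes every entry but the first.
    rcases Nat.eq_zero_or_pos q₀ with h0 | h0
    · have h3 : ¬ ∃ x, (Mp - 1) *ᵥ x = up := by
        intro h4
        have := hq₀.2 (show 1 ∈ {q : ℕ | ∃ x, (M - 1) ^ q *ᵥ x = u} from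
          (hset 1).2 (by simpa using h4))
        omega
      rw [hBpl l (hl h3), zero_vecMul]
      rfl
    · exact hwS j (by omega)

end FloquetForm

/-! ### Tubular coordinates around a periodic orbit. -/

namespace FloquetForm

open Set Filter Topology

/-- The data of a moving frame along a periodic orbit `φ` of `f`: the frame `U` satisfies
`U' = A U - f(φ) ℓ - U H` and is periodic up to the involution `κ`. -/
structure IsFloquetFrame {Z W : Type*} [NormedAddCommGroup Z] [NormedSpace ℝ Z]
    [NormedAddCommGroup W] [NormedSpace ℝ W] (r : ℕ∞) (f : Z → Z) (D : Set Z) (T : ℝ) (φ : ℝ → Z)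
    (U : ℝ → W →L[ℝ] Z) (κ : W ≃ₗᵢ[ℝ] W) (ℓ : W →L[ℝ] ℝ) (H : W →L[ℝ] W) : Prop where
  contDiff_orbit : ContDiff ℝ r φ
  contDiff_frame : ContDiff ℝ r U
  orbit_mem : ∀ s, φ s ∈ D
  hasDerivAt_orbit : ∀ s, HasDerivAt φ (f (φ s)) s
  hasDerivAt_frame : ∀ s, ∃ A : Z →L[ℝ] Z, HasFDerivAt f A (φ s) ∧
    HasDerivAt U (A ∘L U s - ℓ.smulRight (f (φ s)) - U s ∘L H) s
  bijective : ∀ s, Function.Bijective fun p : ℝ × W => p.1 • f (φ s) + U s p.2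
  orbit_periodic : ∀ s, φ (s + T) = φ s
  frame_periodic : ∀ s w, U (s + T) w = U s (κ w)
  invol : ∀ w, κ (κ w) = w
  form_invariant : ∀ w, ℓ (κ w) = ℓ w
  commute : ∀ w, H (κ w) = κ (H w)

/-- The tubular coordinates given by a moving frame. -/
def tube {Z W : Type*} [NormedAddCommGroup Z] [NormedSpace ℝ Z]
    [NormedAddCommGroup W] [NormedSpace ℝ W] (φ : ℝ → Z) (U : ℝ → W →L[ℝ] Z) (p : ℝ × W) : Z :=
  φ p.1 + U p.1 p.2

section

variable {Z W : Type*} [NormedAddCommGroup Z] [NormedSpace ℝ Z] [NormedAddCommGroup W]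
  [NormedSpace ℝ W] {r : ℕ∞} {f : Z → Z} {D : Set Z} {T : ℝ}
  {φ : ℝ → Z} {U : ℝ → W →L[ℝ] Z} {κ : W ≃ₗᵢ[ℝ] W} {ℓ : W →L[ℝ] ℝ} {H : W →L[ℝ] W}

theorem contDiff_tube (hφ : ContDiff ℝ r φ) (hU : ContDiff ℝ r U) : ContDiff ℝ r (tube φ U) :=
  (hφ.comp contDiff_fst).add ((hU.comp contDiff_fst).clm_apply contDiff_snd)

theorem hasFDerivAt_tube {φ' : Z} {U' : W →L[ℝ] Z} {p : ℝ × W} (hφ : HasDerivAt φ φ' p.1)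
    (hU : HasDerivAt U U' p.1) :
    HasFDerivAt (tube φ U) ((ContinuousLinearMap.fst ℝ ℝ W).smulRight (φ' + U' p.2) +
      U p.1 ∘L ContinuousLinearMap.snd ℝ ℝ W) p := by
  have h1 := hφ.hasFDerivAt.comp p hasFDerivAt_fst
  have h2 := (hU.hasFDerivAt.comp p hasFDerivAt_fst).clm_apply
    (hasFDerivAt_snd (𝕜 := ℝ) (p := p))
  refine (h1.add h2).congr_fderiv ?_
  ext
  · simp [add_comm]
  · simp

/-- A property that is compatible with the symmetry of the tube has to be checked over one period
only. -/
theorem forall_of_forall_mem_Icc (hT : 0 < T) (κ : W ≃ₗᵢ[ℝ] W) {δ : ℝ} {Q : ℝ → W → Prop}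
    (hκ : ∀ w, κ (κ w) = w)
    (hQ : ∀ s w, Q (s + T) w ↔ Q s (κ w)) (h : ∀ s ∈ Icc 0 T, ∀ w, ‖w‖ ≤ δ → Q s w) :
    ∀ s w, ‖w‖ ≤ δ → Q s w := by
  have key : ∀ k : ℤ, ∀ s ∈ Icc 0 T, ∀ w, ‖w‖ ≤ δ → Q (s + k * T) w := by
    intro k
    induction k using Int.induction_on with
    | zero => intro s hs w hw; simpa using h s hs w hw
    | succ k ih =>
      intro s hs w hw
      have := (hQ (s + k * T) w).2 (ih s hs (κ w) (by simpa using hw))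
      convert this using 1
      push_cast; ring
    | pred k ih =>
      intro s hs w hw
      -- Going backwards, the symmetry is used at `κ w`, and `κ (κ w) = w` restores `w`.
      have := (hQ (s + ((-(k : ℤ) - 1 : ℤ) : ℝ) * T) (κ w)).1 (by
        convert ih s hs (κ w) (by simpa using hw) using 1
        push_cast; ring)
      rwa [hκ] at this
  intro s w hw
  have hmem := Ico_subset_Icc_self (toIcoMod_mem_Ico' hT s)
  have := key (toIcoDiv hT 0 s) _ hmem w hw
  rwa [← zsmul_eq_mul, toIcoMod_add_toIcoDiv_zsmul] at this

namespace IsFloquetFrame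

variable (F : IsFloquetFrame r f D T φ U κ ℓ H)

include F in
theorem tube_add (p : ℝ × W) : tube φ U (p.1 + T, p.2) = tube φ U (p.1, κ p.2) := by
  simp [tube, F.orbit_periodic, F.frame_periodic]

/-- The symmetry of the tangent spaces of the tube. -/
def flip (κ : W ≃ₗᵢ[ℝ] W) : (ℝ × W) ≃L[ℝ] ℝ × W :=
  (ContinuousLinearEquiv.refl ℝ ℝ).prodCongr κ.toContinuousLinearEquiv

theorem flip_apply (κ : W ≃ₗᵢ[ℝ] W) (p : ℝ × W) : flip κ p = (p.1, κ p.2) := rfl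

theorem norm_flip (κ : W ≃ₗᵢ[ℝ] W) (p : ℝ × W) : ‖flip κ p‖ = ‖p‖ := by
  simp [flip_apply, Prod.norm_def]

include F in
theorem differentiable_tube (hr : 1 ≤ r) : Differentiable ℝ (tube φ U) :=
  (contDiff_tube F.contDiff_orbit F.contDiff_frame).differentiable (by
    intro h; rw [WithTop.coe_eq_zero] at h; simp [h] at hr)

-- This is the derivative of the symmetry `tube_add`.
include F in
theorem fderiv_tube_add (hr : 1 ≤ r) (s : ℝ) (w : W) :
    fderiv ℝ (tube φ U) (s + T, w) =
      fderiv ℝ (tube φ U) (s, κ w) ∘L (flip κ : (ℝ × W) →L[ℝ] ℝ × W) := by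
  have h1 : HasFDerivAt (fun p : ℝ × W => tube φ U (p.1 + T, p.2))
      (fderiv ℝ (tube φ U) (s + T, w)) (s, w) := by
    have := (F.differentiable_tube hr (s + T, w)).hasFDerivAt
    have h2 : HasFDerivAt (fun p : ℝ × W => (p.1 + T, p.2))
        (ContinuousLinearMap.id ℝ (ℝ × W)) (s, w) := by
      have := (hasFDerivAt_id (𝕜 := ℝ) (s, w)).add_const ((T, 0) : ℝ × W)
      refine this.congr_of_eventuallyEq (Eventually.of_forall fun p => ?_)
      ext <;> simp
    simpa using! this.comp (s, w) h2
  have h3 : HasFDerivAt (fun p : ℝ × W => tube φ U (p.1 + T, p.2))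
      (fderiv ℝ (tube φ U) (s, κ w) ∘L (flip κ : (ℝ × W) →L[ℝ] ℝ × W)) (s, w) := by
    have := (F.differentiable_tube hr (s, κ w)).hasFDerivAt
    have h4 := HasFDerivAt.comp (f := flip κ) (s, w) this (flip κ).hasFDerivAt
    refine h4.congr_of_eventuallyEq (Eventually.of_forall fun p => ?_)
    exact F.tube_add p
  exact h1.unique h3

end IsFloquetFrame

end

section

variable {Z W : Type*} [NormedAddCommGroup Z] [NormedSpace ℝ Z] [NormedAddCommGroup W]
  [NormedSpace ℝ W] {r : ℕ∞} {f : Z → Z} {D : Set Z} {T : ℝ}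
  {φ : ℝ → Z} {U : ℝ → W →L[ℝ] Z} {κ : W ≃ₗᵢ[ℝ] W} {ℓ : W →L[ℝ] ℝ} {H : W →L[ℝ] W}

namespace IsFloquetFrame

variable (F : IsFloquetFrame r f D T φ U κ ℓ H)

-- On the orbit the term `U'(s) w` drops out, and what remains is the map that the frame requires to
-- be bijective.
include F in
theorem isInvertible_zero [FiniteDimensional ℝ W] (s : ℝ) : (fderiv ℝ (tube φ U) (s, 0)).IsInvertible := by
  obtain ⟨A, -, hU⟩ := F.hasDerivAt_frame s
  have h := (hasFDerivAt_tube (p := (s, 0)) (F.hasDerivAt_orbit s) hU).fderiv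
  rw [h]
  refine ⟨(LinearEquiv.ofBijective (((ContinuousLinearMap.fst ℝ ℝ W).smulRight (f (φ s)) +
    U s ∘L ContinuousLinearMap.snd ℝ ℝ W : (ℝ × W) →L[ℝ] Z) : (ℝ × W) →ₗ[ℝ] Z)
    (F.bijective s)).toContinuousLinearEquiv, ?_⟩
  ext <;> simp

include F in
/-- On a thin tube, the tubular coordinates are regular, with uniform bounds. -/
theorem exists_tube [FiniteDimensional ℝ Z] [FiniteDimensional ℝ W] (hT : 0 < T) (hr : 1 ≤ r) (hD : IsOpen D) :
    ∃ δ > 0, ∃ C > 0, ∀ s w, ‖w‖ ≤ δ → (fderiv ℝ (tube φ U) (s, w)).IsInvertible ∧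
      tube φ U (s, w) ∈ D ∧ ‖(fderiv ℝ (tube φ U) (s, w)).inverse‖ ≤ C := by
  have : CompleteSpace (ℝ × W) := FiniteDimensional.complete ℝ _
  have hX := contDiff_tube F.contDiff_orbit F.contDiff_frame
  have hX' : Continuous (fderiv ℝ (tube φ U)) := hX.continuous_fderiv (by
    intro h; rw [WithTop.coe_eq_zero] at h; simp [h] at hr)
  -- Both conditions are open and hold on the compact set `[0, T] × {0}`, hence on a thickening of
  -- it.
  set O : Set (ℝ × W) := {p | (fderiv ℝ (tube φ U) p).IsInvertible ∧ tube φ U p ∈ D} with hO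
  have hOo : IsOpen O := by
    have h1 : IsOpen {p : ℝ × W | (fderiv ℝ (tube φ U) p).IsInvertible} :=
      (ContinuousLinearEquiv.isOpen (𝕜 := ℝ) (E := ℝ × W) (F := Z)).preimage hX'
    exact h1.inter (hD.preimage hX.continuous)
  have hK : IsCompact (Icc 0 T ×ˢ ({0} : Set W)) := isCompact_Icc.prod isCompact_singleton
  have hKO : Icc 0 T ×ˢ ({0} : Set W) ⊆ O := by
    rintro ⟨s, w⟩ ⟨-, hw⟩
    obtain rfl : w = 0 := hw
    refine ⟨F.isInvertible_zero s, ?_⟩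
    simpa [tube] using F.orbit_mem s
  obtain ⟨δ, hδ, hδO⟩ := hK.exists_cthickening_subset_open hOo hKO
  have hδ' : ∀ p ∈ Icc 0 T ×ˢ Metric.closedBall (0 : W) δ, p ∈ O := by
    rintro ⟨s, w⟩ ⟨hs, hw⟩
    refine hδO (Metric.mem_cthickening_of_dist_le (s, w) (s, 0) δ _ ⟨hs, rfl⟩ ?_)
    simpa [Prod.dist_eq] using hw
  have hcont : ContinuousOn (fun p => (fderiv ℝ (tube φ U) p).inverse)
      (Icc 0 T ×ˢ Metric.closedBall (0 : W) δ) := by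
    intro p hp
    obtain ⟨e, he⟩ := (hδ' p hp).1
    have h1 : ContinuousAt ContinuousLinearMap.inverse (fderiv ℝ (tube φ U) p) := by
      rw [← he]
      exact (contDiffAt_map_inverse (𝕜 := ℝ) (n := 0) e).continuousAt
    exact (ContinuousAt.comp (f := fderiv ℝ (tube φ U)) h1 hX'.continuousAt).continuousWithinAt
  obtain ⟨C, hC⟩ := (isCompact_Icc.prod (isCompact_closedBall (0 : W) δ)).exists_bound_of_continuousOn
    hcont
  refine ⟨δ, hδ, max C 1, by positivity, ?_⟩
  -- The symmetry preserves invertibility, and also the norm of the inverse because `κ` is an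
  -- isometry; so one period suffices.
  refine forall_of_forall_mem_Icc hT κ F.invol (fun s w => ?_) fun s hs w hw => ?_
  · rw [F.fderiv_tube_add hr, F.tube_add (s, w)]
    have hinv : (fderiv ℝ (tube φ U) (s, κ w) ∘L
        (flip κ : (ℝ × W) →L[ℝ] ℝ × W)).IsInvertible ↔
        (fderiv ℝ (tube φ U) (s, κ w)).IsInvertible :=
      ContinuousLinearMap.isInvertible_comp_equiv
    rw [hinv, ContinuousLinearMap.inverse_comp_equiv]
    have hnorm : ∀ B : Z →L[ℝ] ℝ × W,
        ‖((flip κ).symm : (ℝ × W) →L[ℝ] ℝ × W) ∘L B‖ = ‖B‖ := by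
      intro B
      apply le_antisymm
      · refine ContinuousLinearMap.opNorm_le_bound _ (norm_nonneg _) fun z => ?_
        rw [← norm_flip κ]
        simpa using B.le_opNorm z
      · refine ContinuousLinearMap.opNorm_le_bound _ (norm_nonneg _) fun z => ?_
        have := (((flip κ).symm : (ℝ × W) →L[ℝ] ℝ × W) ∘L B).le_opNorm z
        rw [← norm_flip κ] at this
        simpa using this
    rw [hnorm]
  · have hm : (s, w) ∈ Icc 0 T ×ˢ Metric.closedBall (0 : W) δ := ⟨hs, by simpa using hw⟩
    exact ⟨(hδ' _ hm).1, (hδ' _ hm).2, (hC _ hm).trans (le_max_left _ _)⟩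

/-- The vector `z` at the point `X(p)` of the tube, in tubular coordinates. -/
noncomputable def pull (φ : ℝ → Z) (U : ℝ → W →L[ℝ] Z) (p : ℝ × W) (z : Z) : ℝ × W :=
  (fderiv ℝ (tube φ U) p).inverse z

-- `ContinuousLinearMap.inverse` respects composition with equivalences also at singular points,
-- where it is `0`, so the symmetry is not restricted to the tube.
include F in
theorem pull_add (hr : 1 ≤ r) (s : ℝ) (w : W) (z : Z) :
    pull φ U (s + T, w) z = flip κ (pull φ U (s, κ w) z) := by
  have hsymm : (flip κ).symm = flip κ := by
    refine ContinuousLinearEquiv.ext (funext fun p => ?_)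
    rw [ContinuousLinearEquiv.symm_apply_eq]
    simp [flip_apply, F.invol]
  rw [pull, F.fderiv_tube_add hr, ContinuousLinearMap.inverse_comp_equiv, hsymm]
  rfl

/-- The autonomous remainder of the normal form. -/
noncomputable def remainder (f : Z → Z) (φ : ℝ → Z) (U : ℝ → W →L[ℝ] Z) (ℓ : W →L[ℝ] ℝ)
    (H : W →L[ℝ] W) (s : ℝ) (w : W) : ℝ × W :=
  pull φ U (s, w) (f (tube φ U (s, w))) - (1 + ℓ w, H w)

include F in
theorem remainder_add (hr : 1 ≤ r) (s : ℝ) (w : W) :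
    remainder f φ U ℓ H (s + T) w = flip κ (remainder f φ U ℓ H s (κ w)) := by
  rw [remainder, remainder, F.pull_add hr, F.tube_add (s, w), map_sub]
  congr 1
  simp [flip_apply, F.form_invariant, F.commute, F.invol]

-- By the frame equation, the derivative of the tube map sends `(1 + ℓ w, H w)` to `f(φ) + A U w +
-- (ℓ w) U' w`. This differs from `f` at the point of the tube by `o(‖w‖)`, and the uniformly
-- bounded inverse keeps that order.
include F in
theorem hasFDerivAt_remainder {δ C : ℝ} (hδ : 0 < δ)
    (hC : ∀ s w, ‖w‖ ≤ δ → (fderiv ℝ (tube φ U) (s, w)).IsInvertible ∧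
      tube φ U (s, w) ∈ D ∧ ‖(fderiv ℝ (tube φ U) (s, w)).inverse‖ ≤ C) (s : ℝ) :
    remainder f φ U ℓ H s 0 = 0 ∧
      HasFDerivAt (remainder f φ U ℓ H s) (0 : W →L[ℝ] ℝ × W) 0 := by
  obtain ⟨A, hA, hU⟩ := F.hasDerivAt_frame s
  set U' := A ∘L U s - ℓ.smulRight (f (φ s)) - U s ∘L H with hU'
  have hD : ∀ w, fderiv ℝ (tube φ U) (s, w) =
      (ContinuousLinearMap.fst ℝ ℝ W).smulRight (f (φ s) + U' w) +
      U s ∘L ContinuousLinearMap.snd ℝ ℝ W := fun w =>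
    (hasFDerivAt_tube (p := (s, w)) (F.hasDerivAt_orbit s) hU).fderiv
  set h : W → Z := fun w => f (tube φ U (s, w)) - (f (φ s) + A (U s w) + ℓ w • U' w) with hh
  have hrem : ∀ w, ‖w‖ ≤ δ → remainder f φ U ℓ H s w = pull φ U (s, w) (h w) := by
    intro w hw
    obtain ⟨e, he⟩ := (hC s w hw).1
    have hpull : ∀ z, pull φ U (s, w) z = e.symm z := by
      intro z
      rw [pull, ← he, ContinuousLinearMap.inverse_equiv]
      rfl
    have he2 : e (1 + ℓ w, H w) = f (φ s) + A (U s w) + ℓ w • U' w := by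
      have h1 : e (1 + ℓ w, H w) = fderiv ℝ (tube φ U) (s, w) (1 + ℓ w, H w) := by rw [← he]; rfl
      have h2 : A (U s w) = U' w + ℓ w • f (φ s) + U s (H w) := by simp [hU']; abel
      rw [h1, hD, h2]
      simp only [_root_.add_apply, ContinuousLinearMap.smulRight_apply,
        ContinuousLinearMap.coe_fst', ContinuousLinearMap.comp_apply, ContinuousLinearMap.coe_snd',
        add_smul, one_smul, smul_add]
      abel
    rw [remainder, hpull, hpull, hh]
    simp only
    rw [map_sub, ← he2, e.symm_apply_apply]
  have h0 : h 0 = 0 := by simp [hh, tube]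
  have hz : remainder f φ U ℓ H s 0 = 0 := by
    rw [hrem 0 (by simpa using hδ.le), h0]
    simp [pull]
  refine ⟨hz, ?_⟩
  have hhd : HasFDerivAt h (0 : W →L[ℝ] Z) 0 := by
    have h1 : HasFDerivAt (fun w => tube φ U (s, w)) (U s) 0 := by
      simpa [tube] using (U s).hasFDerivAt.const_add (φ s)
    have h2 : HasFDerivAt (fun w => f (tube φ U (s, w))) (A ∘L U s) 0 := by
      have hA' : HasFDerivAt f A (tube φ U (s, 0)) := by simpa [tube] using hA
      exact hA'.comp 0 h1
    have h3 : HasFDerivAt (fun w => f (φ s) + A (U s w)) (A ∘L U s) 0 :=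
      (A ∘L U s).hasFDerivAt.const_add _
    have h4 : HasFDerivAt (fun w => ℓ w • U' w) (0 : W →L[ℝ] Z) 0 := by
      refine (ℓ.hasFDerivAt.smul U'.hasFDerivAt).congr_fderiv ?_
      ext; simp
    refine (h2.sub (h3.add h4)).congr_fderiv ?_
    simp
  rw [hasFDerivAt_iff_isLittleO_nhds_zero] at hhd ⊢
  simp only [zero_add, h0, hz, sub_zero, _root_.zero_apply] at hhd ⊢
  refine Asymptotics.IsBigO.trans_isLittleO ?_ hhd
  refine Asymptotics.IsBigO.of_bound C ?_
  filter_upwards [Metric.closedBall_mem_nhds (0 : W) hδ] with w hw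
  rw [mem_closedBall_zero_iff] at hw
  rw [hrem w hw]
  exact (ContinuousLinearMap.le_opNorm _ _).trans
    (mul_le_mul_of_nonneg_right (hC s w hw).2.2 (norm_nonneg _))

-- The remainder is an exact difference, so the push-forward identity is pure algebra. A continuous
-- curve whose image is a solution is differentiable because locally it is recovered from that image
-- by a local inverse of the tube map.
include F in
theorem transformsSystem [FiniteDimensional ℝ W] (hr : 1 ≤ r) {δ : ℝ}
    (hδ : ∀ s w, ‖w‖ ≤ δ → (fderiv ℝ (tube φ U) (s, w)).IsInvertible ∧ tube φ U (s, w) ∈ D)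
    (I : Set ℝ) (g : ℝ → Z → Z) :
    TransformsSystem r (tube φ U) {p | ‖p.2‖ < δ} D I (fun t z => f z + g t z)
      (fun t p => (1 + ℓ p.2, H p.2) + remainder f φ U ℓ H p.1 p.2 +
        pull φ U p (g t (tube φ U p))) := by
  have : CompleteSpace (ℝ × W) := FiniteDimensional.complete ℝ _
  have hX := contDiff_tube F.contDiff_orbit F.contDiff_frame
  have hpush : ∀ p ∈ {p : ℝ × W | ‖p.2‖ < δ}, ∃ e : (ℝ × W) ≃L[ℝ] Z,
      HasFDerivAt (tube φ U) (e : (ℝ × W) →L[ℝ] Z) p ∧ ∀ t,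
      e ((1 + ℓ p.2, H p.2) + remainder f φ U ℓ H p.1 p.2 +
        pull φ U p (g t (tube φ U p))) = f (tube φ U p) + g t (tube φ U p) := by
    intro p hp
    obtain ⟨e, he⟩ := (hδ p.1 p.2 (le_of_lt hp)).1
    have hpull : ∀ z, pull φ U p z = e.symm z := by
      intro z
      rw [pull, ← he, ContinuousLinearMap.inverse_equiv]
      rfl
    refine ⟨e, ?_, fun t => ?_⟩
    · rw [he]
      exact (F.differentiable_tube hr p).hasFDerivAt
    · rw [remainder, hpull, hpull, add_sub_cancel, map_add, e.apply_symm_apply,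
        e.apply_symm_apply]
  refine ⟨isOpen_lt (continuous_snd.norm) continuous_const, fun p hp => (hδ p.1 p.2 (le_of_lt hp)).2,
    hX.contDiffOn, fun p hp => ?_, ?_⟩
  · obtain ⟨e, he, h⟩ := hpush p hp
    exact ⟨e, he, fun t _ => h t⟩
  · intro J hJ c hc hcm
    constructor
    · intro h t ht
      obtain ⟨e, he, hG⟩ := hpush (c t) (hcm ht)
      have hs : HasStrictFDerivAt (tube φ U) (e : (ℝ × W) →L[ℝ] Z) (c t) :=
        hX.contDiffAt.hasStrictFDerivAt' he (by
          intro h; rw [WithTop.coe_eq_zero] at h; simp [h] at hr)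
      have h1 := hs.to_localInverse.hasFDerivAt.comp_hasDerivWithinAt t (h t ht)
      rw [← hG t] at h1
      have h2 : ∀ᶠ u in 𝓝[J] t, hs.localInverse (tube φ U) e (c t) (tube φ U (c u)) = c u :=
        (hc t ht).eventually hs.eventually_left_inverse
      have h3 := h1.congr_of_eventuallyEq (f₁ := c) (h2.mono fun u hu => hu.symm)
        (hs.eventually_left_inverse.self_of_nhds).symm
      simpa using h3
    · intro h t ht
      obtain ⟨e, he, hG⟩ := hpush (c t) (hcm ht)
      rw [← hG t]
      exact he.comp_hasDerivWithinAt t (h t ht)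

end IsFloquetFrame

end

end FloquetForm

/-! ### Linearisation of the flow along the orbit. -/

namespace FloquetForm

open Set Filter Topology Asymptotics

/-- The linearisation error of a `C¹` vector field along a compact piece of a curve is uniformly
small. -/
theorem exists_uniform_linearization {Z : Type*} [NormedAddCommGroup Z] [NormedSpace ℝ Z]
    {f : Z → Z} {D : Set Z} (hD : IsOpen D) (hf : ContDiffOn ℝ 1 f D) {K : Set Z}
    (hK : IsCompact K) (hKD : K ⊆ D) {η : ℝ} (hη : 0 < η) :
    ∃ ρ > 0, ∀ a ∈ K, ∀ z, ‖z - a‖ < ρ →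
      ‖f z - f a - fderiv ℝ f a (z - a)‖ ≤ η * ‖z - a‖ := by
  have hcont : ContinuousOn (fderiv ℝ f) D := hf.continuousOn_fderiv_of_isOpen hD le_rfl
  -- Uniform continuity of the derivative near `K` gives one radius for all `a`; the mean value
  -- inequality on the ball does the rest.
  have hunif := hK.uniformContinuousAt_of_continuousAt (fderiv ℝ f)
    (fun a ha => hcont.continuousAt (hD.mem_nhds (hKD ha))) (Metric.dist_mem_uniformity hη)
  obtain ⟨ρ₁, hρ₁, h1⟩ := Metric.mem_uniformity_dist.1 hunif
  obtain ⟨ρ₂, hρ₂, h2⟩ := hK.exists_thickening_subset_open hD hKD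
  refine ⟨min ρ₁ ρ₂, lt_min hρ₁ hρ₂, fun a ha z hz => ?_⟩
  have hball : Metric.ball a (min ρ₁ ρ₂) ⊆ D := fun y hy =>
    h2 (Metric.mem_thickening_iff.2 ⟨a, ha, (Metric.mem_ball.1 hy).trans_le (min_le_right _ _)⟩)
  refine (convex_ball a (min ρ₁ ρ₂)).norm_image_sub_le_of_norm_hasFDerivWithin_le'
    (f' := fderiv ℝ f) (fun y hy => ?_) (fun y hy => ?_)
    (Metric.mem_ball_self (lt_min hρ₁ hρ₂)) (by simpa [dist_eq_norm] using hz)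
  · exact ((hf.differentiableOn one_ne_zero).differentiableAt
      (hD.mem_nhds (hball hy))).hasFDerivAt.hasFDerivWithinAt
  · have := h1 (a := a) (b := y)
      (by rw [dist_comm]; exact (Metric.mem_ball.1 hy).trans_le (min_le_left _ _)) ha
    rw [← dist_eq_norm, dist_comm]
    exact (show dist (fderiv ℝ f a) (fderiv ℝ f y) < η from this).le

section

variable {n : ℕ} {f : Vec n → Vec n} {D : Set (Vec n)} {φ : ℝ → Vec n}
  {Y : ℝ → Vec n →L[ℝ] Vec n}

/-- The solutions near `φ` are approximated, uniformly on bounded time intervals, by the solutions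
of the variational equation. -/
theorem exists_flow_linearization (hD : IsOpen D) (hf : ContDiffOn ℝ 1 f D)
    (hφD : ∀ t, φ t ∈ D) (hφ : ∀ t, HasDerivAt φ (f (φ t)) t) (hY0 : ∀ x, Y 0 x = x)
    (hY : ∀ t, HasDerivAt Y (fderiv ℝ f (φ t) ∘L Y t) t) (b : ℝ) {η : ℝ} (hη : 0 < η) :
    ∃ δ > 0, ∀ x, ‖x‖ < δ → ∀ τ ≤ b, ∀ γ, IsSolutionOn f D γ (Icc 0 τ) → γ 0 = φ 0 + x →
      ∀ t ∈ Icc 0 τ, ‖γ t - φ t - Y t x‖ ≤ η * ‖x‖ := by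
  have hφc : Continuous φ := continuous_iff_continuousAt.2 fun t => (hφ t).continuousAt
  have hK : IsCompact (φ '' Icc 0 b) := isCompact_Icc.image hφc
  have hKD : φ '' Icc 0 b ⊆ D := by rintro _ ⟨t, -, rfl⟩; exact hφD t
  obtain ⟨M, hM⟩ := isCompact_Icc.exists_bound_of_continuousOn (s := Icc 0 b)
    (f := fun t => fderiv ℝ f (φ t)) (((hf.continuousOn_fderiv_of_isOpen hD le_rfl).comp
      hφc.continuousOn fun t _ => hφD t))
  -- `k - 1` bounds the derivative along the orbit; the additional `1` absorbs the linearisation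
  -- error, as `η' ≤ 1`.
  set k := max M 0 + 1 with hk
  have hk0 : 0 < k := by positivity
  have hMk : ∀ t ∈ Icc 0 b, ∀ y, ‖fderiv ℝ f (φ t) y‖ ≤ (k - 1) * ‖y‖ := fun t ht y =>
    (ContinuousLinearMap.le_opNorm _ _).trans (mul_le_mul_of_nonneg_right
      ((hM t ht).trans (by rw [hk, add_sub_cancel_right]; exact le_max_left _ _)) (norm_nonneg _))
  set E := Real.exp ((k + 1) * b) with hE
  have hE0 : 0 < E := Real.exp_pos _
  -- `E` accounts for the growth of `γ - φ` and `exp (k * b)` for the Gronwall inequality; their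
  -- product with `η'` is at most `η`.
  set η' := min 1 (η / (E * Real.exp (k * b))) with hη'
  have hη'0 : 0 < η' := by positivity
  obtain ⟨ρ, hρ, hlin⟩ := exists_uniform_linearization hD hf hK hKD hη'0
  refine ⟨ρ / E, by positivity, fun x hx τ hτ γ hγ hγ0 => ?_⟩
  have hsub : ∀ t ∈ Ico 0 τ, t ∈ Icc 0 b := fun t ht => ⟨ht.1, ht.2.le.trans hτ⟩
  have hexp : ∀ t ∈ Icc 0 τ, Real.exp ((k + 1) * t) ≤ E := fun t ht =>
    Real.exp_le_exp.2 (mul_le_mul_of_nonneg_left (ht.2.trans hτ) (by positivity))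
  have hγd : ∀ t ∈ Ico 0 τ, HasDerivWithinAt (fun t => γ t - φ t) (f (γ t) - f (φ t)) (Ici t) t := by
    intro t ht
    have h1 := ((hγ t (Ico_subset_Icc_self ht)).2.mono
      (Icc_subset_Icc_left ht.1)).mono_of_mem_nhdsWithin (Icc_mem_nhdsGE ht.2)
    exact h1.sub (hφ t).hasDerivWithinAt
  have hγc : ContinuousOn (fun t => γ t - φ t) (Icc 0 τ) := fun t ht =>
    ((hγ t ht).2.continuousWithinAt).sub hφc.continuousWithinAt
  -- A barrier with the larger exponent `k + 1`: the strict inequality is needed only where the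
  -- barrier is touched, and there the distance is already below `ρ`, so no continuation argument is
  -- needed.
  have hclose : ∀ m, ‖x‖ < m → m < ρ / E → ∀ t ∈ Icc 0 τ,
      ‖γ t - φ t‖ ≤ m * Real.exp ((k + 1) * t) := by
    intro m hxm hm
    have hm0 : 0 < m := (norm_nonneg x).trans_lt hxm
    refine image_norm_le_of_norm_deriv_right_lt_deriv_boundary hγc hγd
      (B' := fun t => m * (Real.exp ((k + 1) * t) * (k + 1))) (by simpa [hγ0] using hxm.le)
      (fun t => ?_) fun t ht heq => ?_
    · have h1 : HasDerivAt (fun t => (k + 1) * t) (k + 1) t := by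
        simpa using (hasDerivAt_id t).const_mul (k + 1)
      exact (h1.exp).const_mul m
    · have hpos : 0 < ‖γ t - φ t‖ := by rw [heq]; positivity
      have hlt : ‖γ t - φ t‖ < ρ := by
        rw [heq]
        calc m * Real.exp ((k + 1) * t) ≤ m * E :=
              mul_le_mul_of_nonneg_left (hexp t (Ico_subset_Icc_self ht)) hm0.le
          _ < ρ := (lt_div_iff₀ hE0).1 hm
      have h1 := hlin (φ t) ⟨t, hsub t ht, rfl⟩ (γ t) hlt
      have h2 := hMk t (hsub t ht) (γ t - φ t)
      have h3 : ‖f (γ t) - f (φ t)‖ ≤ k * ‖γ t - φ t‖ := by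
        calc ‖f (γ t) - f (φ t)‖ = ‖(f (γ t) - f (φ t) - fderiv ℝ f (φ t) (γ t - φ t)) +
              fderiv ℝ f (φ t) (γ t - φ t)‖ := by rw [sub_add_cancel]
          _ ≤ η' * ‖γ t - φ t‖ + (k - 1) * ‖γ t - φ t‖ := (norm_add_le _ _).trans (add_le_add h1 h2)
          _ ≤ k * ‖γ t - φ t‖ := by
              have : η' * ‖γ t - φ t‖ ≤ 1 * ‖γ t - φ t‖ :=
                mul_le_mul_of_nonneg_right (min_le_left _ _) (norm_nonneg _)
              linarith
      calc ‖f (γ t) - f (φ t)‖ ≤ k * ‖γ t - φ t‖ := h3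
        _ < (k + 1) * ‖γ t - φ t‖ := by nlinarith
        _ = m * (Real.exp ((k + 1) * t) * (k + 1)) := by rw [heq]; ring
  -- The bound follows as `m` decreases to `‖x‖`.
  have hbound : ∀ t ∈ Icc 0 τ, ‖γ t - φ t‖ ≤ ‖x‖ * E := by
    intro t ht
    by_contra! hlt
    obtain ⟨m, hm1, hm2⟩ := exists_between (lt_min hx ((lt_div_iff₀ hE0).2 hlt))
    have h1 := hclose m hm1 (hm2.trans_le (min_le_left _ _)) t ht
    have h2 : m * E < ‖γ t - φ t‖ := (lt_div_iff₀ hE0).1 (hm2.trans_le (min_le_right _ _))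
    have h3 : m * Real.exp ((k + 1) * t) ≤ m * E :=
      mul_le_mul_of_nonneg_left (hexp t ht) ((norm_nonneg x).trans hm1.le)
    linarith
  have hrd : ∀ t ∈ Ico 0 τ, HasDerivWithinAt (fun t => γ t - φ t - Y t x)
      (f (γ t) - f (φ t) - fderiv ℝ f (φ t) (Y t x)) (Ici t) t := fun t ht =>
    (hγd t ht).sub ((hY t).clm_apply (hasDerivAt_const t x) |>.congr_deriv
      (by simp)).hasDerivWithinAt
  have hYc : Continuous Y := continuous_iff_continuousAt.2 fun t => (hY t).continuousAt
  have hgron := norm_le_gronwallBound_of_norm_deriv_right_le (δ := 0) (K := k)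
    (ε := η' * (‖x‖ * E)) (hγc.sub (hYc.clm_apply continuous_const).continuousOn) hrd
    (by simp [hγ0, hY0]) (fun t ht => by
      have hlt : ‖γ t - φ t‖ < ρ := (hbound t (Ico_subset_Icc_self ht)).trans_lt
        ((lt_div_iff₀ hE0).1 hx)
      have h1 := hlin (φ t) ⟨t, hsub t ht, rfl⟩ (γ t) hlt
      have h2 := hMk t (hsub t ht) (γ t - φ t - Y t x)
      have h3 := mul_le_mul_of_nonneg_left (hbound t (Ico_subset_Icc_self ht)) hη'0.le
      calc ‖f (γ t) - f (φ t) - fderiv ℝ f (φ t) (Y t x)‖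
          = ‖fderiv ℝ f (φ t) (γ t - φ t - Y t x) +
            (f (γ t) - f (φ t) - fderiv ℝ f (φ t) (γ t - φ t))‖ := by
              rw [map_sub]; congr 1; abel
        _ ≤ (k - 1) * ‖γ t - φ t - Y t x‖ + η' * ‖γ t - φ t‖ :=
            (norm_add_le _ _).trans (add_le_add h2 h1)
        _ ≤ k * ‖γ t - φ t - Y t x‖ + η' * (‖x‖ * E) := by
            have := norm_nonneg (γ t - φ t - Y t x)
            linarith)
  intro t ht
  refine (hgron t ht).trans ?_
  rw [gronwallBound_of_K_ne_0 hk0.ne']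
  simp only [sub_zero, zero_mul, zero_add]
  have h1 : Real.exp (k * t) - 1 ≤ Real.exp (k * b) :=
    (sub_le_self _ zero_le_one).trans
      (Real.exp_le_exp.2 (mul_le_mul_of_nonneg_left (ht.2.trans hτ) hk0.le))
  have h2 : η' * (E * Real.exp (k * b)) ≤ η :=
    (le_div_iff₀ (by positivity)).1 (min_le_right _ _)
  have hk1 : 1 ≤ k := by rw [hk]; linarith [le_max_right M 0]
  calc η' * (‖x‖ * E) / k * (Real.exp (k * t) - 1)
      ≤ η' * (‖x‖ * E) / k * Real.exp (k * b) := mul_le_mul_of_nonneg_left h1 (by positivity)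
    _ ≤ η' * (‖x‖ * E) * Real.exp (k * b) := by
        refine mul_le_mul_of_nonneg_right (div_le_self (by positivity) hk1) (by positivity)
    _ = η' * (E * Real.exp (k * b)) * ‖x‖ := by ring
    _ ≤ η * ‖x‖ := mul_le_mul_of_nonneg_right h2 (norm_nonneg _)

/-! ### The derivative of a Poincaré map. -/

/-- The projection onto the kernel of `ℓ` along `v`. -/
noncomputable def kerProj {Z : Type*} [AddCommGroup Z] [Module ℝ Z] (ℓ : Module.Dual ℝ Z) (v : Z)
    (hv : ℓ v = 1) : Z →ₗ[ℝ] LinearMap.ker ℓ :=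
  (LinearMap.id - ℓ.smulRight v).codRestrict _ fun z => by simp [hv]

theorem coe_kerProj {Z : Type*} [AddCommGroup Z] [Module ℝ Z] (ℓ : Module.Dual ℝ Z) (v : Z)
    (hv : ℓ v = 1) (z : Z) : (kerProj ℓ v hv z : Z) = z - ℓ z • v :=
  rfl

/-- In a basis of `v` and of vectors of `ker ℓ`, the matrix of `A` is block triangular with diagonal
blocks `1` and the compression to `ker ℓ` along `v`. -/
theorem charpoly_eq_mul_charpoly_kerProj {Z : Type*} [AddCommGroup Z] [Module ℝ Z]
    [FiniteDimensional ℝ Z] (ℓ : Module.Dual ℝ Z) (v : Z) (hv : ℓ v = 1) (A : Z →ₗ[ℝ] Z)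
    (hA : A v = v) :
    A.charpoly = (Polynomial.X - 1) *
      (kerProj ℓ v hv ∘ₗ A ∘ₗ (LinearMap.ker ℓ).subtype).charpoly := by
  set N := Module.finrank ℝ (LinearMap.ker ℓ)
  let b := Module.finBasis ℝ (LinearMap.ker ℓ)
  obtain ⟨c, hc0, hcs⟩ := exists_basis_cons v ℓ hv b
  let e : Fin (N + 1) ≃ Fin 1 ⊕ Fin N := (finCongr (add_comm N 1)).trans finSumFinEquiv.symm
  have he0 : e.symm (.inl 0) = 0 := by ext; simp [e]
  have hes : ∀ j, e.symm (.inr j) = j.succ := fun j => by ext; simp [e]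
  let C := c.reindex e
  have hC0 : C (.inl 0) = v := by simp [C, he0, hc0]
  have hCs : ∀ j, C (.inr j) = b j := fun j => by simp [C, hes, hcs]
  have hrepr : ∀ z, ∀ j, C.repr z (.inr j) = b.repr (kerProj ℓ v hv z) j := by
    intro z j
    have hz : z = ℓ z • C (.inl 0) + ∑ i, b.repr (kerProj ℓ v hv z) i • C (.inr i) := by
      have h1 := congrArg (LinearMap.ker ℓ).subtype (b.sum_repr (kerProj ℓ v hv z))
      rw [map_sum] at h1
      simp only [map_smul, Submodule.subtype_apply, ← hCs] at h1
      rw [h1, hC0, coe_kerProj, add_sub_cancel]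
    conv_lhs => rw [hz]
    simp [Finsupp.single_apply]
  have hrv : C.repr v = Finsupp.single (.inl 0) 1 := by rw [← hC0, C.repr_self]
  have hM : LinearMap.toMatrix C C A = Matrix.fromBlocks 1
      (LinearMap.toMatrix C C A).toBlocks₁₂ 0
      (LinearMap.toMatrix b b (kerProj ℓ v hv ∘ₗ A ∘ₗ (LinearMap.ker ℓ).subtype)) := by
    ext (i | i) (j | j)
    · rw [Subsingleton.elim j 0, Subsingleton.elim i 0, LinearMap.toMatrix_apply, hC0, hA, hrv]
      simp
    · rfl
    · rw [Subsingleton.elim j 0, LinearMap.toMatrix_apply, hC0, hA, hrv]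
      simp
    · rw [LinearMap.toMatrix_apply, hCs, hrepr, Matrix.fromBlocks_apply₂₂, LinearMap.toMatrix_apply]
      rfl
  rw [← LinearMap.charpoly_toMatrix A C, hM, Matrix.charpoly_fromBlocks_zero₂₁,
    LinearMap.charpoly_toMatrix, Matrix.charpoly_one]
  simp

theorem exists_dual_of_isCompl {Z : Type*} [AddCommGroup Z] [Module ℝ Z] {E : Submodule ℝ Z} {v : Z}
    (hv : v ≠ 0) (h : IsCompl E (Submodule.span ℝ {v})) :
    ∃ ℓ : Module.Dual ℝ Z, ℓ v = 1 ∧ E = LinearMap.ker ℓ := by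
  have hvE : v ∉ E := fun hE => hv
    ((Submodule.disjoint_def.1 h.disjoint) v hE (Submodule.mem_span_singleton_self v))
  obtain ⟨g, hg, hgE⟩ := Submodule.exists_le_ker_of_notMem hvE
  refine ⟨(g v)⁻¹ • g, by simp [inv_mul_cancel₀ hg], le_antisymm (fun z hz => ?_) fun z hz => ?_⟩
  · have := LinearMap.mem_ker.1 (hgE hz)
    simp [this]
  · have hgz : g z = 0 := by simpa [hg] using hz
    obtain ⟨y, hy, w, hw, rfl⟩ := Submodule.mem_sup.1
      (h.sup_eq_top ▸ Submodule.mem_top : z ∈ E ⊔ Submodule.span ℝ {v})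
    obtain ⟨c, rfl⟩ := Submodule.mem_span_singleton.1 hw
    rw [map_add, LinearMap.mem_ker.1 (hgE hy), map_smul, zero_add, smul_eq_mul] at hgz
    rw [(mul_eq_zero.1 hgz).resolve_right hg]
    simpa using hy

/-- A Poincaré map is differentiable at the orbit; its derivative is the monodromy operator modulo
the direction of the flow. -/
theorem differentiableAt_poincareMap (hD : IsOpen D) (hf : ContDiffOn ℝ 1 f D)
    (hφD : ∀ t, φ t ∈ D) (hφ : ∀ t, HasDerivAt φ (f (φ t)) t) (hY0 : ∀ x, Y 0 x = x)
    (hY : ∀ t, HasDerivAt Y (fderiv ℝ f (φ t) ∘L Y t) t) {T : ℝ} (hT : φ T = φ 0)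
    (hv : f (φ 0) ≠ 0) (hYv : Y T (f (φ 0)) = f (φ 0)) {E : Submodule ℝ (Vec n)} {P : E → E}
    (hE : IsCompl E (Submodule.span ℝ {f (φ 0)})) (hP : IsPoincareMap f D (φ 0) T E P) :
    DifferentiableAt ℝ P 0 ∧ (Polynomial.X - 1) * (fderiv ℝ P 0 : E →ₗ[ℝ] E).charpoly =
      (Y T : Vec n →ₗ[ℝ] Vec n).charpoly := by
  obtain ⟨ℓ, hℓv, rfl⟩ := exists_dual_of_isCompl hv hE
  set v := f (φ 0) with hvdef
  obtain ⟨τ, hτ0, hτc, hev⟩ := hP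
  rw [ContinuousAt, hτ0] at hτc
  set ι : LinearMap.ker ℓ → Vec n := fun x => x
  have hYc : Continuous Y := continuous_iff_continuousAt.2 fun t => (hY t).continuousAt
  -- There are three errors: linearising the flow, replacing `Y (τ x)` by `Y T`, and replacing `φ (τ
  -- x)` by its tangent. The last one is at first only `o(τ x - T)`.
  have h1 : (fun x : LinearMap.ker ℓ => φ 0 + P x - φ (τ x) - Y (τ x) x) =o[𝓝 0]
      fun x : LinearMap.ker ℓ => x := by
    rw [isLittleO_iff]
    intro η hη
    obtain ⟨δ, hδ, hflow⟩ := exists_flow_linearization hD hf hφD hφ hY0 hY (T + 1) hη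
    filter_upwards [hev, hτc.eventually (eventually_le_nhds (lt_add_one T)),
      Metric.ball_mem_nhds (0 : LinearMap.ker ℓ) hδ] with x hx hxT hxδ
    obtain ⟨hτpos, γ, hγ, hγ0, hγτ⟩ := hx
    have := hflow x (by simpa using hxδ) (τ x) hxT γ hγ hγ0 (τ x) ⟨hτpos.le, le_rfl⟩
    rw [hγτ] at this
    exact this
  have h2 : (fun x : LinearMap.ker ℓ => Y (τ x) x - Y T x) =o[𝓝 0]
      fun x : LinearMap.ker ℓ => x := by
    rw [isLittleO_iff]
    intro η hη
    have hYT : Tendsto (fun x => Y (τ x)) (𝓝 0) (𝓝 (Y T)) := (hYc.tendsto T).comp hτc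
    filter_upwards [hYT (Metric.closedBall_mem_nhds (Y T) hη)] with x hx
    rw [mem_preimage, Metric.mem_closedBall, dist_eq_norm] at hx
    exact ((Y (τ x) - Y T).le_opNorm x).trans (mul_le_mul_of_nonneg_right hx (norm_nonneg _))
  have h3 : (fun x => φ (τ x) - φ 0 - (τ x - T) • v) =o[𝓝 0] fun x => τ x - T := by
    have hd := hφ T
    rw [hT, hasDerivAt_iff_isLittleO, hT] at hd
    exact hd.comp_tendsto hτc
  let ℓc := LinearMap.toContinuousLinearMap ℓ
  let πc := LinearMap.toContinuousLinearMap (kerProj ℓ v hℓv)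
  have hιO : (fun x : LinearMap.ker ℓ => (x : Vec n)) =O[𝓝 0] fun x : LinearMap.ker ℓ => x :=
    isBigO_of_le _ fun x => le_rfl
  -- The functional `ℓ` kills `P x` and is `1` on `v`. So `τ x - T`, up to `o(τ x - T)`, is a sum of
  -- terms `O(x)`, hence itself `O(x)`.
  have hτO : (fun x => τ x - T) =O[𝓝 0] fun x : LinearMap.ker ℓ => x := by
    have h4 : (fun x => ℓc (φ (τ x) - φ 0 - (τ x - T) • v)) =o[𝓝 0] fun x => τ x - T :=
      (ℓc.isBigO_comp _ _).trans_isLittleO h3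
    refine h4.right_isBigO_add.trans ?_
    have h5 : ∀ x : LinearMap.ker ℓ, ℓc (φ (τ x) - φ 0 - (τ x - T) • v) + (τ x - T) =
        -ℓc (φ 0 + P x - φ (τ x) - Y (τ x) x) - ℓc (Y (τ x) x - Y T x) - ℓc (Y T x) := by
      intro x
      have h6 : ℓ (P x : Vec n) = 0 := (P x).2
      simp only [ℓc, LinearMap.coe_toContinuousLinearMap', map_sub, map_add, map_smul, hℓv, h6,
        smul_eq_mul]
      ring
    simp only [h5]
    exact (((ℓc.isBigO_comp _ _).trans h1.isBigO).neg_left.sub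
      ((ℓc.isBigO_comp _ _).trans h2.isBigO)).sub
      ((ℓc.isBigO_comp _ _).trans (((Y T).isBigO_comp _ _).trans hιO))
  -- With displacement `0` the flow estimate forces `γ = φ`.
  have hP0 : P 0 = 0 := by
    have h6 := hev.self_of_nhds
    have h7 : φ 0 + P 0 - φ (τ 0) - Y (τ 0) (0 : Vec n) = 0 := by
      obtain ⟨hτpos, γ, hγ, hγ0, hγτ⟩ := h6
      obtain ⟨δ, hδ, hflow⟩ := exists_flow_linearization hD hf hφD hφ hY0 hY (τ 0) one_pos
      have := hflow 0 (by simpa using hδ) (τ 0) le_rfl γ hγ (by simpa using hγ0) (τ 0)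
        ⟨hτpos.le, le_rfl⟩
      rw [hγτ, norm_zero, mul_zero] at this
      exact norm_le_zero_iff.1 this
    rw [hτ0, hT, map_zero, sub_zero, add_sub_cancel_left] at h7
    exact Subtype.ext h7
  -- The projection kills `v`, so the first-order variation of the return time drops out.
  have hderiv : HasFDerivAt P (πc ∘L Y T ∘L (LinearMap.ker ℓ).subtypeL) 0 := by
    rw [hasFDerivAt_iff_isLittleO_nhds_zero]
    have h5 : ∀ x : LinearMap.ker ℓ, P (0 + x) - P 0 -
        (πc ∘L Y T ∘L (LinearMap.ker ℓ).subtypeL) x =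
        πc (φ 0 + P x - φ (τ x) - Y (τ x) x) + πc (Y (τ x) x - Y T x) +
          πc (φ (τ x) - φ 0 - (τ x - T) • v) := by
      intro x
      have h6 : πc (P x : Vec n) = P x := by
        apply Subtype.ext
        have : ℓ (P x : Vec n) = 0 := (P x).2
        rw [LinearMap.coe_toContinuousLinearMap', coe_kerProj, this, zero_smul, sub_zero]
      have h7 : πc v = 0 := by
        apply Subtype.ext
        rw [LinearMap.coe_toContinuousLinearMap', coe_kerProj, hℓv, one_smul, sub_self,
          ZeroMemClass.coe_zero]
      simp only [map_sub, map_add, map_smul, h6, h7, smul_zero, zero_add, hP0, sub_zero,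
        ContinuousLinearMap.comp_apply, Submodule.subtypeL_apply]
      abel
    simp only [h5]
    exact (((πc.isBigO_comp _ _).trans_isLittleO h1).add
      ((πc.isBigO_comp _ _).trans_isLittleO h2)).add
      (((πc.isBigO_comp _ _).trans_isLittleO h3).trans_isBigO hτO)
  refine ⟨hderiv.differentiableAt, ?_⟩
  rw [hderiv.fderiv, charpoly_eq_mul_charpoly_kerProj ℓ v hℓv _ hYv]
  rfl

end

end FloquetForm

/-! ### Matrices as operators, and linear differential equations. -/

namespace FloquetForm

open Set Filter Topology Matrix

/-- `mulE M` as a continuous linear map, linear in the matrix `M`. -/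
noncomputable def mulCLM {m p : Type*} [Fintype m] [Fintype p] [DecidableEq p] :
    Matrix m p ℝ →ₗ[ℝ] EuclideanSpace ℝ p →L[ℝ] EuclideanSpace ℝ m :=
  LinearMap.toContinuousLinearMap.toLinearMap ∘ₗ (toLpLin 2 2).toLinearMap

section

variable {m p q : Type*} [Fintype m] [Fintype p] [Fintype q] [DecidableEq p] [DecidableEq q]

theorem ofLp_mulCLM (M : Matrix m p ℝ) (x : EuclideanSpace ℝ p) :
    (mulCLM M x).ofLp = M *ᵥ x.ofLp :=
  rfl

theorem mulCLM_mul (M : Matrix m p ℝ) (N : Matrix p q ℝ) :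
    mulCLM (M * N) = mulCLM M ∘L mulCLM N := by
  ext x i
  simp only [ContinuousLinearMap.comp_apply, ofLp_mulCLM, mulVec_mulVec]

theorem mulCLM_mul_apply (M : Matrix m p ℝ) (N : Matrix p q ℝ) (x : EuclideanSpace ℝ q) :
    mulCLM (M * N) x = mulCLM M (mulCLM N x) := by
  rw [mulCLM_mul]; rfl

theorem mulCLM_one_apply (x : EuclideanSpace ℝ p) : mulCLM (1 : Matrix p p ℝ) x = x := by
  ext i
  rw [ofLp_mulCLM, one_mulVec]

theorem mulCLM_single (M : Matrix m p ℝ) (i : m) (j : p) :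
    mulCLM M (EuclideanSpace.single j 1) i = M i j := by
  rw [ofLp_mulCLM, PiLp.ofLp_single, mulVec_single_one]
  rfl

theorem mulCLM_injective : Function.Injective (mulCLM : Matrix m p ℝ →ₗ[ℝ] _) := by
  intro M N h
  ext i j
  rw [← mulCLM_single M, h, mulCLM_single]

theorem mulCLM_jacobian {n : ℕ} (f : Vec n → Vec n) (z : Vec n) :
    mulCLM (jacobian f z) = fderiv ℝ f z := by
  refine ContinuousLinearMap.coe_injective
    ((EuclideanSpace.basisFun (Fin n) ℝ).toBasis.ext fun j => ?_)
  ext i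
  simp only [OrthonormalBasis.coe_toBasis, EuclideanSpace.basisFun_apply,
    ContinuousLinearMap.coe_coe, mulCLM_single]
  rfl

theorem charpoly_mulCLM (M : Matrix p p ℝ) :
    (mulCLM M : EuclideanSpace ℝ p →ₗ[ℝ] EuclideanSpace ℝ p).charpoly = M.charpoly := by
  have : (mulCLM M : EuclideanSpace ℝ p →ₗ[ℝ] EuclideanSpace ℝ p) = toLpLin 2 2 M := rfl
  rw [this, toLpLin_eq_toLin, charpoly_toLin]

/-- Expansion in matrix units reduces the claim to the entries, without a choice of norm on
matrices. -/
theorem hasDerivAt_mulCLM {Y : ℝ → Matrix m p ℝ} {Y' : Matrix m p ℝ} {t : ℝ}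
    (h : ∀ i j, HasDerivAt (fun u => Y u i j) (Y' i j) t) :
    HasDerivAt (fun u => mulCLM (Y u)) (mulCLM Y') t := by
  classical
  have key : ∀ M : Matrix m p ℝ, mulCLM M = ∑ i, ∑ j, M i j • mulCLM (Matrix.single i j 1) := by
    intro M
    conv_lhs => rw [matrix_eq_sum_single M]
    simp only [map_sum, ← map_smul, smul_single, smul_eq_mul, mul_one]
  rw [key Y']
  simp only [fun u => key (Y u)]
  exact HasDerivAt.fun_sum fun i _ => HasDerivAt.fun_sum fun j _ =>
    HasDerivAt.smul_const (F := EuclideanSpace ℝ p →L[ℝ] EuclideanSpace ℝ m) (h i j) _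

theorem hasDerivAt_mulCLM_exp (B : Matrix p p ℝ) (t : ℝ) :
    HasDerivAt (fun u : ℝ => mulCLM (NormedSpace.exp (u • B)))
      (mulCLM (NormedSpace.exp (t • B)) ∘L mulCLM B) t := by
  let _ : NormedRing (Matrix p p ℝ) := Matrix.linftyOpNormedRing
  let _ : NormedAlgebra ℝ (Matrix p p ℝ) := Matrix.linftyOpNormedAlgebra
  have h := hasDerivAt_exp_smul_const (𝕂 := ℝ) B t
  rw [← mulCLM_mul]
  exact (LinearMap.toContinuousLinearMap
    (mulCLM : Matrix p p ℝ →ₗ[ℝ] _)).hasFDerivAt.comp_hasDerivAt t h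

end

section

variable {E : Type*} [NormedAddCommGroup E] [NormedSpace ℝ E]

/-- The regularity of the solutions of a differential equation. -/
theorem contDiff_of_hasDerivAt {y G : ℝ → E} {r : ℕ∞} (hy : ∀ t, HasDerivAt y (G t) t)
    (h : ∀ k : ℕ, ((k + 1 : ℕ) : ℕ∞) ≤ r → ContDiff ℝ k y → ContDiff ℝ k G) :
    ContDiff ℝ r y := by
  rw [contDiff_iff_forall_nat_le]
  intro k
  induction k with
  | zero =>
    intro _
    exact contDiff_zero.2 (continuous_iff_continuousAt.2 fun t => (hy t).continuousAt)
  | succ k ih =>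
    intro hk
    have hky := ih (le_trans (by exact_mod_cast k.le_succ) hk)
    have hG := h k hk hky
    have hd : deriv y = G := funext fun t => (hy t).deriv
    have : ((k + 1 : ℕ) : WithTop ℕ∞) = (k : WithTop ℕ∞) + 1 := by push_cast; rfl
    rw [this, contDiff_succ_iff_deriv, hd]
    refine ⟨fun t => (hy t).differentiableAt, fun h => ?_, hG⟩
    exact absurd h (by exact WithTop.coe_ne_top (a := (k : ℕ∞)))

theorem contDiff_orbit {f : E → E} {D : Set E} {r : ℕ∞} (hf : ContDiffOn ℝ r f D) {φ : ℝ → E}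
    (hφD : ∀ t, φ t ∈ D) (hφ : ∀ t, HasDerivAt φ (f (φ t)) t) : ContDiff ℝ r φ :=
  contDiff_of_hasDerivAt hφ fun k hk hc => by
    have hkr : (k : WithTop ℕ∞) ≤ (r : WithTop ℕ∞) := by
      exact_mod_cast le_trans (by exact_mod_cast k.le_succ) hk
    exact (hf.of_le hkr).comp_contDiff hc hφD

/-- The derivative of `f` has one class less than `f`, but a solution gains one, so `Y`, and with it
the frame, keeps the class of `f`. -/
theorem contDiff_variational {f : E → E} {D : Set E} (hD : IsOpen D) {r : ℕ∞}
    (hf : ContDiffOn ℝ r f D) {φ : ℝ → E}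
    (hφD : ∀ t, φ t ∈ D) (hφ : ∀ t, HasDerivAt φ (f (φ t)) t) {F : Type*} [NormedAddCommGroup F]
    [NormedSpace ℝ F] {Y : ℝ → F →L[ℝ] E}
    (hY : ∀ t, HasDerivAt Y (fderiv ℝ f (φ t) ∘L Y t) t) : ContDiff ℝ r Y :=
  contDiff_of_hasDerivAt hY fun k hk hc => by
    have hkr : (k : WithTop ℕ∞) + 1 ≤ (r : WithTop ℕ∞) := by exact_mod_cast hk
    refine ContDiff.clm_comp ?_ hc
    exact (hf.fderiv_of_isOpen hD hkr).comp_contDiff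
      ((contDiff_orbit hf hφD hφ).of_le (le_self_add.trans hkr)) hφD

/-- The solutions of a linear system are determined by their initial values. -/
theorem eq_apply_of_hasDerivAt [CompleteSpace E] {A Y : ℝ → E →L[ℝ] E}
    (hY : ∀ t, HasDerivAt Y (A t ∘L Y t) t) (hu : ∀ t, IsUnit (Y t)) (hY0 : ∀ x, Y 0 x = x)
    {y : ℝ → E} (hy : ∀ t, HasDerivAt y (A t (y t)) t) (t : ℝ) : y t = Y t (y 0) := by
  have hinv : ∀ t x, Y t (Ring.inverse (Y t) x) = x := fun t x =>
    congrArg (fun Z : E →L[ℝ] E => Z x) (Ring.mul_inverse_cancel _ (hu t))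
  -- Variation of constants: `Y⁻¹ y` has derivative zero.
  have hd : ∀ t, HasDerivAt (fun t => Ring.inverse (Y t) (y t)) 0 t := by
    intro t
    obtain ⟨u, hut⟩ := hu t
    have h1 : HasFDerivAt Ring.inverse _ (Y t) := hut ▸ hasFDerivAt_ringInverse (𝕜 := ℝ) u
    have h2 := (h1.comp_hasDerivAt t (hY t)).clm_apply (hy t)
    refine h2.congr_deriv ?_
    have h3 : Ring.inverse (Y t) = (↑u⁻¹ : E →L[ℝ] E) := by rw [← hut, Ring.inverse_unit]
    have h4 : ∀ x, Y t ((↑u⁻¹ : E →L[ℝ] E) x) = x := by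
      intro x; rw [← h3]; exact hinv t x
    simp [h3, h4]
  have hc := is_const_of_deriv_eq_zero (fun t => (hd t).differentiableAt) (fun t => (hd t).deriv) t 0
  have h0 : Ring.inverse (Y 0) (y 0) = y 0 := by
    have := hY0 (Ring.inverse (Y 0) (y 0))
    rw [hinv] at this
    exact this.symm
  simp only [h0] at hc
  rw [← hc, hinv]

end

end FloquetForm

/-! ### The Floquet frame. -/

namespace FloquetForm

open Set Filter Topology Matrix

section

variable {a b : ℕ}

/-- The coordinates `(s, v, w)` as one vector. -/
noncomputable def join :
    (ℝ × Vec a × Vec b) →L[ℝ] EuclideanSpace ℝ (Fin 1 ⊕ (Fin a ⊕ Fin b)) :=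
  LinearMap.toContinuousLinearMap
    { toFun := fun p => WithLp.toLp 2 (Sum.elim (fun _ => p.1) (Sum.elim p.2.1.ofLp p.2.2.ofLp))
      map_add' := fun p q => by ext (i | i | i) <;> rfl
      map_smul' := fun c p => by ext (i | i | i) <;> rfl }

theorem ofLp_join (p : ℝ × Vec a × Vec b) :
    (join p).ofLp = Sum.elim (fun _ => p.1) (Sum.elim p.2.1.ofLp p.2.2.ofLp) :=
  rfl

theorem bijective_join : Function.Bijective (join : (ℝ × Vec a × Vec b) →L[ℝ] _) := by
  refine ⟨fun p q h => ?_, fun x => ⟨(x (.inl 0), WithLp.toLp 2 fun i => x (.inr (.inl i)),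
    WithLp.toLp 2 fun i => x (.inr (.inr i))), ?_⟩⟩
  · have h' := congrArg WithLp.ofLp h
    refine Prod.ext (congrFun h' (.inl 0)) (Prod.ext ?_ ?_)
    · ext i; exact congrFun h' (.inr (.inl i))
    · ext i; exact congrFun h' (.inr (.inr i))
  · ext (i | i | i)
    · rw [Subsingleton.elim i 0]; rfl
    · rfl
    · rfl

/-- The reflection `(v, w) ↦ (v, -w)`. -/
noncomputable def reflection (a b : ℕ) : (Vec a × Vec b) ≃ₗᵢ[ℝ] (Vec a × Vec b) where
  toLinearEquiv := LinearEquiv.prodCongr (LinearEquiv.refl ℝ _) (LinearEquiv.neg ℝ)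
  norm_map' w := by simp [Prod.norm_def]

theorem reflection_apply (w : Vec a × Vec b) : reflection a b w = (w.1, -w.2) :=
  rfl

/-- The linear form `(v, w) ↦ L v`. -/
noncomputable def rowForm (b : ℕ) (L : Matrix (Fin 1) (Fin a) ℝ) : (Vec a × Vec b) →L[ℝ] ℝ :=
  EuclideanSpace.proj (0 : Fin 1) ∘L mulCLM L ∘L ContinuousLinearMap.fst ℝ _ _

theorem rowForm_apply (L : Matrix (Fin 1) (Fin a) ℝ) (w : Vec a × Vec b) :
    rowForm b L w = mulE L w.1 0 :=
  rfl

/-- The linear map `(v, w) ↦ (H₁ v, H₂ w)`. -/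
noncomputable def diagMap (H₁ : Matrix (Fin a) (Fin a) ℝ) (H₂ : Matrix (Fin b) (Fin b) ℝ) :
    (Vec a × Vec b) →L[ℝ] (Vec a × Vec b) :=
  (mulCLM H₁).prodMap (mulCLM H₂)

theorem diagMap_reflection (H₁ : Matrix (Fin a) (Fin a) ℝ) (H₂ : Matrix (Fin b) (Fin b) ℝ)
    (w : Vec a × Vec b) : diagMap H₁ H₂ (reflection a b w) = reflection a b (diagMap H₁ H₂ w) :=
  Prod.ext rfl (map_neg (mulCLM H₂) w.2)

theorem mulCLM_floquetBlock_join (L : Matrix (Fin 1) (Fin a) ℝ) (H₁ : Matrix (Fin a) (Fin a) ℝ)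
    (H₂ : Matrix (Fin b) (Fin b) ℝ) (p : ℝ × Vec a × Vec b) :
    mulCLM (floquetBlock L H₁ H₂) (join p) = join (rowForm b L p.2, diagMap H₁ H₂ p.2) := by
  refine (WithLp.ofLp_injective 2) ?_
  rw [ofLp_mulCLM, ofLp_join, ofLp_join, floquetBlock, fromBlocks_mulVec, Sum.elim_comp_inl,
    Sum.elim_comp_inr, fromBlocks_mulVec, Sum.elim_comp_inl, Sum.elim_comp_inr,
    fromCols_mulVec]
  simp only [Sum.elim_comp_inl, Sum.elim_comp_inr, zero_mulVec, zero_add, add_zero]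
  congr 1
  funext i
  rw [Subsingleton.elim i 0]
  rfl

theorem mulCLM_blockReflection_join (p : ℝ × Vec a × Vec b) :
    mulCLM (blockReflection a b) (join p) = join (p.1, reflection a b p.2) := by
  refine (WithLp.ofLp_injective 2) ?_
  rw [ofLp_mulCLM, ofLp_join, ofLp_join, blockReflection, fromBlocks_mulVec, Sum.elim_comp_inl,
    Sum.elim_comp_inr, fromBlocks_mulVec, Sum.elim_comp_inl, Sum.elim_comp_inr]
  simp only [zero_mulVec, zero_add, add_zero, one_mulVec, neg_mulVec, reflection_apply]
  rfl

theorem submatrix_mul_blockReflection {m : Type*} (Z : Matrix m (Fin 1 ⊕ (Fin a ⊕ Fin b)) ℝ)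
    {K : Matrix (Fin a ⊕ Fin b) (Fin a ⊕ Fin b) ℝ} (hK : K = fromBlocks 1 0 0 (-1)) :
    (Z * blockReflection a b).submatrix id Sum.inr = Z.submatrix id Sum.inr * K := by
  rw [hK]
  ext i j
  rw [submatrix_apply, Matrix.mul_apply, Matrix.mul_apply, Fintype.sum_sum_type]
  simp [blockReflection]

/-- Commutation holds because `L` does not involve `w` and the equations for `v` and `w` are
decoupled. -/
theorem blockReflection_mul_floquetBlock (L : Matrix (Fin 1) (Fin a) ℝ)
    (H₁ : Matrix (Fin a) (Fin a) ℝ) (H₂ : Matrix (Fin b) (Fin b) ℝ) :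
    blockReflection a b * floquetBlock L H₁ H₂ = floquetBlock L H₁ H₂ * blockReflection a b := by
  refine mulCLM_injective (ContinuousLinearMap.ext fun x => ?_)
  obtain ⟨p, rfl⟩ := bijective_join.2 x
  simp only [mulCLM_mul_apply, mulCLM_floquetBlock_join, mulCLM_blockReflection_join]
  rw [diagMap_reflection, reflection_apply, rowForm_apply, rowForm_apply]
  rfl

/-- The generator kills the first unit vector, so its exponential fixes it; hence the first column
of the frame stays the direction of the flow. -/
theorem mulCLM_exp_floquetBlock_join (L : Matrix (Fin 1) (Fin a) ℝ)
    (H₁ : Matrix (Fin a) (Fin a) ℝ) (H₂ : Matrix (Fin b) (Fin b) ℝ) (t c : ℝ) :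
    mulCLM (NormedSpace.exp (t • floquetBlock L H₁ H₂)) (join (c, (0 : Vec a × Vec b))) =
      join (c, (0 : Vec a × Vec b)) := by
  obtain ⟨R, hR⟩ : ∃ R : Matrix (Fin 1 ⊕ (Fin a ⊕ Fin b)) (Fin 1) ℝ,
      ∀ i j, R i j = (join (c, (0 : Vec a × Vec b))).ofLp i := ⟨of fun i _ => _, fun _ _ => rfl⟩
  have h : R * (0 : Matrix (Fin 1) (Fin 1) ℝ) = (t • floquetBlock L H₁ H₂) * R := by
    have h1 := congrArg WithLp.ofLp (mulCLM_floquetBlock_join L H₁ H₂ (c, (0 : Vec a × Vec b)))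
    rw [map_zero, map_zero, ← Prod.zero_eq_mk, map_zero] at h1
    rw [Matrix.mul_zero, Matrix.smul_mul]
    ext i j
    have h2 : (floquetBlock L H₁ H₂ * R) i j = 0 := by
      rw [Matrix.mul_apply]
      simp only [hR]
      exact congrFun h1 i
    rw [Matrix.smul_apply, h2, smul_zero, Matrix.zero_apply]
  have h3 := mul_exp_of_mul_eq _ _ _ h
  rw [NormedSpace.exp_zero, Matrix.mul_one] at h3
  ext i
  have h4 := congrFun (congrFun h3 i) 0
  rw [hR, Matrix.mul_apply] at h4
  simp only [hR] at h4
  exact h4.symm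

variable {n : ℕ} {f : Vec n → Vec n} {D : Set (Vec n)} {φ : ℝ → Vec n} {T : ℝ}
  {Ψ : ℝ → Matrix (Fin n) (Fin n) ℝ}
  {S : Matrix (Fin n) (Fin 1 ⊕ (Fin a ⊕ Fin b)) ℝ} {S' : Matrix (Fin 1 ⊕ (Fin a ⊕ Fin b)) (Fin n) ℝ}
  {L : Matrix (Fin 1) (Fin a) ℝ} {H₁ : Matrix (Fin a) (Fin a) ℝ} {H₂ : Matrix (Fin b) (Fin b) ℝ}

/-- The moving frame `Ψ(t) S exp(-t B)` of Floquet theory. -/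
noncomputable def frameMatrix (Ψ : ℝ → Matrix (Fin n) (Fin n) ℝ)
    (S : Matrix (Fin n) (Fin 1 ⊕ (Fin a ⊕ Fin b)) ℝ) (L : Matrix (Fin 1) (Fin a) ℝ)
    (H₁ : Matrix (Fin a) (Fin a) ℝ) (H₂ : Matrix (Fin b) (Fin b) ℝ) (t : ℝ) :
    Matrix (Fin n) (Fin 1 ⊕ (Fin a ⊕ Fin b)) ℝ :=
  Ψ t * S * NormedSpace.exp (t • -floquetBlock L H₁ H₂)

theorem frameMatrix_mul_exp (t : ℝ) :
    frameMatrix Ψ S L H₁ H₂ t * NormedSpace.exp (t • floquetBlock L H₁ H₂) = Ψ t * S := by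
  rw [frameMatrix, Matrix.mul_assoc, ← Matrix.exp_add_of_commute, smul_neg, neg_add_cancel,
    NormedSpace.exp_zero, Matrix.mul_one]
  exact (((Commute.refl (floquetBlock L H₁ H₂)).neg_left).smul_left t).smul_right t

/-- The factor `exp(TB)` of the monodromy matrix cancels against `exp(-TB)`, and the reflection that
remains commutes with `exp(-tB)`. -/
theorem frameMatrix_add (hΨT : ∀ t, Ψ (t + T) = Ψ t * Ψ T)
    (hS : Ψ T * S = S * (blockReflection a b * NormedSpace.exp (T • floquetBlock L H₁ H₂))) (t : ℝ) :
    frameMatrix Ψ S L H₁ H₂ (t + T) = frameMatrix Ψ S L H₁ H₂ t * blockReflection a b := by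
  have h1 : NormedSpace.exp ((t + T) • -floquetBlock L H₁ H₂) =
      NormedSpace.exp (T • -floquetBlock L H₁ H₂) *
        NormedSpace.exp (t • -floquetBlock L H₁ H₂) := by
    rw [← Matrix.exp_add_of_commute, ← add_smul, add_comm]
    exact ((Commute.refl (-floquetBlock L H₁ H₂)).smul_left T).smul_right t
  have h2 : NormedSpace.exp (T • floquetBlock L H₁ H₂) *
      NormedSpace.exp (T • -floquetBlock L H₁ H₂) = 1 := by
    rw [← Matrix.exp_add_of_commute, smul_neg, add_neg_cancel, NormedSpace.exp_zero]
    exact (((Commute.refl (floquetBlock L H₁ H₂)).neg_right).smul_left T).smul_right T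
  have h3 : blockReflection a b * NormedSpace.exp (t • -floquetBlock L H₁ H₂) =
      NormedSpace.exp (t • -floquetBlock L H₁ H₂) * blockReflection a b := by
    refine mul_exp_of_mul_eq _ _ _ ?_
    rw [Matrix.mul_smul, Matrix.mul_neg, blockReflection_mul_floquetBlock, Matrix.smul_mul,
      Matrix.neg_mul]
  rw [frameMatrix, frameMatrix, hΨT, Matrix.mul_assoc (Ψ t), hS, h1]
  simp only [Matrix.mul_assoc]
  rw [← Matrix.mul_assoc (NormedSpace.exp (T • floquetBlock L H₁ H₂)), h2, Matrix.one_mul, h3]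

/-- The moving frame along the orbit, without the direction of the flow, as a linear map. -/
noncomputable def frameMap (Z : ℝ → Matrix (Fin n) (Fin 1 ⊕ (Fin a ⊕ Fin b)) ℝ) (t : ℝ) :
    (Vec a × Vec b) →L[ℝ] Vec n :=
  mulCLM (Z t) ∘L join ∘L ContinuousLinearMap.inr ℝ ℝ (Vec a × Vec b)

theorem frameMap_apply (Z : ℝ → Matrix (Fin n) (Fin 1 ⊕ (Fin a ⊕ Fin b)) ℝ) (t : ℝ)
    (w : Vec a × Vec b) : frameMap Z t w = mulCLM (Z t) (join (0, w)) :=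
  rfl

theorem tubeMap_eq_tube (Z : ℝ → Matrix (Fin n) (Fin 1 ⊕ (Fin a ⊕ Fin b)) ℝ) :
    tubeMap φ (fun t => (Z t).submatrix id Sum.inr) = tube φ (frameMap Z) := by
  funext p
  rw [tubeMap, tube, frameMap_apply]
  congr 1
  ext i
  simp [mulE, ofLp_mulCLM, ofLp_join, mulVec, dotProduct, Fintype.sum_sum_type]

/-- From `Z' = Df(φ) Z - Z B`: the first column of `Z` is `f(φ)`, so the first row of `B` produces
the term `f(φ) ℓ` and the other rows produce `U H`. -/
theorem isFloquetFrame_frameMatrix {r : ℕ∞} (hr : 1 ≤ r) (hD : IsOpen D) (hf : ContDiffOn ℝ r f D)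
    (hφD : ∀ t, φ t ∈ D) (hφ : ∀ t, HasDerivAt φ (f (φ t)) t) (hper : ∀ t, φ (t + T) = φ t)
    (hΨ : ∀ t, HasDerivAt (fun t => mulCLM (Ψ t)) (fderiv ℝ f (φ t) ∘L mulCLM (Ψ t)) t)
    (hΨu : ∀ t, IsUnit (Ψ t)) (hΨf : ∀ t, f (φ t) = mulCLM (Ψ t) (f (φ 0)))
    (hΨT : ∀ t, Ψ (t + T) = Ψ t * Ψ T) (hSS : S * S' = 1) (hSS' : S' * S = 1)
    (hS0 : ∀ i, S i (.inl 0) = f (φ 0) i)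
    (hS : Ψ T * S = S * (blockReflection a b * NormedSpace.exp (T • floquetBlock L H₁ H₂))) :
    IsFloquetFrame r f D T φ (frameMap (frameMatrix Ψ S L H₁ H₂)) (reflection a b) (rowForm b L)
      (diagMap H₁ H₂) := by
  set Z := frameMatrix Ψ S L H₁ H₂ with hZ
  have hflow : ∀ t, mulCLM (Z t) (join (1, (0 : Vec a × Vec b))) = f (φ t) := by
    intro t
    rw [hΨf, ← mulCLM_exp_floquetBlock_join L H₁ H₂ t, ← mulCLM_mul_apply, frameMatrix_mul_exp,
      mulCLM_mul_apply]
    congr 1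
    ext i
    simp [ofLp_mulCLM, ofLp_join, mulVec, dotProduct, Fintype.sum_sum_type, hS0]
  have hjoin : ∀ (c : ℝ) (w : Vec a × Vec b),
      join (c, w) = c • join (1, (0 : Vec a × Vec b)) + join (0, w) := by
    intro c w
    rw [← map_smul, ← map_add]
    simp
  have hsplit : ∀ t (p : ℝ × Vec a × Vec b),
      mulCLM (Z t) (join p) = p.1 • f (φ t) + frameMap Z t p.2 := by
    intro t p
    rw [frameMap_apply, ← hflow, ← map_smul, ← map_add, ← hjoin]
  have hZc : (fun t => mulCLM (Z t)) = fun t => mulCLM (Ψ t) ∘L mulCLM S ∘L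
      mulCLM (NormedSpace.exp (t • -floquetBlock L H₁ H₂)) := by
    funext t
    rw [hZ, frameMatrix, mulCLM_mul, mulCLM_mul]
    rfl
  have hZd : ∀ t, HasDerivAt (fun t => mulCLM (Z t)) (fderiv ℝ f (φ t) ∘L mulCLM (Z t) -
      mulCLM (Z t) ∘L mulCLM (floquetBlock L H₁ H₂)) t := by
    intro t
    have h := (hΨ t).clm_comp ((hasDerivAt_const t (mulCLM S)).clm_comp
      (hasDerivAt_mulCLM_exp (-floquetBlock L H₁ H₂) t))
    rw [← hZc] at h
    refine h.congr_deriv ?_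
    rw [congrFun hZc t]
    refine ContinuousLinearMap.ext fun x => ?_
    simp [sub_eq_add_neg]
  have hZs : ContDiff ℝ r fun t => mulCLM (Z t) := by
    rw [hZc]
    refine (contDiff_variational hD hf hφD hφ hΨ).clm_comp (contDiff_const.clm_comp ?_)
    exact contDiff_of_hasDerivAt (hasDerivAt_mulCLM_exp _) fun k _ hk => hk.clm_comp contDiff_const
  refine ⟨contDiff_orbit hf hφD hφ, hZs.clm_comp contDiff_const, hφD, hφ, fun s =>
    ⟨fderiv ℝ f (φ s), ?_, ?_⟩, fun s => ?_, hper, fun s w => ?_, fun w => ?_, fun w => ?_,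
    fun w => ?_⟩
  · refine ((hf.differentiableOn ?_).differentiableAt (hD.mem_nhds (hφD s))).hasFDerivAt
    intro h
    rw [WithTop.coe_eq_zero] at h
    simp [h] at hr
  · refine ((hZd s).clm_comp (hasDerivAt_const s _)).congr_deriv ?_
    refine ContinuousLinearMap.ext fun w => ?_
    have h := hsplit s (rowForm b L w, diagMap H₁ H₂ w)
    have h2 : mulCLM (floquetBlock L H₁ H₂) (join (0, w)) =
        join (rowForm b L w, diagMap H₁ H₂ w) := mulCLM_floquetBlock_join L H₁ H₂ (0, w)
    simp [h2, h, frameMap_apply, sub_sub]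
  · have hb : Function.Bijective (mulCLM (Z s)) := by
      refine Function.bijective_iff_has_inverse.2 ⟨mulCLM (NormedSpace.exp
        (s • floquetBlock L H₁ H₂) * (S' * (Ψ s)⁻¹)), fun x => ?_, fun x => ?_⟩
      · have hc : NormedSpace.exp (s • floquetBlock L H₁ H₂) *
            NormedSpace.exp (s • -floquetBlock L H₁ H₂) = 1 := by
          rw [← Matrix.exp_add_of_commute, smul_neg, add_neg_cancel, NormedSpace.exp_zero]
          exact (((Commute.refl (floquetBlock L H₁ H₂)).neg_right).smul_left s).smul_right s
        rw [← mulCLM_mul_apply, hZ, frameMatrix]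
        simp only [Matrix.mul_assoc]
        rw [← Matrix.mul_assoc (Ψ s)⁻¹, nonsing_inv_mul _ ((isUnit_iff_isUnit_det _).1 (hΨu s)),
          Matrix.one_mul, ← Matrix.mul_assoc S', hSS', Matrix.one_mul, hc, mulCLM_one_apply]
      · rw [← mulCLM_mul_apply, ← Matrix.mul_assoc, frameMatrix_mul_exp, Matrix.mul_assoc,
          ← Matrix.mul_assoc S, hSS, Matrix.one_mul,
          mul_nonsing_inv _ ((isUnit_iff_isUnit_det _).1 (hΨu s)), mulCLM_one_apply]
    have := hb.comp bijective_join
    simpa only [Function.comp_def, hsplit] using this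
  · rw [frameMap_apply, hZ, frameMatrix_add hΨT hS, mulCLM_mul_apply, mulCLM_blockReflection_join,
      frameMap_apply]
  · simp [reflection_apply]
  · simp [reflection_apply, rowForm_apply]
  · exact diagMap_reflection H₁ H₂ w

end

end FloquetForm

/-! ### Monodromy matrices and their characteristic polynomials. -/

namespace FloquetForm

open Set Filter Topology Matrix

theorem antiperiodicityIndex_conj {n : ℕ} {X Y P P' : Matrix (Fin n) (Fin n) ℝ} (h1 : P * P' = 1)
    (h2 : P' * P = 1) (h : X * P = P * Y) : antiperiodicityIndex X = antiperiodicityIndex Y := by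
  have hY : Y = P' * X * P := by rw [Matrix.mul_assoc, h, ← Matrix.mul_assoc, h2, Matrix.one_mul]
  have hc : Y.charpoly = X.charpoly := by rw [hY, charpoly_conj P P' h1 h2]
  have hJ : numJordanBlocks X = numJordanBlocks Y := by
    funext μ k
    have hr : ∀ q, ((X - scalar (Fin n) μ) ^ q).rank = ((Y - scalar (Fin n) μ) ^ q).rank :=
      fun q => rank_conj h1 h2 (pow_mul_of_mul_eq (sub_scalar_mul_of_mul_eq h μ) q)
    simp only [numJordanBlocks, hr]
  rw [antiperiodicityIndex, antiperiodicityIndex, hc, hJ]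

theorem isUnit_mulCLM {p : Type*} [Fintype p] [DecidableEq p] {M : Matrix p p ℝ} (h : IsUnit M) :
    IsUnit (mulCLM M) := by
  have hdet := (isUnit_iff_isUnit_det _).1 h
  refine ⟨⟨mulCLM M, mulCLM M⁻¹, ?_, ?_⟩, rfl⟩
  · refine ContinuousLinearMap.ext fun x => ?_
    change mulCLM M (mulCLM M⁻¹ x) = x
    rw [← mulCLM_mul_apply, mul_nonsing_inv _ hdet, mulCLM_one_apply]
  · refine ContinuousLinearMap.ext fun x => ?_
    change mulCLM M⁻¹ (mulCLM M x) = x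
    rw [← mulCLM_mul_apply, nonsing_inv_mul _ hdet, mulCLM_one_apply]

theorem IsFundamentalMatrix.hasDerivAt_mulCLM {n : ℕ} {A Ψ : ℝ → Matrix (Fin n) (Fin n) ℝ}
    (hΨ : IsFundamentalMatrix A Ψ) (t : ℝ) :
    HasDerivAt (fun t => mulCLM (Ψ t)) (mulCLM (A t) ∘L mulCLM (Ψ t)) t :=
  (FloquetForm.hasDerivAt_mulCLM (hΨ.1 t)).congr_deriv (mulCLM_mul _ _)

theorem IsFundamentalMatrix.eq_mulCLM_apply {n : ℕ} {A Ψ : ℝ → Matrix (Fin n) (Fin n) ℝ}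
    (hΨ : IsFundamentalMatrix A Ψ) (hΨ0 : Ψ 0 = 1) {y : ℝ → Vec n}
    (hy : ∀ t, HasDerivAt y (mulCLM (A t) (y t)) t) (t : ℝ) : y t = mulCLM (Ψ t) (y 0) :=
  eq_apply_of_hasDerivAt (Y := fun t => mulCLM (Ψ t)) hΨ.hasDerivAt_mulCLM
    (fun t => isUnit_mulCLM (hΨ.2 t)) (fun x => by rw [hΨ0, mulCLM_one_apply]) hy t

theorem IsFundamentalMatrix.eq_mul {n : ℕ} {A Ψ Φ : ℝ → Matrix (Fin n) (Fin n) ℝ}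
    (hΨ : IsFundamentalMatrix A Ψ) (hΨ0 : Ψ 0 = 1) (hΦ : IsFundamentalMatrix A Φ) (t : ℝ) :
    Φ t = Ψ t * Φ 0 := by
  refine mulCLM_injective (ContinuousLinearMap.ext fun x => ?_)
  rw [mulCLM_mul_apply]
  refine hΨ.eq_mulCLM_apply hΨ0 (y := fun t => mulCLM (Φ t) x) (fun t => ?_) t
  exact ((hΦ.hasDerivAt_mulCLM t).clm_apply (hasDerivAt_const t x)).congr_deriv (by simp)

theorem IsFundamentalMatrix.comp_add_const {n : ℕ} {A Ψ : ℝ → Matrix (Fin n) (Fin n) ℝ} {T : ℝ}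
    (hΨ : IsFundamentalMatrix A Ψ) (hA : ∀ t, A (t + T) = A t) :
    IsFundamentalMatrix A fun t => Ψ (t + T) :=
  ⟨fun t i j => by
    have h := (hΨ.1 (t + T) i j).comp_add_const t T
    rwa [hA] at h, fun t => hΨ.2 _⟩

section

variable {n a b : ℕ} {M : Matrix (Fin n) (Fin n) ℝ} {T : ℝ}
  {S : Matrix (Fin n) (Fin 1 ⊕ (Fin a ⊕ Fin b)) ℝ} {S' : Matrix (Fin 1 ⊕ (Fin a ⊕ Fin b)) (Fin n) ℝ}
  {L : Matrix (Fin 1) (Fin a) ℝ} {H₁ : Matrix (Fin a) (Fin a) ℝ} {H₂ : Matrix (Fin b) (Fin b) ℝ}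

theorem smul_floquetBlock (c : ℝ) (L : Matrix (Fin 1) (Fin a) ℝ) (H₁ : Matrix (Fin a) (Fin a) ℝ)
    (H₂ : Matrix (Fin b) (Fin b) ℝ) :
    c • floquetBlock L H₁ H₂ = floquetBlock (c • L) (c • H₁) (c • H₂) := by
  ext (i | i | i) (j | j | j) <;> simp [floquetBlock]

/-- The scalars `1` and `-1` are written out to match `log_norm_aroots_charpoly_smul_exp`. -/
theorem charpoly_of_normal_form (hSS : S * S' = 1) (hSS' : S' * S = 1)
    (hS : M * S = S * (blockReflection a b * NormedSpace.exp (T • floquetBlock L H₁ H₂))) :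
    M.charpoly = (Polynomial.X - 1) * (((1 : ℝ) • NormedSpace.exp (T • H₁)).charpoly *
      ((-1 : ℝ) • NormedSpace.exp (T • H₂)).charpoly) := by
  have h1 : S' * M * S = blockReflection a b * NormedSpace.exp (T • floquetBlock L H₁ H₂) := by
    rw [Matrix.mul_assoc, hS, ← Matrix.mul_assoc, hSS', Matrix.one_mul]
  have h2 : ∃ Y, blockReflection a b * NormedSpace.exp (T • floquetBlock L H₁ H₂) =
      fromBlocks 1 Y 0 (fromBlocks ((1 : ℝ) • NormedSpace.exp (T • H₁)) 0 0
        ((-1 : ℝ) • NormedSpace.exp (T • H₂))) := by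
    rw [smul_floquetBlock, floquetBlock]
    obtain ⟨Y, hY⟩ := exists_exp_fromBlocks (0 : Matrix (Fin 1) (Fin 1) ℝ)
      (fromCols (T • L) (0 : Matrix (Fin 1) (Fin b) ℝ)) (fromBlocks (T • H₁) 0 0 (T • H₂))
    refine ⟨Y, ?_⟩
    rw [hY, exp_fromBlocks_diagonal, blockReflection, fromBlocks_multiply, fromBlocks_multiply]
    simp [NormedSpace.exp_zero]
  obtain ⟨Y, hY⟩ := h2
  rw [← charpoly_conj S S' hSS hSS' M, h1, hY, charpoly_fromBlocks_zero₂₁,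
    charpoly_fromBlocks_zero₂₁, charpoly_one]
  simp

theorem re_aroots_of_normal_form (hT : T ≠ 0) (hSS : S * S' = 1) (hSS' : S' * S = 1)
    (hS : M * S = S * (blockReflection a b * NormedSpace.exp (T • floquetBlock L H₁ H₂)))
    {p : Polynomial ℝ} (hp : (Polynomial.X - 1) * p = M.charpoly) :
    ((fromBlocks H₁ 0 0 H₂).charpoly.aroots ℂ).map Complex.re =
      (p.aroots ℂ).map fun l => 1 / T * Real.log ‖l‖ := by
  have hX : (Polynomial.X - 1 : Polynomial ℝ) ≠ 0 := by
    simpa using Polynomial.X_sub_C_ne_zero (1 : ℝ)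
  have h0 : ∀ {k : ℕ} (X : Matrix (Fin k) (Fin k) ℝ), X.charpoly ≠ 0 :=
    fun X => X.charpoly_monic.ne_zero
  rw [charpoly_of_normal_form hSS hSS' hS] at hp
  rw [mul_left_cancel₀ hX hp, charpoly_fromBlocks_zero₂₁,
    Polynomial.aroots_mul (mul_ne_zero (h0 _) (h0 _)),
    Polynomial.aroots_mul (mul_ne_zero (h0 _) (h0 _)), Multiset.map_add, Multiset.map_add,
    log_norm_aroots_charpoly_smul_exp 1 T (by simp) hT,
    log_norm_aroots_charpoly_smul_exp (-1) T (by simp) hT]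

end

/-- The Poincaré maps at the different points of the orbit. -/
theorem differentiableAt_poincareMap_of_fundamental {n : ℕ} {f : Vec n → Vec n} {D : Set (Vec n)}
    {φ : ℝ → Vec n} {T : ℝ} {Ψ : ℝ → Matrix (Fin n) (Fin n) ℝ} (hD : IsOpen D)
    (hf : ContDiffOn ℝ 1 f D) (hφD : ∀ t, φ t ∈ D) (hφ : ∀ t, HasDerivAt φ (f (φ t)) t)
    (hper : ∀ t, φ (t + T) = φ t) (hΨ : IsFundamentalMatrix (fun t => jacobian f (φ t)) Ψ)
    (hΨT : ∀ t, Ψ (t + T) = Ψ t * Ψ T)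
    (hΨf : ∀ t, f (φ t) = mulCLM (Ψ t) (f (φ 0))) (t₀ : ℝ) (hv : f (φ t₀) ≠ 0)
    {E : Submodule ℝ (Vec n)} {P : E → E} (hE : IsCompl E (Submodule.span ℝ {f (φ t₀)}))
    (hP : IsPoincareMap f D (φ t₀) T E P) :
    DifferentiableAt ℝ P 0 ∧
      (Polynomial.X - 1) * (fderiv ℝ P 0 : E →ₗ[ℝ] E).charpoly = (Ψ T).charpoly := by
  have hdet := fun t => (isUnit_iff_isUnit_det _).1 (hΨ.2 t)
  have hd : ∀ t, HasDerivAt (fun t => mulCLM (Ψ t)) (fderiv ℝ f (φ t) ∘L mulCLM (Ψ t)) t :=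
    fun t => (hΨ.hasDerivAt_mulCLM t).congr_deriv (by rw [mulCLM_jacobian])
  -- Starting at time `t₀` replaces the monodromy by `Ψ(t₀) Ψ(T) Ψ(t₀)⁻¹`, which has the same
  -- characteristic polynomial.
  have h := differentiableAt_poincareMap (φ := fun t => φ (t + t₀))
    (Y := fun t => mulCLM (Ψ (t + t₀)) ∘L mulCLM (Ψ t₀)⁻¹) hD hf (fun t => hφD _)
    (fun t => (hφ (t + t₀)).comp_add_const t t₀) (fun x => ?_) (fun t => ?_) (T := T) ?_ ?_ ?_
    (E := E) (P := P) ?_ ?_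
  · refine ⟨h.1, h.2.trans ?_⟩
    rw [← mulCLM_mul, charpoly_mulCLM, add_comm, hΨT]
    have := charpoly_conj (Ψ t₀)⁻¹ (Ψ t₀) (nonsing_inv_mul _ (hdet t₀)) (mul_nonsing_inv _ (hdet t₀))
      (Ψ T)
    exact this
  · rw [← mulCLM_mul, zero_add, mul_nonsing_inv _ (hdet t₀), mulCLM_one_apply]
  · exact (((hd (t + t₀)).comp_add_const t t₀).clm_comp (hasDerivAt_const t _)).congr_deriv
      (by simp [ContinuousLinearMap.comp_assoc])
  · simp only [zero_add]
    rw [add_comm, hper]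
  · simpa using hv
  · simp only [zero_add]
    have h1 : mulCLM (Ψ t₀)⁻¹ (f (φ t₀)) = f (φ 0) := by
      rw [hΨf, ← mulCLM_mul_apply, nonsing_inv_mul _ (hdet t₀), mulCLM_one_apply]
    rw [ContinuousLinearMap.comp_apply, h1, ← hΨf, add_comm, hper]
  · simpa using hE
  · simpa using hP

end FloquetForm

/-! ### Proof of the theorem. -/

/-- The coordinates are `s : ℝ`, `v ∈ ℝ^(n-d-1)`, `w ∈ ℝ^d`, in the tube of all `(s, v, w)` with
`‖(v, w)‖ < ε`; the functions `Λt₀`, `Λt₁`, `Λt₂` are the remainders that depend on time. -/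
theorem theoremC (n : ℕ) (r : ℕ∞) (hr : 2 ≤ r)
    (D : Set (FloquetForm.Vec n)) (hD : IsOpen D) (I : Set ℝ)
    (f : FloquetForm.Vec n → FloquetForm.Vec n) (hf : ContDiffOn ℝ r f D)
    (g : ℝ → FloquetForm.Vec n → FloquetForm.Vec n)
    (hg : ContDiffOn ℝ r (fun p : ℝ × FloquetForm.Vec n => g p.1 p.2) (I ×ˢ D))
    (T : ℝ) (hT : 0 < T) (φ : ℝ → FloquetForm.Vec n)
    (hφ : FloquetForm.IsSolutionOn f D φ Set.univ) (hper : Function.Periodic φ T)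
    (hnontriv : ∃ t, φ t ≠ φ 0)
    (Ψ : ℝ → Matrix (Fin n) (Fin n) ℝ)
    (hΨ : FloquetForm.IsFundamentalMatrix (fun t => FloquetForm.jacobian f (φ t)) Ψ)
    (hΨ0 : Ψ 0 = 1)
    (d : ℕ) (hd : FloquetForm.IsAIndex (fun t => FloquetForm.jacobian f (φ t)) T d) :
    ∃ q₀ : ℕ,
      IsGreatest {q : ℕ | ∃ x : FloquetForm.Vec n,
        FloquetForm.mulE ((Ψ T - 1) ^ q) x = deriv φ 0} q₀ ∧
      q₀ + d + 1 ≤ n ∧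
      ∃ U : ℝ → Matrix (Fin n) (Fin (n - d - 1) ⊕ Fin d) ℝ,
        (∀ i j, ContDiff ℝ r fun t => U t i j) ∧
        (∀ t, U (t + T) = U t * Matrix.fromBlocks 1 0 0 (-1)) ∧
        ∃ (ε : ℝ) (L : Matrix (Fin 1) (Fin (n - d - 1)) ℝ)
          (H₁ : Matrix (Fin (n - d - 1)) (Fin (n - d - 1)) ℝ) (H₂ : Matrix (Fin d) (Fin d) ℝ)
          (Λ₀ : ℝ → FloquetForm.Vec (n - d - 1) → FloquetForm.Vec d → ℝ)
          (Λ₁ : ℝ → FloquetForm.Vec (n - d - 1) → FloquetForm.Vec d →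
            FloquetForm.Vec (n - d - 1))
          (Λ₂ : ℝ → FloquetForm.Vec (n - d - 1) → FloquetForm.Vec d →
            FloquetForm.Vec d)
          (Λt₀ : ℝ → ℝ → FloquetForm.Vec (n - d - 1) → FloquetForm.Vec d → ℝ)
          (Λt₁ : ℝ → ℝ → FloquetForm.Vec (n - d - 1) → FloquetForm.Vec d →
            FloquetForm.Vec (n - d - 1))
          (Λt₂ : ℝ → ℝ → FloquetForm.Vec (n - d - 1) → FloquetForm.Vec d →
            FloquetForm.Vec d),
          0 < ε ∧
          -- the change of variables transforms the perturbed system into the normal form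
          FloquetForm.TransformsSystem r (FloquetForm.tubeMap φ U) {p | ‖p.2‖ < ε} D I
            (fun t z => f z + g t z)
            (fun t p =>
              (1 + FloquetForm.mulE L p.2.1 0 + Λ₀ p.1 p.2.1 p.2.2 + Λt₀ t p.1 p.2.1 p.2.2,
                FloquetForm.mulE H₁ p.2.1 + Λ₁ p.1 p.2.1 p.2.2 + Λt₁ t p.1 p.2.1 p.2.2,
                FloquetForm.mulE H₂ p.2.2 + Λ₂ p.1 p.2.1 p.2.2 + Λt₂ t p.1 p.2.1 p.2.2)) ∧
          -- (i) eigenvalues, with multiplicities, for every Poincaré map on a transversal section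
          (∀ (t₀ : ℝ) (E : Submodule ℝ (FloquetForm.Vec n)) (P : E → E),
            IsCompl E (Submodule.span ℝ {deriv φ t₀}) →
            FloquetForm.IsPoincareMap f D (φ t₀) T E P →
            DifferentiableAt ℝ P 0 ∧
            ((Matrix.fromBlocks H₁ 0 0 H₂).charpoly.aroots ℂ).map Complex.re =
              ((fderiv ℝ P 0 : E →ₗ[ℝ] E).charpoly.aroots ℂ).map
                fun l => 1 / T * Real.log ‖l‖) ∧
          -- (ii) the autonomous remainders vanish to first order along the orbit
          (∀ s, Λ₀ s 0 0 = 0 ∧ Λ₁ s 0 0 = 0 ∧ Λ₂ s 0 0 = 0 ∧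
            HasFDerivAt (Function.uncurry (Λ₀ s))
              (0 : FloquetForm.Vec (n - d - 1) × FloquetForm.Vec d →L[ℝ] ℝ) 0 ∧
            HasFDerivAt (Function.uncurry (Λ₁ s))
              (0 : FloquetForm.Vec (n - d - 1) × FloquetForm.Vec d →L[ℝ] FloquetForm.Vec (n - d - 1)) 0 ∧
            HasFDerivAt (Function.uncurry (Λ₂ s))
              (0 : FloquetForm.Vec (n - d - 1) × FloquetForm.Vec d →L[ℝ] FloquetForm.Vec d) 0) ∧
          -- (iii), (iv) symmetries
          (∀ s v w, ‖(v, w)‖ < ε →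
            Λ₀ (s + T) v w = Λ₀ s v (-w) ∧ Λ₁ (s + T) v w = Λ₁ s v (-w) ∧
            Λ₂ (s + T) v w = -Λ₂ s v (-w)) ∧
          (∀ t ∈ I, ∀ s v w, ‖(v, w)‖ < ε →
            Λt₀ t (s + T) v w = Λt₀ t s v (-w) ∧ Λt₁ t (s + T) v w = Λt₁ t s v (-w) ∧
            Λt₂ t (s + T) v w = -Λt₂ t s v (-w)) ∧
          -- (v) the time-dependent remainders are bounded by the perturbation
          (∃ C > 0, ∀ t ∈ I, ∀ s v w, ‖(v, w)‖ < ε →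
            ‖Λt₀ t s v w‖ ≤ C * ‖g t (FloquetForm.tubeMap φ U (s, v, w))‖ ∧
            ‖Λt₁ t s v w‖ ≤ C * ‖g t (FloquetForm.tubeMap φ U (s, v, w))‖ ∧
            ‖Λt₂ t s v w‖ ≤ C * ‖g t (FloquetForm.tubeMap φ U (s, v, w))‖) ∧
          -- (vi) only the first `q₀` entries of `L` can be nonzero
          (∀ j : Fin (n - d - 1), q₀ ≤ j → L 0 j = 0) := by
  have hr1 : 1 ≤ r := le_trans one_le_two hr
  have hf1 : ContDiffOn ℝ 1 f D := hf.of_le (by exact_mod_cast hr1)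
  have hφD : ∀ t, φ t ∈ D := fun t => (hφ t (Set.mem_univ t)).1
  have hφd : ∀ t, HasDerivAt φ (f (φ t)) t := fun t =>
    hasDerivWithinAt_univ.1 (hφ t (Set.mem_univ t)).2
  have hderiv : ∀ t, deriv φ t = f (φ t) := fun t => (hφd t).deriv
  have hfd : ∀ t, HasFDerivAt f (fderiv ℝ f (φ t)) (φ t) := fun t =>
    ((hf1.differentiableOn one_ne_zero).differentiableAt (hD.mem_nhds (hφD t))).hasFDerivAt
  -- Differentiating `φ' = f(φ)` shows that `f(φ)` solves the variational equation.
  have hΨf : ∀ t, f (φ t) = FloquetForm.mulCLM (Ψ t) (f (φ 0)) := fun t =>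
    hΨ.eq_mulCLM_apply hΨ0 (y := fun t => f (φ t)) (fun t => by
      rw [FloquetForm.mulCLM_jacobian]
      exact (hfd t).comp_hasDerivAt t (hφd t)) t
  have hΨT : ∀ t, Ψ (t + T) = Ψ t * Ψ T := fun t => by
    have h := hΨ.eq_mul hΨ0 (hΨ.comp_add_const (T := T) fun t => by rw [hper]) t
    rwa [zero_add] at h
  have hdet : ∀ t, IsUnit (Ψ t).det := fun t => (Matrix.isUnit_iff_isUnit_det _).1 (hΨ.2 t)
  -- If `f` vanished at `φ 0`, it would vanish along the orbit, and `φ` would be constant.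
  have hv0 : f (φ 0) ≠ 0 := by
    intro h0
    obtain ⟨t, ht⟩ := hnontriv
    refine ht (is_const_of_deriv_eq_zero (fun t => (hφd t).differentiableAt) (fun t => ?_) t 0)
    rw [hderiv, hΨf, h0, map_zero]
  have hv : ∀ t, f (φ t) ≠ 0 := by
    intro t ht
    apply hv0
    rw [← FloquetForm.mulCLM_one_apply (f (φ 0)), ← Matrix.nonsing_inv_mul _ (hdet t),
      FloquetForm.mulCLM_mul_apply, ← hΨf, ht, map_zero]
  obtain ⟨Φ, hΦ, hΦd⟩ := hd
  -- From `Φ(T) = Ψ(T) Φ(0)`, the two monodromy matrices are conjugate by `Φ(0)`.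
  have hindex : FloquetForm.antiperiodicityIndex (Ψ T) = d := by
    have hΦ0 := (Matrix.isUnit_iff_isUnit_det _).1 (hΦ.2 0)
    rw [← hΦd]
    refine FloquetForm.antiperiodicityIndex_conj (Matrix.mul_nonsing_inv _ hΦ0)
      (Matrix.nonsing_inv_mul _ hΦ0) ?_
    rw [← Matrix.mul_assoc, Matrix.mul_nonsing_inv _ hΦ0, Matrix.one_mul, hΨ.eq_mul hΨ0 hΦ T]
  have hfix : (Ψ T).mulVec (f (φ 0)).ofLp = (f (φ 0)).ofLp := by
    have h := hΨf T
    have h1 := hper 0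
    rw [zero_add] at h1
    rw [h1] at h
    exact (congrArg WithLp.ofLp h).symm
  obtain ⟨q₀, hq₀, hq, S, S', L, H₁, H₂, hSS, hSS', hS0, hS, hL⟩ :=
    FloquetForm.exists_normal_form (Ψ T) (hdet T).ne_zero (f (φ 0)).ofLp
      (fun h => hv0 (WithLp.ofLp_injective 2 h)) hfix hindex
  -- The normal form yields a logarithm for the whole period; the generator of the frame is its
  -- multiple by `T⁻¹`, with the same zero entries in `L`.
  have hscale : FloquetForm.floquetBlock L H₁ H₂ =
      T • FloquetForm.floquetBlock (T⁻¹ • L) (T⁻¹ • H₁) (T⁻¹ • H₂) := by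
    rw [FloquetForm.smul_floquetBlock, smul_inv_smul₀ hT.ne', smul_inv_smul₀ hT.ne',
      smul_inv_smul₀ hT.ne']
  rw [hscale] at hS
  have hF := FloquetForm.isFloquetFrame_frameMatrix hr1 hD hf hφD hφd hper
    (fun t => (hΨ.hasDerivAt_mulCLM t).congr_deriv (by rw [FloquetForm.mulCLM_jacobian]))
    hΨ.2 hΨf hΨT hSS hSS' hS0 hS
  obtain ⟨δ, hδ, C, hC, htube⟩ := hF.exists_tube hT hr1 hD
  set Z := FloquetForm.frameMatrix Ψ S (T⁻¹ • L) (T⁻¹ • H₁) (T⁻¹ • H₂) with hZ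
  set X := FloquetForm.tube φ (FloquetForm.frameMap Z) with hX
  have hXeq : FloquetForm.tubeMap φ (fun t => (Z t).submatrix id Sum.inr) = X :=
    FloquetForm.tubeMap_eq_tube Z
  refine ⟨q₀, ?_, hq, fun t => (Z t).submatrix id Sum.inr, fun i j => ?_, fun t => ?_, δ, T⁻¹ • L,
    T⁻¹ • H₁, T⁻¹ • H₂,
    fun s v w => (FloquetForm.IsFloquetFrame.remainder f φ (FloquetForm.frameMap Z)
      (FloquetForm.rowForm d (T⁻¹ • L)) (FloquetForm.diagMap (T⁻¹ • H₁) (T⁻¹ • H₂)) s (v, w)).1,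
    fun s v w => (FloquetForm.IsFloquetFrame.remainder f φ (FloquetForm.frameMap Z)
      (FloquetForm.rowForm d (T⁻¹ • L)) (FloquetForm.diagMap (T⁻¹ • H₁) (T⁻¹ • H₂)) s (v, w)).2.1,
    fun s v w => (FloquetForm.IsFloquetFrame.remainder f φ (FloquetForm.frameMap Z)
      (FloquetForm.rowForm d (T⁻¹ • L)) (FloquetForm.diagMap (T⁻¹ • H₁) (T⁻¹ • H₂)) s (v, w)).2.2,
    fun t s v w => (FloquetForm.IsFloquetFrame.pull φ (FloquetForm.frameMap Z) (s, v, w)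
      (g t (X (s, v, w)))).1,
    fun t s v w => (FloquetForm.IsFloquetFrame.pull φ (FloquetForm.frameMap Z) (s, v, w)
      (g t (X (s, v, w)))).2.1,
    fun t s v w => (FloquetForm.IsFloquetFrame.pull φ (FloquetForm.frameMap Z) (s, v, w)
      (g t (X (s, v, w)))).2.2, hδ, ?_, fun t₀ E P hE hP => ?_, fun s => ?_, fun s v w _ => ?_,
    fun t _ s v w _ => ?_, ⟨C, hC, fun t _ s v w hvw => ?_⟩, fun j hj => ?_⟩
  · have hset : {q : ℕ | ∃ x : FloquetForm.Vec n,
        FloquetForm.mulE ((Ψ T - 1) ^ q) x = deriv φ 0} =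
        {q | ∃ x : Fin n → ℝ, ((Ψ T - 1) ^ q).mulVec x = (f (φ 0)).ofLp} := by
      ext q
      refine ⟨fun ⟨x, hx⟩ => ⟨x.ofLp, ?_⟩, fun ⟨x, hx⟩ => ⟨WithLp.toLp 2 x, ?_⟩⟩
      · rw [hderiv] at hx
        exact congrArg WithLp.ofLp hx
      · rw [hderiv]
        exact WithLp.ofLp_injective 2 hx
    rw [hset]
    exact hq₀
  -- Each entry of `U` is a coordinate of the frame applied to a unit vector.
  · have h := (hF.contDiff_frame.clm_apply (contDiff_const (c := (Sum.elim
      (fun i => (EuclideanSpace.single i 1, 0)) (fun i => (0, EuclideanSpace.single i 1)) j :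
        FloquetForm.Vec (n - d - 1) × FloquetForm.Vec d))))
    have h1 := (EuclideanSpace.proj (𝕜 := ℝ) i).contDiff.comp h
    refine (congrArg (ContDiff ℝ r) (funext fun t => ?_)).mpr h1
    have h2 : FloquetForm.join (0, (Sum.elim
      (fun i => (EuclideanSpace.single i 1, 0)) (fun i => (0, EuclideanSpace.single i 1)) j :
        FloquetForm.Vec (n - d - 1) × FloquetForm.Vec d)) =
        EuclideanSpace.single (Sum.inr j) 1 := by
      ext k
      rw [FloquetForm.ofLp_join]
      rcases j with j | j <;> rcases k with k | k | k <;> simp [Pi.single_apply]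
    rw [Function.comp_apply, FloquetForm.frameMap_apply, h2]
    exact (FloquetForm.mulCLM_single (Z t) i (Sum.inr j)).symm
  · have h := FloquetForm.frameMatrix_add hΨT hS t
    change (Z (t + T)).submatrix id Sum.inr = _
    rw [hZ, h]
    exact FloquetForm.submatrix_mul_blockReflection _ rfl
  · rw [hXeq]
    exact hF.transformsSystem hr1 (fun s w hw => ⟨(htube s w hw).1, (htube s w hw).2.1⟩) I g
  · rw [hderiv] at hE
    obtain ⟨h1, h2⟩ := FloquetForm.differentiableAt_poincareMap_of_fundamental hD hf1 hφD hφd hper hΨ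
      hΨT hΨf t₀ (hv t₀) hE hP
    exact ⟨h1, FloquetForm.re_aroots_of_normal_form hT.ne' hSS hSS' hS h2⟩
  · obtain ⟨h0, h1⟩ := hF.hasFDerivAt_remainder hδ htube s
    rw [Prod.zero_eq_mk] at h0
    refine ⟨congrArg Prod.fst h0, congrArg (fun p => p.2.1) h0, congrArg (fun p => p.2.2) h0,
      ?_, ?_, ?_⟩
    · exact h1.fst
    · exact h1.snd.fst
    · exact h1.snd.snd
  · have h := hF.remainder_add hr1 s (v, w)
    rw [FloquetForm.IsFloquetFrame.flip_apply, FloquetForm.reflection_apply] at h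
    have h₀ := congrArg Prod.fst h
    have h₁ := congrArg (fun p => p.2.1) h
    have h₂ := congrArg (fun p => p.2.2) h
    exact ⟨h₀, h₁, h₂⟩
  · have h := hF.pull_add hr1 s (v, w) (g t (X (s + T, v, w)))
    rw [FloquetForm.IsFloquetFrame.flip_apply, FloquetForm.reflection_apply] at h
    have h1 : X (s + T, v, w) = X (s, v, -w) := hF.tube_add (s, v, w)
    rw [h1] at h
    simp only [h1]
    have h₀ := congrArg Prod.fst h
    have h₁ := congrArg (fun p => p.2.1) h
    have h₂ := congrArg (fun p => p.2.2) h
    exact ⟨h₀, h₁, h₂⟩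
  · rw [hXeq]
    have h := (ContinuousLinearMap.le_opNorm
      (fderiv ℝ X (s, v, w)).inverse (g t (X (s, v, w)))).trans
      (mul_le_mul_of_nonneg_right (htube s (v, w) hvw.le).2.2 (norm_nonneg _))
    exact ⟨(norm_fst_le _).trans h, (norm_fst_le _).trans ((norm_snd_le _).trans h),
      (norm_snd_le _).trans ((norm_snd_le _).trans h)⟩
  · rw [Matrix.smul_apply, hL j hj, smul_zero]
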